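/- Conventions. For a symmetric monoidal category $\mathcal V$, let $\mathbf{CoComon}(\mathcal V)$ be the category of cocommutative comonoids in $\mathcal V$; the tensor product of $\mathcal V$ makes it a cartesian category (the tensor product is the categorical product). For a cartesian category $\mathcal C$, $\mathbf{Ab}(\mathcal C)$ and $\mathbf{Ring}(\mathcal C)$ are the categories of abelian group objects and of (associative, unital, not necessarily commutative) ring objects in $\mathcal C$. $\mathbf{GrRing}(\mathcal C)$ is the category of graded ring objects: sequences $(A_n)_{n\ge 0}$ in $\mathbf{Ab}(\mathcal C)$ with a unit $1\to A_0$ and multiplications $A_n\times A_m\to A_{n+m}$ that are associative, unital and distributive. A graded ring object in $\mathbf{CoComon}(\mathcal V)$ is called a coalgebraic (or Hopf) ring in $\mathcal V$. Let $\mathcal V$ be a cocomplete closed symmetric monoidal category and $F\colon s\mathbf{Set}\to\mathcal V$ a strong symmetric monoidal functor which is a left adjoint ($s\mathbf{Set}$ with its cartesian structure). Each $F\Delta^n$ is a cocommutative comonoid through the diagonal of $\Delta^n$. For $A\in\mathbf{Ab}(\mathbf{CoComon}(\mathcal V))$ let $B_\bullet A$ be the simplicial bar construction: $B_pA=A^{\otimes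 p}$, where $d_0$ and $d_p$ drop the first and the last factor, the other $d_i$ add two neighbouring factors, and the degeneracies insert zeros. Let $BA=|B_\bullet A|=\int^{p}A^{\otimes p}\otimes F\Delta^p$, the coend being formed in $\mathcal V$ with the induced cocommutative comonoid structure. For $x_1,\dots,x_p\colon T\to A$ and $d\colon T\to F\Delta^p$ in $\mathbf{CoComon}(\mathcal V)$ write $[x_1|\dots|x_p;d]\colon T\to BA$ for the resulting morphism. (1) There is exactly one choice of the following data. (a) Abelian group structures on the objects $BA$, for $A\in \mathbf{Ab}(\mathbf{CoComon}(\mathcal V))$, with $$[x_1|\dots|x_p;d]+[y_1|\dots|y_p;d]=[x_1+y_1|\dots|x_p+y_p;d],$$ such that $B$ becomes a functor $\mathbf{Ab}(\mathbf{CoComon}(\mathcal V))\to\mathbf{Ab}(\mathbf{CoComon}(\mathcal V))$. Put $B^0=\mathrm{id}$ and $B^{n+1}=B\circ B^n$. (b) For each $S\in\mathbf{Ring}(\mathbf{CoComon}(\mathcal V))$ a graded ring structure $\smile_{n,m}\colon B^nS\otimes B^mS\to B^{n+m}S$ on $B^*S=(B^nS)_{n\ge0}$, natural in $S$, whose unit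 is that of $S$, such that $\smile_{0,0}$ is the multiplication of $S$ and, for all $n,m\ge 0$, $$s\smile_{0,m+1}[x_1|\dots|x_p;d]=[s\smile_{0,m} x_1|\dots|s\smile_{0,m} x_p;d],$$ $$[x_1|\dots|x_p;d]\smile_{n+1,m}y=[x_1\smile_{n,m} y|\dots|x_p\smile_{n,m} y;d].$$ Thus the iterated bar construction is a functor $$B^*\colon\mathbf{Ring}(\mathbf{CoComon}(\mathcal V))\to\mathbf{GrRing}(\mathbf{CoComon}(\mathcal V)).$$ (2) Let moreover $\mathcal W$ be a cocomplete closed symmetric monoidal category and $G\colon\mathcal V\to\mathcal W$ a strong symmetric monoidal functor which is a left adjoint, and let $B^*$ for $\mathcal W$ be the iterated bar construction of (1) for the functor $GF\colon s\mathbf{Set}\to\mathcal W$. Write $G$ also for the functors that $G$ induces on ring objects and on graded ring objects in cocommutative comonoids. Then there is a natural isomorphism $B^*\circ G\cong G\circ B^*$ of functors $\mathbf{Ring}(\mathbf{CoComon}(\mathcal V))\to\mathbf{GrRing}(\mathbf{CoComon}(\mathcal W))$. -/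

import Mathlib

open CategoryTheory MonoidalCategory CartesianMonoidalCategory Limits Opposite
open scoped ComonObj MonObj AddMonObj

universe v v' u u'

namespace HopfBar

section CoComon

variable {V : Type u} [Category.{v} V] [MonoidalCategory V] [SymmetricCategory V]

lemma comul_comul_comul_comm (A : V) [ComonObj A] [IsCommComonObj A] :
    Δ[A] ≫ (Δ[A] ⊗ₘ Δ[A]) ≫ tensorμ A A A A = Δ[A] ≫ (Δ[A] ⊗ₘ Δ[A]) := by
  let _ : MonObj (op A) := Comon.ComonToMonOpOpObjMon ⟨A⟩
  have : IsCommMonObj (op A) := ⟨Quiver.Hom.unop_inj (IsCommComonObj.comul_comm A)⟩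
  have h := congrArg Quiver.Hom.unop (MonObj.mul_mul_mul_comm (op A))
  have e : (tensorμ (op A) (op A) (op A) (op A)).unop = tensorμ A A A A := by
    simp
  simp only [unop_comp, e, Category.assoc] at h
  exact h

/-- The morphism of `V` underlying a morphism of cocommutative comonoids. -/
def homOf {A B : CommComon V} (f : A ⟶ B) : A.X ⟶ B.X := f.hom.hom

/-- Morphisms of cocommutative comonoids from morphisms of the underlying objects. -/
def homMk {A B : CommComon V} (f : A.X ⟶ B.X) (h : IsComonHom f) : A ⟶ B :=
  InducedCategory.homMk (X := A) (Y := B) (F := CommComon.toComon)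
    (Comon.Hom.mk (M := A.toComon) (N := B.toComon) f (isComonHom_hom := h))

instance {A B : CommComon V} (f : A ⟶ B) : IsComonHom (homOf f) := f.hom.isComonHom_hom

lemma homOf_injective {A B : CommComon V} {f g : A ⟶ B} (h : homOf f = homOf g) : f = g :=
  CommComon.hom_ext _ _ h

@[simp] lemma homOf_homMk {A B : CommComon V} (f : A.X ⟶ B.X) (h : IsComonHom f) :
    homOf (homMk f h) = f := rfl
@[simp] lemma homOf_id (A : CommComon V) : homOf (𝟙 A) = 𝟙 A.X := rfl
@[simp] lemma homOf_comp {A B C : CommComon V} (f : A ⟶ B) (g : B ⟶ C) :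
    homOf (f ≫ g) = homOf f ≫ homOf g := rfl

/-- Isomorphisms of cocommutative comonoids from isomorphisms of the underlying objects. -/
def isoMk {A B : CommComon V} (e : A.X ≅ B.X) (h : IsComonHom e.hom) : A ≅ B where
  hom := homMk e.hom h
  inv := homMk e.inv inferInstance
  hom_inv_id := homOf_injective e.hom_inv_id
  inv_hom_id := homOf_injective e.inv_hom_id

variable (V) in
/-- The forgetful functor from cocommutative comonoids to `V`. -/
def forgetV : CommComon V ⥤ V where
  obj A := A.X
  map f := homOf f

lemma isComonHom_associator (A B C : Comon V) : IsComonHom (α_ A.X B.X C.X).hom := by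
  have e : (α_ A B C).hom.hom = (α_ A.X B.X C.X).hom := by
    rw [Comon.monoidal_associator_hom_hom]
    change 𝟙 (A.X ⊗ B.X) ▷ C.X ≫ (α_ A.X B.X C.X).hom ≫ A.X ◁ 𝟙 (B.X ⊗ C.X) = _
    simp
  have := (α_ A B C).hom.isComonHom_hom
  rw [e] at this
  exact this

attribute [local instance] ComonObj.instTensorUnit in
lemma isComonHom_leftUnitor (A : Comon V) : IsComonHom (λ_ A.X).hom := by
  have e : (λ_ A).hom.hom = (λ_ A.X).hom := by
    rw [Comon.monoidal_leftUnitor_hom_hom]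
    change 𝟙 (𝟙_ V) ▷ A.X ≫ (λ_ A.X).hom = _
    simp
  have := (λ_ A).hom.isComonHom_hom
  rw [e] at this
  exact this

attribute [local instance] ComonObj.instTensorUnit in
lemma isComonHom_rightUnitor (A : Comon V) : IsComonHom (ρ_ A.X).hom := by
  have e : (ρ_ A).hom.hom = (ρ_ A.X).hom := by
    rw [Comon.monoidal_rightUnitor_hom_hom]
    change A.X ◁ 𝟙 (𝟙_ V) ≫ (ρ_ A.X).hom = _
    simp
  have := (ρ_ A).hom.isComonHom_hom
  rw [e] at this
  exact this

attribute [local instance] ComonObj.instTensorUnit in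
/-- The tensor product of cocommutative comonoids: it is the tensor product of `V` on underlying
objects and morphisms. -/
instance : MonoidalCategoryStruct (CommComon V) where
  tensorObj A B := ⟨A.X ⊗ B.X⟩
  whiskerLeft A _ _ f := homMk (A.X ◁ homOf f) (A.toComon ◁ f.hom).isComonHom_hom
  whiskerRight f B := homMk (homOf f ▷ B.X) (f.hom ▷ B.toComon).isComonHom_hom
  tensorHom f g := homMk (homOf f ⊗ₘ homOf g) (f.hom ⊗ₘ g.hom).isComonHom_hom
  tensorUnit := CommComon.trivial V
  associator A B C := isoMk (α_ A.X B.X C.X)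
    (isComonHom_associator A.toComon B.toComon C.toComon)
  leftUnitor A := isoMk (λ_ A.X) (isComonHom_leftUnitor A.toComon)
  rightUnitor A := isoMk (ρ_ A.X) (isComonHom_rightUnitor A.toComon)

section
variable {A B C D : CommComon V}

lemma tensorObj_X : (A ⊗ B).X = A.X ⊗ B.X := rfl
lemma tensorUnit_X : (𝟙_ (CommComon V)).X = 𝟙_ V := rfl
@[simp] lemma homOf_whiskerLeft (f : B ⟶ C) : homOf (A ◁ f) = A.X ◁ homOf f := rfl
@[simp] lemma homOf_whiskerRight (f : B ⟶ C) : homOf (f ▷ A) = homOf f ▷ A.X := rfl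
@[simp] lemma homOf_tensorHom (f : A ⟶ B) (g : C ⟶ D) :
    homOf (f ⊗ₘ g) = homOf f ⊗ₘ homOf g := rfl
@[simp] lemma homOf_associator_hom : homOf (α_ A B C).hom = (α_ A.X B.X C.X).hom := rfl
@[simp] lemma homOf_leftUnitor_hom : homOf (λ_ A).hom = (λ_ A.X).hom := rfl
@[simp] lemma homOf_rightUnitor_hom : homOf (ρ_ A).hom = (ρ_ A.X).hom := rfl

end

/-- The tensor product of `V` makes cocommutative comonoids a monoidal category. -/
instance : MonoidalCategory (CommComon V) where
  tensorHom_def _ _ := homOf_injective (MonoidalCategory.tensorHom_def _ _)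
  id_tensorHom_id _ _ := homOf_injective (MonoidalCategory.id_tensorHom_id _ _)
  tensorHom_comp_tensorHom _ _ _ _ :=
    homOf_injective (MonoidalCategory.tensorHom_comp_tensorHom _ _ _ _)
  whiskerLeft_id _ _ := homOf_injective (MonoidalCategory.whiskerLeft_id _ _)
  id_whiskerRight _ _ := homOf_injective (MonoidalCategory.id_whiskerRight _ _)
  associator_naturality _ _ _ := homOf_injective (MonoidalCategory.associator_naturality _ _ _)
  leftUnitor_naturality _ := homOf_injective (MonoidalCategory.leftUnitor_naturality _)
  rightUnitor_naturality _ := homOf_injective (MonoidalCategory.rightUnitor_naturality _)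
  pentagon _ _ _ _ := homOf_injective (MonoidalCategory.pentagon _ _ _ _)
  triangle _ _ := homOf_injective (MonoidalCategory.triangle _ _)

/-- The counit of a cocommutative comonoid, as a morphism of comonoids. -/
def counitHom (A : CommComon V) : A ⟶ 𝟙_ (CommComon V) :=
  homMk ε[A.X] ((Comon.uniqueHomToTrivial A.toComon).default).isComonHom_hom

/-- The comultiplication of a cocommutative comonoid, as a morphism of comonoids. -/
def comulHom (A : CommComon V) : A ⟶ A ⊗ A :=
  homMk Δ[A.X]
    { hom_counit := by
        change Δ[A.X] ≫ (ε[A.X] ⊗ₘ ε[A.X]) ≫ (λ_ _).hom = _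
        rw [ComonObj.counit_comul_hom_assoc]; simp
      hom_comul := by
        change Δ[A.X] ≫ Δ[A.X ⊗ A.X] = _
        rw [Comon.tensorObj_comul]
        exact comul_comul_comul_comm A.X }

@[simp] lemma homOf_counitHom (A : CommComon V) : homOf (counitHom A) = ε[A.X] := rfl
@[simp] lemma homOf_comulHom (A : CommComon V) : homOf (comulHom A) = Δ[A.X] := rfl

/-- The unit of `V`, with its unique comonoid structure, is a terminal cocommutative comonoid. -/
def isTerminalUnit : IsTerminal (𝟙_ (CommComon V)) :=
  IsTerminal.ofUniqueHom counitHom (fun _ f => homOf_injective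
    ((Category.comp_id _).symm.trans f.hom.isComonHom_hom.hom_counit))

lemma pair_unique {T A B : V} [ComonObj T] [ComonObj A] [ComonObj B] (m : T ⟶ A ⊗ B)
    [IsComonHom m] :
    Δ[T] ≫ ((m ≫ A ◁ ε[B] ≫ (ρ_ A).hom) ⊗ₘ (m ≫ ε[A] ▷ B ≫ (λ_ B).hom)) = m := by
  have h : m ≫ Δ[A ⊗ B] = Δ[T] ≫ (m ⊗ₘ m) := IsComonHom.hom_comul m
  rw [← tensorHom_comp_tensorHom, ← reassoc_of% h, Comon.tensorObj_comul]
  have : (Δ[A] ⊗ₘ Δ[B]) ≫ tensorμ A A B B ≫ ((A ◁ ε[B] ≫ (ρ_ A).hom) ⊗ₘ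
      (ε[A] ▷ B ≫ (λ_ B).hom)) = 𝟙 _ := by
    rw [← tensorHom_comp_tensorHom]
    have e : (A ◁ ε[B] ⊗ₘ ε[A] ▷ B) = ((𝟙 A ⊗ₘ ε[B]) ⊗ₘ (ε[A] ⊗ₘ 𝟙 B)) := by simp
    rw [e, ← tensorμ_natural_assoc]
    have e' : tensorμ A (𝟙_ V) (𝟙_ V) B ≫ ((ρ_ A).hom ⊗ₘ (λ_ B).hom) =
        ((ρ_ A).hom ⊗ₘ (λ_ B).hom) := by
      have e₁ : (β_ (𝟙_ V) (𝟙_ V)).hom = 𝟙 _ := by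
        rw [braiding_tensorUnit_left, unitors_equal]; simp
      rw [tensorμ, e₁]
      monoidal
    rw [e']
    simp
  simp [this]

/-- Cocommutative comonoids form a cartesian monoidal category: the tensor product of `V` is the
categorical product, with projections `A ⊗ ε` and `ε ⊗ B` and pairing `Δ ≫ (f ⊗ g)`. -/
instance : CartesianMonoidalCategory (CommComon V) where
  isTerminalTensorUnit := isTerminalUnit
  fst A B := A ◁ counitHom B ≫ (ρ_ A).hom
  snd A B := counitHom A ▷ B ≫ (λ_ B).hom
  fst_def _ _ := rfl
  snd_def _ _ := rfl
  tensorProductIsBinaryProduct A B := BinaryFan.IsLimit.mk _ (fun f g => comulHom _ ≫ (f ⊗ₘ g))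
    (fun {T} f g => homOf_injective (by
      change (Δ[T.X] ≫ (homOf f ⊗ₘ homOf g)) ≫ A.X ◁ ε[B.X] ≫ (ρ_ A.X).hom = homOf f
      rw [Category.assoc, ← id_tensorHom, tensorHom_comp_tensorHom_assoc, IsComonHom.hom_counit]
      simp))
    (fun {T} f g => homOf_injective (by
      change (Δ[T.X] ≫ (homOf f ⊗ₘ homOf g)) ≫ ε[A.X] ▷ B.X ≫ (λ_ B.X).hom = homOf g
      rw [Category.assoc, ← tensorHom_id, tensorHom_comp_tensorHom_assoc, IsComonHom.hom_counit]
      simp))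
    (fun {T} f g m h₁ h₂ => homOf_injective (by
      subst h₁ h₂
      exact (pair_unique (A := A.X) (B := B.X) (homOf m)).symm))

/-- The symmetry of the cartesian category of cocommutative comonoids. -/
instance : BraidedCategory (CommComon V) := .ofCartesianMonoidalCategory

end CoComon
section Power

variable {C : Type u} [Category.{v} C] [CartesianMonoidalCategory C]

/-- The `n`-fold power of an object for the cartesian product. -/
def pow (A : C) : ℕ → C
  | 0 => 𝟙_ C
  | n + 1 => A ⊗ pow A n

/-- The projections from a power. -/
def powProj (A : C) : (n : ℕ) → Fin n → (pow A n ⟶ A)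
  | 0, i => i.elim0
  | n + 1, i => Fin.cases (fst A (pow A n)) (fun j => snd A (pow A n) ≫ powProj A n j) i

/-- The morphism to a power with given components. -/
def powLift {T A : C} : {n : ℕ} → (Fin n → (T ⟶ A)) → (T ⟶ pow A n)
  | 0, _ => toUnit T
  | _ + 1, x => lift (x 0) (powLift fun i => x i.succ)

lemma powLift_proj {T A : C} {n : ℕ} (x : Fin n → (T ⟶ A)) (i : Fin n) :
    powLift x ≫ powProj A n i = x i := by
  induction n with
  | zero => exact i.elim0
  | succ n ih =>
    refine Fin.cases ?_ (fun j => ?_) i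
    · exact lift_fst _ _
    · change lift _ _ ≫ snd _ _ ≫ powProj A n j = _
      rw [lift_snd_assoc, ih]

lemma powLift_proj_assoc {T A Z : C} {n : ℕ} (x : Fin n → (T ⟶ A)) (i : Fin n) (h : A ⟶ Z) :
    powLift x ≫ powProj A n i ≫ h = x i ≫ h := by
  rw [← Category.assoc, powLift_proj]

lemma pow_hom_ext {T A : C} {n : ℕ} {f g : T ⟶ pow A n}
    (h : ∀ i, f ≫ powProj A n i = g ≫ powProj A n i) : f = g := by
  induction n with
  | zero => exact toUnit_unique f g
  | succ n ih =>
    refine CartesianMonoidalCategory.hom_ext _ _ (h 0) (ih fun i => ?_)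
    exact (Category.assoc _ _ _).trans ((h i.succ).trans (Category.assoc _ _ _).symm)

end Power

section Cartesian

variable {C : Type u} [Category.{v} C] [CartesianMonoidalCategory C] [BraidedCategory C]

variable (C) in
/-- An abelian group object in a cartesian category, written additively. -/
structure AbObj where
  /-- The underlying object. -/
  X : C
  [grp : AddGrpObj X]
  [comm : IsCommAddMonObj X]

attribute [instance] AbObj.grp AbObj.comm

namespace AbObj

/-- A morphism of abelian group objects. -/
@[ext]
structure Hom (A B : AbObj C) where
  /-- The underlying morphism. -/
  hom : A.X ⟶ B.X
  [isAddMonHom : IsAddMonHom hom]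

attribute [instance] Hom.isAddMonHom

@[simps]
instance : Category (AbObj C) where
  Hom A B := Hom A B
  id A := { hom := 𝟙 A.X }
  comp f g := { hom := f.hom ≫ g.hom }

@[ext]
lemma hom_ext {A B : AbObj C} {f g : A ⟶ B} (h : f.hom = g.hom) : f = g := Hom.ext h

end AbObj

variable (C) in
/-- The additive abelian group object of a ring object. -/
@[simps]
def ringToAb : RingObjCat C ⥤ AbObj C where
  obj R := { X := R.X }
  map f := { hom := f.hom }

/-- A graded ring structure on a sequence of abelian group objects: a unit in degree `0` and
multiplications `A n × A m ⟶ A (n + m)` which are associative, unital and distributive.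
The index `k = n + m` is a separate variable, and the axioms are written with generalized
elements. -/
structure GrRingStr (A : ℕ → AbObj C) where
  /-- The unit. -/
  one : 𝟙_ C ⟶ (A 0).X
  /-- The multiplication. -/
  mul : ∀ {n m k : ℕ}, n + m = k → ((A n).X ⊗ (A m).X ⟶ (A k).X)
  one_mul : ∀ {T : C} {n : ℕ} (x : T ⟶ (A n).X),
    lift (toUnit T ≫ one) x ≫ mul (Nat.zero_add n) = x
  mul_one : ∀ {T : C} {n : ℕ} (x : T ⟶ (A n).X),
    lift x (toUnit T ≫ one) ≫ mul (Nat.add_zero n) = x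
  mul_assoc : ∀ {T : C} {a b c ab bc abc : ℕ} (h₁ : a + b = ab) (h₂ : ab + c = abc)
    (h₃ : b + c = bc) (h₄ : a + bc = abc)
    (x : T ⟶ (A a).X) (y : T ⟶ (A b).X) (z : T ⟶ (A c).X),
    lift (lift x y ≫ mul h₁) z ≫ mul h₂ = lift x (lift y z ≫ mul h₃) ≫ mul h₄
  mul_add : ∀ {T : C} {n m k : ℕ} (h : n + m = k) (x : T ⟶ (A n).X) (y z : T ⟶ (A m).X),
    lift x (y + z) ≫ mul h = lift x y ≫ mul h + lift x z ≫ mul h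
  add_mul : ∀ {T : C} {n m k : ℕ} (h : n + m = k) (x y : T ⟶ (A n).X) (z : T ⟶ (A m).X),
    lift (x + y) z ≫ mul h = lift x z ≫ mul h + lift y z ≫ mul h

variable (C) in
/-- A graded ring object in a cartesian category. -/
structure GrRing where
  /-- The abelian group object in each degree. -/
  deg : ℕ → AbObj C
  /-- The graded multiplication. -/
  str : GrRingStr deg

namespace GrRing

/-- A morphism of graded ring objects. -/
@[ext]
structure Hom (A B : GrRing C) where
  /-- The morphism of abelian group objects in each degree. -/
  hom : ∀ n, A.deg n ⟶ B.deg n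
  map_one : A.str.one ≫ (hom 0).hom = B.str.one
  map_mul : ∀ {n m k : ℕ} (h : n + m = k),
    A.str.mul h ≫ (hom k).hom = ((hom n).hom ⊗ₘ (hom m).hom) ≫ B.str.mul h

@[simps]
instance : Category (GrRing C) where
  Hom A B := Hom A B
  id A := { hom := fun _ => 𝟙 _, map_one := by simp, map_mul := by simp }
  comp f g :=
    { hom := fun n => f.hom n ≫ g.hom n
      map_one := by simp [reassoc_of% f.map_one, g.map_one]
      map_mul := fun h => by simp [reassoc_of% f.map_mul h, g.map_mul h] }

end GrRing

/-- The sums over the consecutive segments cut out by a monotone map `θ : [m] → [n]`: the `j`-th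
one is the sum of the `x i` with `θ j ≤ i < θ (j + 1)`. -/
def segSum {M : Type*} [AddCommMonoid M] {m n : ℕ} (θ : Fin (m + 1) →o Fin (n + 1))
    (x : Fin n → M) (j : Fin m) : M :=
  ∑ i : Fin n with θ j.castSucc ≤ i.castSucc ∧ i.castSucc < θ j.succ, x i

section segSum

/-- The partial sums of a finite sequence. -/
def partSum {M : Type*} [AddCommMonoid M] {n : ℕ} (x : Fin n → M) (a : Fin (n + 1)) : M :=
  ∑ i : Fin n with i.castSucc < a, x i

variable {M : Type*} [AddCommGroup M]

lemma segSum_eq {m n : ℕ} (θ : Fin (m + 1) →o Fin (n + 1)) (x : Fin n → M) (j : Fin m) :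
    segSum θ x j = partSum x (θ j.succ) - partSum x (θ j.castSucc) := by
  have hθ : θ j.castSucc ≤ θ j.succ := θ.monotone (Fin.castSucc_le_succ j)
  rw [eq_sub_iff_add_eq, segSum, partSum, partSum, ← Finset.sum_union]
  · congr 1
    ext i
    simp only [Finset.mem_union, Finset.mem_filter, Finset.mem_univ, true_and]
    constructor
    · rintro (h | h)
      exacts [h.2, h.trans_le hθ]
    · intro h
      rcases lt_or_ge i.castSucc (θ j.castSucc) with h' | h'
      exacts [Or.inr h', Or.inl ⟨h', h⟩]
  · rw [Finset.disjoint_filter]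
    intro i _ h
    exact not_lt.2 h.1

lemma partSum_zero {n : ℕ} (x : Fin n → M) : partSum x 0 = 0 := by
  simp [partSum]

lemma partSum_succ {n : ℕ} (x : Fin n → M) (j : Fin n) :
    partSum x j.succ = partSum x j.castSucc + x j := by
  have : (Finset.univ.filter fun i : Fin n => i.castSucc < j.succ) =
      insert j (Finset.univ.filter fun i : Fin n => i.castSucc < j.castSucc) := by
    ext i
    simp only [Finset.mem_filter, Finset.mem_univ, true_and, Finset.mem_insert]
    rw [Fin.lt_def, Fin.lt_def, Fin.ext_iff]
    simp only [Fin.val_castSucc, Fin.val_succ]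
    omega
  rw [partSum, this, Finset.sum_insert (by simp), add_comm, partSum]

lemma partSum_segSum {m n : ℕ} (θ : Fin (m + 1) →o Fin (n + 1)) (x : Fin n → M)
    (a : Fin (m + 1)) : partSum (segSum θ x) a = partSum x (θ a) - partSum x (θ 0) := by
  induction a using Fin.induction with
  | zero => simp [partSum_zero]
  | succ j ih => rw [partSum_succ, ih, segSum_eq]; abel

lemma segSum_id {n : ℕ} (x : Fin n → M) (j : Fin n) : segSum OrderHom.id x j = x j := by
  rw [segSum_eq]
  simp [partSum_succ]

lemma segSum_comp {l m n : ℕ} (φ : Fin (l + 1) →o Fin (m + 1)) (θ : Fin (m + 1) →o Fin (n + 1))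
    (x : Fin n → M) (j : Fin l) : segSum (θ.comp φ) x j = segSum φ (segSum θ x) j := by
  simp [segSum_eq, partSum_segSum]

end segSum

lemma comp_segSum {A : AbObj C} {T T' : C} (f : T' ⟶ T) {m n : ℕ}
    (θ : Fin (m + 1) →o Fin (n + 1)) (x : Fin n → (T ⟶ A.X)) (j : Fin m) :
    f ≫ segSum θ x j = segSum θ (fun i => f ≫ x i) j := by
  let F : (T ⟶ A.X) →+ (T' ⟶ A.X) :=
    { toFun := fun g => f ≫ g
      map_zero' := AddMonObj.comp_zero f
      map_add' := AddMonObj.comp_add f }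
  exact map_sum F _ _

lemma segSum_comp_hom {A B : AbObj C} {T : C} (f : A ⟶ B) {m n : ℕ}
    (θ : Fin (m + 1) →o Fin (n + 1)) (x : Fin n → (T ⟶ A.X)) (j : Fin m) :
    segSum θ x j ≫ f.hom = segSum θ (fun i => x i ≫ f.hom) j := by
  let F : (T ⟶ A.X) →+ (T ⟶ B.X) :=
    { toFun := fun g => g ≫ f.hom
      map_zero' := AddMonObj.zero_comp f.hom
      map_add' := fun a b => AddMonObj.add_comp a b f.hom }
  exact map_sum F _ _

variable (C) in
/-- The simplicial (reduced) bar construction of abelian group objects: `B_n A = A ^ n`, and a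
monotone map `θ : [m] → [n]` sends `(x_0, …, x_{n-1})` to the `m`-tuple of the sums over the
segments cut out by `θ`. Thus the face `d_0` drops the first entry, `d_n` drops the last one,
`d_i` adds two neighbouring entries, and the degeneracies insert zeros. -/
def simplicialBar : AbObj C ⥤ SimplexCategoryᵒᵖ ⥤ C where
  obj A :=
    { obj := fun n => pow A.X n.unop.len
      map := fun θ => powLift (segSum θ.unop.toOrderHom (powProj A.X _))
      map_id := fun n => pow_hom_ext fun i => by
        rw [powLift_proj, Category.id_comp]
        exact segSum_id _ _
      map_comp := fun θ φ => pow_hom_ext fun i => by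
        rw [powLift_proj, Category.assoc, powLift_proj, comp_segSum]
        simp only [powLift_proj]
        exact segSum_comp _ _ _ _ }
  map f :=
    { app := fun n => powLift fun i => powProj _ n.unop.len i ≫ f.hom
      naturality := fun n m θ => pow_hom_ext fun i => by
        dsimp
        simp only [Category.assoc, powLift_proj, powLift_proj_assoc, segSum_comp_hom, comp_segSum] }
  map_id A := by
    ext n
    exact pow_hom_ext fun i => by
      dsimp
      rw [powLift_proj, Category.comp_id, Category.id_comp]
  map_comp f g := by
    ext n
    exact pow_hom_ext fun i => by
      dsimp
      rw [powLift_proj, Category.assoc, powLift_proj, powLift_proj_assoc, Category.assoc]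

end Cartesian

section MapLemmas

variable {C : Type u} [Category.{v} C] [CartesianMonoidalCategory C]
  {D : Type u'} [Category.{v'} D] [CartesianMonoidalCategory D]
  (Φ : C ⥤ D) [Φ.Monoidal]

open scoped Obj

lemma exists_common₂ {A B : C} {T : D} (x : T ⟶ Φ.obj A) (y : T ⟶ Φ.obj B) :
    ∃ u : T ⟶ Φ.obj (A ⊗ B), x = u ≫ Φ.map (fst A B) ∧ y = u ≫ Φ.map (snd A B) :=
  ⟨lift x y ≫ Functor.LaxMonoidal.μ Φ A B, by simp, by simp⟩

lemma exists_common₃ {A B E : C} {T : D} (x : T ⟶ Φ.obj A) (y : T ⟶ Φ.obj B) (z : T ⟶ Φ.obj E) :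
    ∃ (T₀ : C) (u : T ⟶ Φ.obj T₀) (x₀ : T₀ ⟶ A) (y₀ : T₀ ⟶ B) (z₀ : T₀ ⟶ E),
      x = u ≫ Φ.map x₀ ∧ y = u ≫ Φ.map y₀ ∧ z = u ≫ Φ.map z₀ := by
  obtain ⟨v, rfl, rfl⟩ := exists_common₂ Φ y z
  obtain ⟨u, rfl, rfl⟩ := exists_common₂ Φ x v
  exact ⟨_, u, fst _ _, snd _ _ ≫ fst _ _, snd _ _ ≫ snd _ _, rfl, by simp, by simp⟩

lemma lift_comp_map_μ {T₀ A B E : C} {T : D} (u : T ⟶ Φ.obj T₀) (x : T₀ ⟶ A) (y : T₀ ⟶ B)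
    (f : A ⊗ B ⟶ E) :
    lift (u ≫ Φ.map x) (u ≫ Φ.map y) ≫ Functor.LaxMonoidal.μ Φ A B ≫ Φ.map f =
      u ≫ Φ.map (lift x y ≫ f) := by
  rw [← comp_lift, Category.assoc, Functor.Monoidal.lift_μ_assoc, Φ.map_comp]

lemma comp_map_add {T₀ A : C} [AddMonObj A] {T : D} (u : T ⟶ Φ.obj T₀) (x y : T₀ ⟶ A) :
    u ≫ Φ.map x + u ≫ Φ.map y = u ≫ Φ.map (x + y) := by
  rw [Functor.map_add', AddMonObj.comp_add]

lemma map_mul_add {A B E : C} [AddMonObj B] [AddMonObj E] (f : A ⊗ B ⟶ E)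
    (h : ∀ {T : C} (x : T ⟶ A) (y z : T ⟶ B),
      lift x (y + z) ≫ f = lift x y ≫ f + lift x z ≫ f)
    {T : D} (x : T ⟶ Φ.obj A) (y z : T ⟶ Φ.obj B) :
    lift x (y + z) ≫ Functor.LaxMonoidal.μ Φ A B ≫ Φ.map f =
      lift x y ≫ Functor.LaxMonoidal.μ Φ A B ≫ Φ.map f +
        lift x z ≫ Functor.LaxMonoidal.μ Φ A B ≫ Φ.map f := by
  obtain ⟨T₀, u, x, y, z, rfl, rfl, rfl⟩ := exists_common₃ Φ x y z
  simp only [comp_map_add, lift_comp_map_μ, h]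

lemma map_add_mul {A B E : C} [AddMonObj A] [AddMonObj E] (f : A ⊗ B ⟶ E)
    (h : ∀ {T : C} (x y : T ⟶ A) (z : T ⟶ B),
      lift (x + y) z ≫ f = lift x z ≫ f + lift y z ≫ f)
    {T : D} (x y : T ⟶ Φ.obj A) (z : T ⟶ Φ.obj B) :
    lift (x + y) z ≫ Functor.LaxMonoidal.μ Φ A B ≫ Φ.map f =
      lift x z ≫ Functor.LaxMonoidal.μ Φ A B ≫ Φ.map f +
        lift y z ≫ Functor.LaxMonoidal.μ Φ A B ≫ Φ.map f := by
  obtain ⟨T₀, u, x, y, z, rfl, rfl, rfl⟩ := exists_common₃ Φ x y z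
  simp only [comp_map_add, lift_comp_map_μ, h]

lemma map_one_mul {A B : C} (e : 𝟙_ C ⟶ A) (f : A ⊗ B ⟶ B)
    (h : ∀ {T : C} (x : T ⟶ B), lift (toUnit T ≫ e) x ≫ f = x) {T : D} (x : T ⟶ Φ.obj B) :
    lift (toUnit T ≫ Functor.LaxMonoidal.ε Φ ≫ Φ.map e) x ≫
      Functor.LaxMonoidal.μ Φ A B ≫ Φ.map f = x := by
  have e' : toUnit T ≫ Functor.LaxMonoidal.ε Φ ≫ Φ.map e = x ≫ Φ.map (toUnit _ ≫ e) := by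
    rw [Φ.map_comp, ← Functor.Monoidal.toUnit_ε_assoc, comp_toUnit_assoc]
  have := lift_comp_map_μ Φ x (toUnit _ ≫ e) (𝟙 _) f
  rw [h, Φ.map_id, Category.comp_id] at this
  rw [e', this]

lemma map_mul_one {A B : C} (e : 𝟙_ C ⟶ A) (f : B ⊗ A ⟶ B)
    (h : ∀ {T : C} (x : T ⟶ B), lift x (toUnit T ≫ e) ≫ f = x) {T : D} (x : T ⟶ Φ.obj B) :
    lift x (toUnit T ≫ Functor.LaxMonoidal.ε Φ ≫ Φ.map e) ≫
      Functor.LaxMonoidal.μ Φ B A ≫ Φ.map f = x := by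
  have e' : toUnit T ≫ Functor.LaxMonoidal.ε Φ ≫ Φ.map e = x ≫ Φ.map (toUnit _ ≫ e) := by
    rw [Φ.map_comp, ← Functor.Monoidal.toUnit_ε_assoc, comp_toUnit_assoc]
  have := lift_comp_map_μ Φ x (𝟙 _) (toUnit _ ≫ e) f
  rw [h, Φ.map_id, Category.comp_id] at this
  rw [e', this]

lemma map_mul_assoc {A₁ A₂ A₃ A₁₂ A₂₃ A : C} (f : A₁ ⊗ A₂ ⟶ A₁₂) (g : A₁₂ ⊗ A₃ ⟶ A)
    (f' : A₂ ⊗ A₃ ⟶ A₂₃) (g' : A₁ ⊗ A₂₃ ⟶ A)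
    (h : ∀ {T : C} (x : T ⟶ A₁) (y : T ⟶ A₂) (z : T ⟶ A₃),
      lift (lift x y ≫ f) z ≫ g = lift x (lift y z ≫ f') ≫ g')
    {T : D} (x : T ⟶ Φ.obj A₁) (y : T ⟶ Φ.obj A₂) (z : T ⟶ Φ.obj A₃) :
    lift (lift x y ≫ Functor.LaxMonoidal.μ Φ _ _ ≫ Φ.map f) z ≫
        Functor.LaxMonoidal.μ Φ _ _ ≫ Φ.map g =
      lift x (lift y z ≫ Functor.LaxMonoidal.μ Φ _ _ ≫ Φ.map f') ≫
        Functor.LaxMonoidal.μ Φ _ _ ≫ Φ.map g' := by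
  obtain ⟨T₀, u, x, y, z, rfl, rfl, rfl⟩ := exists_common₃ Φ x y z
  simp only [lift_comp_map_μ, h]

end MapLemmas

section MapRing

variable {C : Type u} [Category.{v} C] [CartesianMonoidalCategory C] [BraidedCategory C]
  {D : Type u'} [Category.{v'} D] [CartesianMonoidalCategory D] [BraidedCategory D]
  (Φ : C ⥤ D) [Φ.Monoidal]

open scoped Obj

instance isCommAddMonObj_obj (A : C) [AddMonObj A] [IsCommAddMonObj A] :
    IsCommAddMonObj (Φ.obj A) where
  add_comm := by
    have e : (β_ (Φ.obj A) (Φ.obj A)).hom ≫ Functor.LaxMonoidal.μ Φ A A = Functor.LaxMonoidal.μ Φ A A ≫ Φ.map (β_ A A).hom := by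
      rw [← cancel_mono (Functor.Monoidal.μIso Φ A A).inv]
      ext <;> simp [← Functor.map_comp]
    change (β_ (Φ.obj A) (Φ.obj A)).hom ≫ Functor.LaxMonoidal.μ Φ A A ≫ Φ.map σ[A] = Functor.LaxMonoidal.μ Φ A A ≫ Φ.map σ[A]
    rw [reassoc_of% e, ← Functor.map_comp, IsCommAddMonObj.add_comm]

/-- The functor on abelian group objects induced by a cartesian functor. -/
@[simps]
def mapAb : AbObj C ⥤ AbObj D where
  obj A := { X := Φ.obj A.X }
  map f := { hom := Φ.map f.hom }

/-- A cartesian functor sends ring objects to ring objects. -/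
instance ringObjObj (R : C) [RingObj R] : RingObj (Φ.obj R) where
  mul_add := (mul_add_iff _).2 fun _ a b c =>
    map_mul_add Φ μ[R] (fun x y z => (mul_add_iff R).1 (RingObj.mul_add R) x y z) a b c
  add_mul := (add_mul_iff _).2 fun _ a b c =>
    map_add_mul Φ μ[R] (fun x y z => (add_mul_iff R).1 (RingObj.add_mul R) x y z) a b c

/-- The functor on ring objects induced by a cartesian functor. -/
@[simps]
def mapRing : RingObjCat C ⥤ RingObjCat D where
  obj R := { X := Φ.obj R.X }
  map f := { hom := Φ.map f.hom, isRingHom := { } }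

/-- The graded ring structure induced on the image of a graded ring object under a cartesian
functor. -/
@[simps]
def mapGrRingStr {A : ℕ → AbObj C} (s : GrRingStr A) :
    GrRingStr (fun n => (mapAb Φ).obj (A n)) where
  one := Functor.LaxMonoidal.ε Φ ≫ Φ.map s.one
  mul := fun h => Functor.LaxMonoidal.μ Φ _ _ ≫ Φ.map (s.mul h)
  one_mul := fun x => map_one_mul Φ s.one (s.mul (Nat.zero_add _)) s.one_mul x
  mul_one := fun x => map_mul_one Φ s.one (s.mul (Nat.add_zero _)) s.mul_one x
  mul_assoc := fun h₁ h₂ h₃ h₄ x y z => map_mul_assoc Φ (s.mul h₁) (s.mul h₂) (s.mul h₃) (s.mul h₄)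
    (s.mul_assoc h₁ h₂ h₃ h₄) x y z
  mul_add := fun h x y z => map_mul_add Φ (s.mul h) (s.mul_add h) x y z
  add_mul := fun h x y z => map_add_mul Φ (s.mul h) (s.add_mul h) x y z

/-- The functor on graded ring objects induced by a cartesian functor. -/
@[simps]
def mapGrRing : GrRing C ⥤ GrRing D where
  obj A := { deg := fun n => (mapAb Φ).obj (A.deg n), str := mapGrRingStr Φ A.str }
  map f :=
    { hom := fun n => (mapAb Φ).map (f.hom n)
      map_one := by
        change (Functor.LaxMonoidal.ε Φ ≫ Φ.map _) ≫ Φ.map (f.hom 0).hom = _ ≫ Φ.map _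
        rw [Category.assoc, ← Φ.map_comp, f.map_one]
      map_mul := fun {n m k} h => by
        change (Functor.LaxMonoidal.μ Φ _ _ ≫ Φ.map _) ≫ Φ.map (f.hom k).hom =
          (Φ.map (f.hom n).hom ⊗ₘ Φ.map (f.hom m).hom) ≫ Functor.LaxMonoidal.μ Φ _ _ ≫ Φ.map _
        rw [Category.assoc, ← Φ.map_comp, f.map_mul h, Φ.map_comp,
          Functor.LaxMonoidal.μ_natural_assoc] }

end MapRing
section Induced

variable {V : Type u} [Category.{v} V] [MonoidalCategory V] [SymmetricCategory V]
  {W : Type u'} [Category.{v'} W] [MonoidalCategory W] [SymmetricCategory W]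
  (G : V ⥤ W) [G.Braided]

lemma isCommComonObj_obj (A : V) [ComonObj A] [IsCommComonObj A] :
    letI := Functor.obj.instComonObj A G
    IsCommComonObj (G.obj A) := by
  let _ := Functor.obj.instComonObj A G
  refine ⟨?_⟩
  change (G.map Δ[A] ≫ Functor.OplaxMonoidal.δ G A A) ≫ (β_ (G.obj A) (G.obj A)).hom =
    G.map Δ[A] ≫ Functor.OplaxMonoidal.δ G A A
  have h : Functor.OplaxMonoidal.δ G A A ≫ (β_ (G.obj A) (G.obj A)).hom =
      G.map (β_ A A).hom ≫ Functor.OplaxMonoidal.δ G A A := by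
    rw [← cancel_epi (Functor.LaxMonoidal.μ G A A), Functor.Monoidal.μ_δ_assoc,
      Functor.LaxBraided.braided_assoc, Functor.Monoidal.μ_δ, Category.comp_id]
  rw [Category.assoc, h, ← G.map_comp_assoc, IsCommComonObj.comul_comm]

/-- The functor on cocommutative comonoids induced by a strong symmetric monoidal functor. -/
def mapCoComon : CommComon V ⥤ CommComon W where
  obj A :=
    letI := Functor.obj.instComonObj A.X G
    letI := isCommComonObj_obj G A.X
    { X := G.obj A.X }
  map {A B} f := homMk (G.map (homOf f)) (by
    let _ := Functor.obj.instComonObj A.X G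
    let _ := Functor.obj.instComonObj B.X G
    exact Functor.map.instIsComon_Hom G (homOf f))
  map_id A := homOf_injective (G.map_id A.X)
  map_comp f g := homOf_injective (G.map_comp (homOf f) (homOf g))

lemma isIso_of_homOf {A B : CommComon V} (f : A ⟶ B) [IsIso (homOf f)] : IsIso f :=
  (isoMk (asIso (homOf f)) (inferInstanceAs (IsComonHom (homOf f)))).isIso_hom

lemma homOf_prodComparison (A B : CommComon V) :
    homOf (CartesianMonoidalCategory.prodComparison (mapCoComon G) A B) = Functor.OplaxMonoidal.δ G A.X B.X := by
  change (G.map Δ[A.X ⊗ B.X] ≫ Functor.OplaxMonoidal.δ G (A.X ⊗ B.X) (A.X ⊗ B.X)) ≫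
    (G.map (A.X ◁ ε[B.X] ≫ (ρ_ A.X).hom) ⊗ₘ G.map (ε[A.X] ▷ B.X ≫ (λ_ B.X).hom)) = _
  have h := pair_unique (𝟙 (A.X ⊗ B.X))
  simp only [Category.id_comp] at h
  rw [Category.assoc, Functor.OplaxMonoidal.δ_natural, ← G.map_comp_assoc, h, G.map_id,
    Category.id_comp]

lemma homOf_terminalComparison :
    homOf (CartesianMonoidalCategory.terminalComparison (mapCoComon G)) = Functor.OplaxMonoidal.η G := by
  change G.map (𝟙 (𝟙_ V)) ≫ Functor.OplaxMonoidal.η G = _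
  rw [G.map_id, Category.id_comp]

/-- The functor induced on cocommutative comonoids by a strong symmetric monoidal functor is
cartesian. -/
noncomputable instance : (mapCoComon G).Monoidal :=
  letI := Functor.OplaxMonoidal.ofChosenFiniteProducts (mapCoComon G)
  haveI (A B : CommComon V) : IsIso (Functor.OplaxMonoidal.δ (mapCoComon G) A B) := by
    change IsIso (CartesianMonoidalCategory.prodComparison (mapCoComon G) A B)
    have : IsIso (homOf (CartesianMonoidalCategory.prodComparison (mapCoComon G) A B)) := by
      rw [homOf_prodComparison]
      exact (Functor.Monoidal.μIso G A.X B.X).isIso_inv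
    exact isIso_of_homOf _
  haveI : IsIso (Functor.OplaxMonoidal.η (mapCoComon G)) := by
    change IsIso (CartesianMonoidalCategory.terminalComparison (mapCoComon G))
    have : IsIso (homOf (CartesianMonoidalCategory.terminalComparison (mapCoComon G))) := by
      rw [homOf_terminalComparison]
      exact (Functor.Monoidal.εIso G).isIso_inv
    exact isIso_of_homOf _
  .ofOplaxMonoidal _

end Induced

section Diagonal

variable {C : Type u} [Category.{v} C] [CartesianMonoidalCategory C] [SymmetricCategory C]

variable (C) in
/-- In a cartesian category every object is a cocommutative comonoid through its diagonal. -/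
def diagonalCoComon : C ⥤ CommComon C where
  obj A :=
    letI : ComonObj A := ((cartesianComon C).obj A).comon
    { X := A
      comm := ⟨by
        change lift (𝟙 A) (𝟙 A) ≫ (β_ A A).hom = lift (𝟙 A) (𝟙 A)
        ext <;> simp⟩ }
  map f := homMk f ((cartesianComon C).map f).isComonHom_hom
  map_id _ := rfl
  map_comp _ _ := rfl

end Diagonal

section Realization

variable {V : Type u} [Category.{v} V] [MonoidalCategory V] [SymmetricCategory V]
  [HasColimits V]

section Coend

variable {J : Type} [SmallCategory J] (K : Jᵒᵖ ⥤ J ⥤ CommComon V)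

/-- The bifunctor to `V` underlying a bifunctor to cocommutative comonoids. -/
abbrev underlying : Jᵒᵖ ⥤ J ⥤ V := K ⋙ (Functor.whiskeringRight J _ _).obj (forgetV V)

/-- The structure maps of the coend, as morphisms of `V`. -/
noncomputable abbrev coendι (j : J) : ((K.obj (op j)).obj j).X ⟶ coend (underlying K) :=
  coend.ι (underlying K) j

lemma coendι_condition {i j : J} (f : i ⟶ j) :
    homOf ((K.map f.op).app i) ≫ coendι K i = homOf ((K.obj (op j)).map f) ≫ coendι K j :=
  coend.condition (underlying K) f

/-- Morphisms out of the coend in `V`. -/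
noncomputable def coendDesc {T : V} (f : ∀ j, ((K.obj (op j)).obj j).X ⟶ T)
    (hf : ∀ ⦃i j : J⦄ (g : i ⟶ j),
      homOf ((K.map g.op).app i) ≫ f i = homOf ((K.obj (op j)).map g) ≫ f j) :
    coend (underlying K) ⟶ T :=
  coend.desc (F := underlying K) f hf

@[simp]
lemma coendι_desc {T : V} (f : ∀ j, ((K.obj (op j)).obj j).X ⟶ T)
    (hf : ∀ ⦃i j : J⦄ (g : i ⟶ j),
      homOf ((K.map g.op).app i) ≫ f i = homOf ((K.obj (op j)).map g) ≫ f j) (j : J) :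
    coendι K j ≫ coendDesc K f hf = f j :=
  coend.ι_desc (F := underlying K) f hf j

@[simp]
lemma coendι_desc_assoc {T Z : V} (f : ∀ j, ((K.obj (op j)).obj j).X ⟶ T)
    (hf : ∀ ⦃i j : J⦄ (g : i ⟶ j),
      homOf ((K.map g.op).app i) ≫ f i = homOf ((K.obj (op j)).map g) ≫ f j) (j : J) (h : T ⟶ Z) :
    coendι K j ≫ coendDesc K f hf ≫ h = f j ≫ h := by
  rw [← Category.assoc, coendι_desc]

lemma coend_hom_ext {T : V} {f g : coend (underlying K) ⟶ T}
    (h : ∀ j, coendι K j ≫ f = coendι K j ≫ g) : f = g :=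
  coend.hom_ext h

/-- The counit of a coend of comonoids, induced by the counits of the terms. -/
noncomputable def coendCounit : coend (underlying K) ⟶ 𝟙_ V :=
  coendDesc K (fun j => ε[((K.obj (op j)).obj j).X]) (fun i j g => by
    rw [IsComonHom.hom_counit, IsComonHom.hom_counit])

/-- The comultiplication of a coend of comonoids, induced by the comultiplications of the terms. -/
noncomputable def coendComul :
    coend (underlying K) ⟶ coend (underlying K) ⊗ coend (underlying K) :=
  coendDesc K (fun j => Δ[((K.obj (op j)).obj j).X] ≫ (coendι K j ⊗ₘ coendι K j))
    (fun i j g => by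
      rw [IsComonHom.hom_comul_assoc, IsComonHom.hom_comul_assoc, tensorHom_comp_tensorHom,
        tensorHom_comp_tensorHom, coendι_condition])

lemma coendι_counit (j : J) : coendι K j ≫ coendCounit K = ε[((K.obj (op j)).obj j).X] :=
  coendι_desc K _ _ j

lemma coendι_comul (j : J) : coendι K j ≫ coendComul K =
    Δ[((K.obj (op j)).obj j).X] ≫ (coendι K j ⊗ₘ coendι K j) :=
  coendι_desc K _ _ j

lemma coendι_comul_assoc (j : J) {Z : V} (h : coend (underlying K) ⊗ coend (underlying K) ⟶ Z) :
    coendι K j ≫ coendComul K ≫ h =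
      Δ[((K.obj (op j)).obj j).X] ≫ (coendι K j ⊗ₘ coendι K j) ≫ h := by
  rw [← Category.assoc, coendι_comul, Category.assoc]

/-- The coend in `V` of a bifunctor to cocommutative comonoids is a comonoid. -/
noncomputable instance : ComonObj (coend (underlying K)) where
  counit := coendCounit K
  comul := coendComul K
  counit_comul := coend_hom_ext K fun j => by
    rw [coendι_comul_assoc, ← tensorHom_id, tensorHom_comp_tensorHom, coendι_counit,
      Category.comp_id, ComonObj.counit_comul_hom]
  comul_counit := coend_hom_ext K fun j => by
    rw [coendι_comul_assoc, ← id_tensorHom, tensorHom_comp_tensorHom, coendι_counit,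
      Category.comp_id, ComonObj.comul_counit_hom]
  comul_assoc := coend_hom_ext K fun j => by
    rw [coendι_comul_assoc, coendι_comul_assoc, ← id_tensorHom, ← tensorHom_id,
      tensorHom_comp_tensorHom, tensorHom_comp_tensorHom_assoc, coendι_comul, Category.comp_id]
    have h₁ : ∀ {A : V} [ComonObj A] {B : V} (f : A ⟶ B),
        Δ[A] ≫ (f ⊗ₘ (Δ[A] ≫ (f ⊗ₘ f))) = Δ[A] ≫ A ◁ Δ[A] ≫ (f ⊗ₘ (f ⊗ₘ f)) := by
      intro A _ B f
      rw [← id_tensorHom, tensorHom_comp_tensorHom, Category.id_comp]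
    have h₂ : ∀ {A : V} [ComonObj A] {B : V} (f : A ⟶ B),
        Δ[A] ≫ ((Δ[A] ≫ (f ⊗ₘ f)) ⊗ₘ f) = Δ[A] ≫ Δ[A] ▷ A ≫ ((f ⊗ₘ f) ⊗ₘ f) := by
      intro A _ B f
      rw [← tensorHom_id, tensorHom_comp_tensorHom, Category.id_comp]
    rw [h₁, reassoc_of% h₂, MonoidalCategory.associator_naturality, ComonObj.comul_assoc_assoc]

instance : IsCommComonObj (coend (underlying K)) where
  comul_comm := coend_hom_ext K fun j => by
    change coendι K j ≫ coendComul K ≫ _ = coendι K j ≫ coendComul K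
    rw [coendι_comul_assoc, BraidedCategory.braiding_naturality, IsCommComonObj.comul_comm_assoc,
      coendι_comul]

/-- The coend of a bifunctor to cocommutative comonoids, as a cocommutative comonoid. -/
noncomputable def coCoend : CommComon V := { X := coend (underlying K) }

/-- The structure maps of the coend, as morphisms of comonoids. -/
noncomputable def coCoendι (j : J) : (K.obj (op j)).obj j ⟶ coCoend K :=
  homMk (B := coCoend K) (coendι K j) ⟨coendι_counit K j, coendι_comul K j⟩

lemma coCoendι_condition {i j : J} (f : i ⟶ j) :
    (K.map f.op).app i ≫ coCoendι K i = (K.obj (op j)).map f ≫ coCoendι K j :=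
  homOf_injective (coendι_condition K f)

lemma coCoend_hom_ext {T : CommComon V} {f g : coCoend K ⟶ T}
    (h : ∀ j, coCoendι K j ≫ f = coCoendι K j ≫ g) : f = g :=
  homOf_injective (coend_hom_ext K fun j => congrArg homOf (h j))

section Desc

variable {K} {T : CommComon V} (f : ∀ j, (K.obj (op j)).obj j ⟶ T)
  (hf : ∀ ⦃i j : J⦄ (g : i ⟶ j), (K.map g.op).app i ≫ f i = (K.obj (op j)).map g ≫ f j)

/-- Morphisms of cocommutative comonoids out of the coend, as morphisms of `V`. -/
noncomputable def descHom : coend (underlying K) ⟶ T.X :=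
  coendDesc K (fun j => homOf (f j)) fun _ _ g => congrArg homOf (hf g)

lemma coendι_descHom (j : J) : coendι K j ≫ descHom f hf = homOf (f j) :=
  coendι_desc K _ _ j

lemma coendι_descHom_assoc (j : J) {Z : V} (h : T.X ⟶ Z) :
    coendι K j ≫ descHom f hf ≫ h = homOf (f j) ≫ h := by
  rw [← Category.assoc, coendι_descHom]

lemma isComonHom_descHom : IsComonHom (descHom f hf) where
  hom_counit := coend_hom_ext K fun j => by
    rw [coendι_descHom_assoc, IsComonHom.hom_counit]
    exact (coendι_counit K j).symm
  hom_comul := coend_hom_ext K fun j => by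
    rw [coendι_descHom_assoc, IsComonHom.hom_comul]
    refine Eq.trans ?_ (coendι_comul_assoc K j _).symm
    rw [tensorHom_comp_tensorHom, coendι_descHom]

/-- Morphisms of cocommutative comonoids out of the coend. -/
noncomputable def coCoendDesc : coCoend K ⟶ T :=
  homMk (A := coCoend K) (descHom f hf) (isComonHom_descHom f hf)

lemma coCoendι_desc (j : J) : coCoendι K j ≫ coCoendDesc f hf = f j :=
  homOf_injective (coendι_descHom f hf j)

lemma coCoendι_desc_assoc (j : J) {Z : CommComon V} (h : T ⟶ Z) :
    coCoendι K j ≫ coCoendDesc f hf ≫ h = f j ≫ h := by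
  rw [← Category.assoc, coCoendι_desc]

end Desc

end Coend

variable (D : SimplexCategory ⥤ CommComon V)

/-- The bifunctor `([n], [m]) ↦ X n ⊗ D m` whose coend is the geometric realization. -/
def realizationBifunctor (X : SimplexCategoryᵒᵖ ⥤ CommComon V) :
    SimplexCategoryᵒᵖ ⥤ SimplexCategory ⥤ CommComon V where
  obj n :=
    { obj := fun m => X.obj n ⊗ D.obj m
      map := fun g => X.obj n ◁ D.map g
      map_id := fun m => by rw [D.map_id, MonoidalCategory.whiskerLeft_id]
      map_comp := fun g h => by rw [D.map_comp, MonoidalCategory.whiskerLeft_comp] }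
  map f :=
    { app := fun m => X.map f ▷ D.obj m
      naturality := fun _ _ g => whisker_exchange (X.map f) (D.map g) }
  map_id n := by
    refine NatTrans.ext (funext fun m => ?_)
    change X.map (𝟙 n) ▷ D.obj m = 𝟙 _
    rw [X.map_id, MonoidalCategory.id_whiskerRight]
  map_comp f g := by
    refine NatTrans.ext (funext fun m => ?_)
    change X.map (f ≫ g) ▷ D.obj m = X.map f ▷ D.obj m ≫ X.map g ▷ D.obj m
    rw [X.map_comp, MonoidalCategory.comp_whiskerRight]

/-- The structure maps `X n ⊗ D n ⟶ |X|` of the geometric realization. -/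
noncomputable def realizationι (X : SimplexCategoryᵒᵖ ⥤ CommComon V) (n : SimplexCategory) :
    X.obj (op n) ⊗ D.obj n ⟶ coCoend (realizationBifunctor D X) :=
  coCoendι (realizationBifunctor D X) n

lemma realizationι_condition (X : SimplexCategoryᵒᵖ ⥤ CommComon V) {i j : SimplexCategory}
    (g : i ⟶ j) : X.map g.op ▷ D.obj i ≫ realizationι D X i =
      X.obj (op j) ◁ D.map g ≫ realizationι D X j :=
  coCoendι_condition (realizationBifunctor D X) g

lemma realizationMap_aux {X Y : SimplexCategoryᵒᵖ ⥤ CommComon V} (f : X ⟶ Y)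
    {i j : SimplexCategory} (g : i ⟶ j) :
    X.map g.op ▷ D.obj i ≫ f.app (op i) ▷ D.obj i ≫ realizationι D Y i =
      X.obj (op j) ◁ D.map g ≫ f.app (op j) ▷ D.obj j ≫ realizationι D Y j := by
  rw [← comp_whiskerRight_assoc, f.naturality, comp_whiskerRight_assoc,
    realizationι_condition, whisker_exchange_assoc]

/-- The morphism of realizations induced by a morphism of simplicial objects. -/
noncomputable def realizationMap {X Y : SimplexCategoryᵒᵖ ⥤ CommComon V} (f : X ⟶ Y) :
    coCoend (realizationBifunctor D X) ⟶ coCoend (realizationBifunctor D Y) :=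
  coCoendDesc (fun n => f.app (op n) ▷ D.obj n ≫ realizationι D Y n) fun _ _ g =>
    realizationMap_aux D f g

lemma realizationι_map {X Y : SimplexCategoryᵒᵖ ⥤ CommComon V} (f : X ⟶ Y)
    (n : SimplexCategory) : realizationι D X n ≫ realizationMap D f =
      f.app (op n) ▷ D.obj n ≫ realizationι D Y n :=
  coCoendι_desc _ _ n

/-- The geometric realization of simplicial cocommutative comonoids with respect to a cosimplicial
cocommutative comonoid `D`: the coend of `X n ⊗ D n`, formed in `V`. -/
noncomputable def realization : (SimplexCategoryᵒᵖ ⥤ CommComon V) ⥤ CommComon V where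
  obj X := coCoend (realizationBifunctor D X)
  map f := realizationMap D f
  map_id X := coCoend_hom_ext _ fun n => by
    refine (realizationι_map D (𝟙 X) n).trans ?_
    rw [NatTrans.id_app, MonoidalCategory.id_whiskerRight, Category.id_comp, Category.comp_id]
    rfl
  map_comp {X Y Z} f g := coCoend_hom_ext _ fun n => by
    refine (realizationι_map D (f ≫ g) n).trans ?_
    rw [NatTrans.comp_app, comp_whiskerRight_assoc, ← realizationι_map, ← Category.assoc,
      ← realizationι_map, Category.assoc]
    rfl

end Realization

section Bar

variable {V : Type u} [Category.{v} V] [MonoidalCategory V] [SymmetricCategory V]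
  [HasColimits V] (D : SimplexCategory ⥤ CommComon V)

/-- The bar construction `B A = |B_• A|` of abelian group objects in cocommutative comonoids, as a
functor to cocommutative comonoids. -/
noncomputable def bar : AbObj (CommComon V) ⥤ CommComon V :=
  simplicialBar (CommComon V) ⋙ realization D

/-- The class `[x_1 | … | x_p ; d]` in the bar construction of `A`: the composite
`T ⟶ A ^ p ⊗ D p ⟶ B A` of a generalized element of `A ^ p ⊗ D p`, given by its components, with
the structure map of the realization. -/
noncomputable def barCls (A : AbObj (CommComon V)) {T : CommComon V} {p : ℕ}
    (x : Fin p → (T ⟶ A.X)) (d : T ⟶ D.obj (SimplexCategory.mk p)) : T ⟶ (bar D).obj A :=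
  lift (powLift x) d ≫
    realizationι D ((simplicialBar (CommComon V)).obj A) (SimplexCategory.mk p)

/-- The abelian group structures on the bar constructions `B A = |B_• A|` that come from the
levelwise addition of the simplicial abelian group object `B_• A`: on classes with the same second
component `d` the addition is
`[x_1 | … | x_p ; d] + [y_1 | … | y_p ; d] = [x_1 + y_1 | … | x_p + y_p ; d]`,
which says that the addition of `B A` is the composite
`|B_• A| ⊗ |B_• A| ≅ |B_• A ⊗ B_• A| ⟶ |B_• A|` of the inverse of the canonical comparison map and
the realization of the addition of `B_• A`. -/
structure BarGroup where
  /-- The group structure on the bar construction of `A`. -/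
  grp : ∀ A : AbObj (CommComon V), AddGrpObj ((bar D).obj A)
  comm : ∀ A : AbObj (CommComon V),
    @IsCommAddMonObj _ _ _ _ ((bar D).obj A) (grp A).toAddMonObj
  add_barCls : ∀ (A : AbObj (CommComon V)) {T : CommComon V} {p : ℕ} (x y : Fin p → (T ⟶ A.X))
    (d : T ⟶ D.obj (SimplexCategory.mk p)),
    lift (barCls D A x d) (barCls D A y d) ≫ (grp A).add = barCls D A (fun i => x i + y i) d
  isAddMonHom_map : ∀ {A A' : AbObj (CommComon V)} (f : A ⟶ A'),
    @IsAddMonHom _ _ _ _ _ (grp A).toAddMonObj (grp A').toAddMonObj ((bar D).map f)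

namespace BarGroup

variable {D} (b : BarGroup D)

/-- The bar construction of an abelian group object, as an abelian group object. -/
noncomputable def obj (A : AbObj (CommComon V)) : AbObj (CommComon V) :=
  letI := b.grp A
  letI := b.comm A
  { X := (bar D).obj A }

/-- The bar construction as an endofunctor of abelian group objects. -/
noncomputable def functor : AbObj (CommComon V) ⥤ AbObj (CommComon V) where
  obj A := b.obj A
  map {A A'} f :=
    letI := b.grp A
    letI := b.grp A'
    AbObj.Hom.mk (A := b.obj A) (B := b.obj A') ((bar D).map f)
      (isAddMonHom := b.isAddMonHom_map f)
  map_id A := AbObj.hom_ext ((bar D).map_id A)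
  map_comp f g := AbObj.hom_ext ((bar D).map_comp f g)

/-- The iterated bar constructions: `B^0 A = A` and `B^(n+1) A = B (B^n A)`. -/
noncomputable def iter : ℕ → (AbObj (CommComon V) ⥤ AbObj (CommComon V))
  | 0 => 𝟭 _
  | n + 1 => iter n ⋙ b.functor

/-- The abelian group object `B^n S` of a ring object `S`. -/
noncomputable abbrev deg (S : RingObjCat (CommComon V)) (n : ℕ) : AbObj (CommComon V) :=
  (b.iter n).obj (ringToAb (CommComon V) |>.obj S)

/-- The class `[x_1 | … | x_p ; d]` in `B^(n+1) S` of `x_1, …, x_p` in `B^n S`. -/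
noncomputable def cls (S : RingObjCat (CommComon V)) (n : ℕ) {T : CommComon V} {p : ℕ}
    (x : Fin p → (T ⟶ (b.deg S n).X)) (d : T ⟶ D.obj (SimplexCategory.mk p)) :
    T ⟶ (b.deg S (n + 1)).X :=
  barCls D (b.deg S n) x d

end BarGroup

/-- The iterated bar construction of ring objects in cocommutative comonoids: the abelian group
structures of the bar constructions together with the graded ring structures on `B^* S`, given by
the multiplication of `S` in degree `(0, 0)` and extended to higher degrees componentwise: for
`s` in `S`, `x_i` in `B^m S` respectively `B^n S`, and `y` in `B^m S`,
`s * [x_1 | … | x_p ; d] = [s * x_1 | … | s * x_p ; d]` and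
`[x_1 | … | x_p ; d] * y = [x_1 * y | … | x_p * y ; d]`.
The multiplications are natural in `S`. -/
structure IteratedBar extends BarGroup D where
  /-- The graded ring structure on `B^* S`. -/
  ring : ∀ S : RingObjCat (CommComon V), GrRingStr (toBarGroup.deg S)
  one_eq : ∀ S : RingObjCat (CommComon V), (ring S).one = η[S.X]
  mul_zero_zero : ∀ S : RingObjCat (CommComon V), (ring S).mul (Nat.add_zero 0) = μ[S.X]
  mul_zero_succ : ∀ (S : RingObjCat (CommComon V)) (m : ℕ) {T : CommComon V} {p : ℕ}
    (s : T ⟶ (toBarGroup.deg S 0).X) (x : Fin p → (T ⟶ (toBarGroup.deg S m).X))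
    (d : T ⟶ D.obj (SimplexCategory.mk p)),
    lift s (toBarGroup.cls S m x d) ≫ (ring S).mul (Nat.zero_add (m + 1)) =
      toBarGroup.cls S m (fun i => lift s (x i) ≫ (ring S).mul (Nat.zero_add m)) d
  mul_succ : ∀ (S : RingObjCat (CommComon V)) {n m k : ℕ} (h : n + m = k)
    (h₁ : n + 1 + m = k + 1) {T : CommComon V} {p : ℕ}
    (x : Fin p → (T ⟶ (toBarGroup.deg S n).X)) (d : T ⟶ D.obj (SimplexCategory.mk p))
    (y : T ⟶ (toBarGroup.deg S m).X),
    lift (toBarGroup.cls S n x d) y ≫ (ring S).mul h₁ =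
      toBarGroup.cls S k (fun i => lift (x i) y ≫ (ring S).mul h) d
  mul_natural : ∀ {S S' : RingObjCat (CommComon V)} (f : S ⟶ S') {n m k : ℕ} (h : n + m = k),
    (ring S).mul h ≫ ((toBarGroup.iter k).map ((ringToAb _).map f)).hom =
      (((toBarGroup.iter n).map ((ringToAb _).map f)).hom ⊗ₘ
        ((toBarGroup.iter m).map ((ringToAb _).map f)).hom) ≫ (ring S').mul h

namespace IteratedBar

variable {D} (b : IteratedBar D)

/-- The functor `S ↦ B^* S` from ring objects to graded ring objects. -/
@[simps]
noncomputable def functor : RingObjCat (CommComon V) ⥤ GrRing (CommComon V) where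
  obj S := { deg := b.toBarGroup.deg S, str := b.ring S }
  map {S S'} f :=
    { hom := fun n => (b.toBarGroup.iter n).map ((ringToAb _).map f)
      map_one := by
        rw [b.one_eq, b.one_eq]
        exact IsMonHom.one_hom f.hom
      map_mul := fun h => b.mul_natural f h }
  map_id S := GrRing.Hom.ext (funext fun n =>
    (congrArg (b.toBarGroup.iter n).map ((ringToAb _).map_id S)).trans
      ((b.toBarGroup.iter n).map_id _))
  map_comp f g := GrRing.Hom.ext (funext fun n =>
    (congrArg (b.toBarGroup.iter n).map ((ringToAb _).map_comp f g)).trans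
      ((b.toBarGroup.iter n).map_comp _ _))

end IteratedBar

end Bar

section Cosimplicial

variable {V : Type u} [Category.{v} V] [MonoidalCategory V] [SymmetricCategory V]

/-- The cosimplicial cocommutative comonoid `F Δ^•` in `V`, for a strong symmetric monoidal functor
`F` from simplicial sets: the comonoid structure of `F Δ^n` is induced by the diagonal of `Δ^n`. -/
noncomputable def cosimplicial (F : SSet.{v} ⥤ V) [F.Braided] : SimplexCategory ⥤ CommComon V :=
  SSet.stdSimplex.{v} ⋙ diagonalCoComon SSet.{v} ⋙ mapCoComon F

end Cosimplicial

end HopfBar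

/-!
# The iterated bar construction of coalgebraic rings

Everything is checked on classes. A family of morphisms of cocommutative comonoids into `P` is a
`Covering` if it remains jointly epic in `V` after tensoring with an arbitrary object. Morphisms
of comonoids out of `P` are equal if they agree on a covering family, and being a morphism of
comonoids is a local property. As `V` is closed, tensoring preserves coends, so the structure maps
of a realization are a covering (`covering_geomι`), and a morphism out of `C ⊗ B A` is the same
thing as a natural operation on classes `[x_1 | … | x_p ; d]` that is compatible with the
simplicial operators (`bar_hom_ext_right`, `exists_bar_desc_right`).

The addition and its axioms involve several classes with one common second component `d`.
This is where `F` enters: since `F` is a strong monoidal left adjoint and every simplicial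
set is the colimit of its simplices, `F Δ^p ⊗ F Δ^q` is covered by the images of the simplices of
`Δ^p × Δ^q` (`covering_lift_cosimplicial`), and there is descent along this covering
(`exists_cosimplicial_desc`). Hence the realization commutes with products: `|X| ⊗ |Y|` is covered
by the pairs `([x ; d], [y ; d])`, with the corresponding descent (`covering_geomPair`,
`exists_realization_pair_desc`). So the prescribed formula defines a unique addition on `B A`, and
the group axioms, which hold componentwise, follow (`barGroup`, `barGroup_unique`).

A biadditive morphism `A × B → E` is compatible with the sums over segments which make up the
simplicial operators. So it extends to the bar construction of either variable, and the extension
is again biadditive (`BarGroup.exists_pairing_left`, `BarGroup.exists_pairing_right`). Starting with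
the multiplication of `S`, the recursive formulas in the theorem determine all multiplications
`B^n S ⊗ B^m S → B^(n+m) S`, and associativity, unitality and naturality are proved on classes, by
the same recursion (`BarGroup.prod_assoc`, `IteratedBar.ring_mul`).

For the change of base along `G`, generalized elements of the images of finitely many comonoids
come from generalized elements over `V`, because the induced functor on comonoids preserves
products (`exists_eq_map_comp`). So there is a morphism from the bar construction of the image of
`A` to the image of `B A` which sends classes to classes (`barComparisonHom`). It is an isomorphism
because `G`, being a left adjoint, preserves the coend (`exists_map_bar_desc`). It is additive, and
induction on the degrees shows that the resulting isomorphisms of iterated bar constructions are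
multiplicative (`prod_comp_degComparisonHom`).
-/

namespace HopfBar

/-! ### Coverings of cocommutative comonoids -/

section Covering

variable {V : Type u} [Category.{v} V] [MonoidalCategory V] [SymmetricCategory V]

/-- A family of morphisms of cocommutative comonoids into `P` is covering if it is jointly epic
in `V`, even after tensoring with any object of `V`. -/
def Covering {P : CommComon V} (S : Presieve P) : Prop :=
  ∀ ⦃C Z : V⦄ (f g : C ⊗ P.X ⟶ Z),
    (∀ ⦃Q : CommComon V⦄ (e : Q ⟶ P), S e → C ◁ homOf e ≫ f = C ◁ homOf e ≫ g) → f = g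

namespace Covering

variable {P : CommComon V} {S : Presieve P}

lemma homOf_ext (hS : Covering S) {Z : V} {f g : P.X ⟶ Z}
    (h : ∀ ⦃Q : CommComon V⦄ (e : Q ⟶ P), S e → homOf e ≫ f = homOf e ≫ g) : f = g := by
  rw [← cancel_epi (λ_ P.X).hom]
  refine hS _ _ fun Q e he => ?_
  rw [leftUnitor_naturality_assoc, leftUnitor_naturality_assoc, h e he]

lemma hom_ext (hS : Covering S) {Z : CommComon V} {f g : P ⟶ Z}
    (h : ∀ ⦃Q : CommComon V⦄ (e : Q ⟶ P), S e → e ≫ f = e ≫ g) : f = g :=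
  homOf_injective (hS.homOf_ext fun _ e he => congrArg homOf (h e he))

/-- Being a morphism of comonoids is a local property. -/
lemma isComonHom (hS : Covering S) {T : CommComon V} (f : P.X ⟶ T.X)
    (h : ∀ ⦃Q : CommComon V⦄ (e : Q ⟶ P), S e → IsComonHom (homOf e ≫ f)) : IsComonHom f where
  hom_counit := hS.homOf_ext fun Q e he => by
    have := (h e he).hom_counit
    rw [Category.assoc] at this
    rw [this, IsComonHom.hom_counit]
  hom_comul := hS.homOf_ext fun Q e he => by
    have := (h e he).hom_comul
    rw [Category.assoc] at this
    rw [this, IsComonHom.hom_comul_assoc, tensorHom_comp_tensorHom]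

lemma mono (hS : Covering S) {S' : Presieve P}
    (h : ∀ ⦃Q : CommComon V⦄ (e : Q ⟶ P), S e → S' e) : Covering S' :=
  fun _ _ f g hfg => hS f g fun _ e he => hfg e (h e he)

lemma of_section {R : CommComon V} (s : P ⟶ R) (π : R ⟶ P) (hs : s ≫ π = 𝟙 P)
    (h : Covering (fun (Q : CommComon V) (t : Q ⟶ R) => S (t ≫ π))) : Covering S :=
  fun C Z f g hfg => by
    have key : C ◁ homOf π ≫ f = C ◁ homOf π ≫ g := h _ _ fun Q t ht => by
      rw [← whiskerLeft_comp_assoc, ← whiskerLeft_comp_assoc, ← homOf_comp, hfg _ ht]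
    have hs' : C ◁ homOf s ≫ C ◁ homOf π = 𝟙 _ := by
      rw [← whiskerLeft_comp, ← homOf_comp, hs, homOf_id, whiskerLeft_id]
    simpa [reassoc_of% hs'] using congrArg (fun t => C ◁ homOf s ≫ t) key

section Family

variable {I : Type*} {Q : I → CommComon V} {e : ∀ i, Q i ⟶ P}

lemma family_iff : Covering (Presieve.ofArrows Q e) ↔ ∀ ⦃C Z : V⦄ (f g : C ⊗ P.X ⟶ Z),
    (∀ i, C ◁ homOf (e i) ≫ f = C ◁ homOf (e i) ≫ g) → f = g :=
  ⟨fun h C Z f g hfg => h f g (by rintro _ _ ⟨i⟩; exact hfg i),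
    fun h C Z f g hfg => h f g fun i => hfg _ ⟨i⟩⟩

lemma family_hom_ext (he : Covering (Presieve.ofArrows Q e)) {Z : CommComon V} {f g : P ⟶ Z}
    (h : ∀ i, e i ≫ f = e i ≫ g) : f = g :=
  he.hom_ext (by rintro _ _ ⟨i⟩; exact h i)

lemma trans (he : Covering (Presieve.ofArrows Q e))
    (h : ∀ i, Covering (fun (R : CommComon V) (t : R ⟶ Q i) => S (t ≫ e i))) : Covering S :=
  fun C Z f g hfg => family_iff.1 he f g fun i => h i _ _ fun R t ht => by
    rw [← whiskerLeft_comp_assoc, ← whiskerLeft_comp_assoc, ← homOf_comp, hfg _ ht]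

lemma of_mem (he : Covering (Presieve.ofArrows Q e)) (h : ∀ i, S (e i)) : Covering S :=
  he.mono (by rintro _ _ ⟨i⟩; exact h i)

lemma of_factors (hS : Covering S)
    (h : ∀ ⦃R : CommComon V⦄ (t : R ⟶ P), S t → ∃ i w, t = w ≫ e i) :
    Covering (Presieve.ofArrows Q e) :=
  family_iff.2 fun C Z f g hfg => hS f g fun R t ht => by
    obtain ⟨i, w, rfl⟩ := h t ht
    simp only [homOf_comp, whiskerLeft_comp_assoc, hfg i]

lemma whiskerLeft (he : Covering (Presieve.ofArrows Q e)) (B : CommComon V) :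
    Covering (Presieve.ofArrows (fun i => B ⊗ Q i) fun i => B ◁ e i) :=
  family_iff.2 fun C Z f g hfg => by
    have key : (α_ C B.X P.X).hom ≫ f = (α_ C B.X P.X).hom ≫ g :=
      family_iff.1 he _ _ fun i => by
        have : (C ⊗ B.X) ◁ homOf (e i) ≫ (α_ C B.X P.X).hom =
          (α_ C B.X (Q i).X).hom ≫ C ◁ homOf (B ◁ e i) := by
          simp
        rw [reassoc_of% this, reassoc_of% this, hfg]
    exact (cancel_epi _).1 key

lemma whiskerRight (he : Covering (Presieve.ofArrows Q e)) (B : CommComon V) :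
    Covering (Presieve.ofArrows (fun i => Q i ⊗ B) fun i => e i ▷ B) :=
  family_iff.2 fun C Z f g hfg => by
    have key : C ◁ homOf (β_ B P).hom ≫ f = C ◁ homOf (β_ B P).hom ≫ g :=
      family_iff.1 (he.whiskerLeft B) _ _ fun i => by
        rw [← whiskerLeft_comp_assoc, ← whiskerLeft_comp_assoc, ← homOf_comp,
          BraidedCategory.braiding_naturality_right, homOf_comp, whiskerLeft_comp_assoc,
          whiskerLeft_comp_assoc, hfg]
    have h : C ◁ homOf (β_ B P).inv ≫ C ◁ homOf (β_ B P).hom = 𝟙 _ := by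
      rw [← whiskerLeft_comp, ← homOf_comp, Iso.inv_hom_id, homOf_id, whiskerLeft_id]
    simpa [reassoc_of% h] using congrArg (fun t => C ◁ homOf (β_ B P).inv ≫ t) key

end Family

end Covering

end Covering
/-! ### Descent along coends and along standard simplices -/

section CoendDescent

variable {V : Type u} [Category.{v} V] [MonoidalCategory V] [SymmetricCategory V]
  [MonoidalClosed V] [HasColimits V] {J : Type} [SmallCategory J] (K : Jᵒᵖ ⥤ J ⥤ CommComon V)

lemma covering_coCoendι :
    Covering (Presieve.ofArrows (fun j => (K.obj (op j)).obj j) (coCoendι K)) :=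
  Covering.family_iff.2 fun C Z f g hfg => by
    refine MonoidalClosed.curry_injective (coend_hom_ext K fun j => ?_)
    exact (MonoidalClosed.curry_natural_left (homOf (coCoendι K j)) f).symm.trans
      ((congrArg _ (hfg j)).trans (MonoidalClosed.curry_natural_left (homOf (coCoendι K j)) g))

variable {K} in
lemma exists_coCoend_desc {C T : CommComon V} (f : ∀ j, C ⊗ (K.obj (op j)).obj j ⟶ T)
    (hf : ∀ ⦃i j : J⦄ (g : i ⟶ j), C ◁ (K.map g.op).app i ≫ f i =
      C ◁ (K.obj (op j)).map g ≫ f j) :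
    ∃ h : C ⊗ coCoend K ⟶ T, ∀ j, C ◁ coCoendι K j ≫ h = f j := by
  let h₀ : coend (underlying K) ⟶ (ihom C.X).obj T.X :=
    coendDesc K (fun j => MonoidalClosed.curry (homOf (f j))) fun i j g => by
      rw [← MonoidalClosed.curry_natural_left, ← MonoidalClosed.curry_natural_left]
      exact congrArg (fun t => MonoidalClosed.curry (homOf t)) (hf g)
  have h₁ (j : J) : C.X ◁ coendι K j ≫ MonoidalClosed.uncurry h₀ = homOf (f j) := by
    rw [← MonoidalClosed.uncurry_natural_left, coendι_desc, MonoidalClosed.uncurry_curry]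
  have h₂ : IsComonHom (M := (C ⊗ coCoend K).X) (MonoidalClosed.uncurry h₀) :=
    ((covering_coCoendι K).whiskerLeft C).isComonHom _ (by
      rintro _ _ ⟨j⟩
      have : homOf (C ◁ coCoendι K j) ≫ MonoidalClosed.uncurry h₀ = homOf (f j) := h₁ j
      rw [this]
      infer_instance)
  exact ⟨homMk (A := C ⊗ coCoend K) _ h₂, fun j => homOf_injective (h₁ j)⟩

end CoendDescent

section Density

/-- The standard simplices, as a functor to simplicial sets. -/
def simplices : SimplexCategory ⥤ SSet.{v} := SSet.stdSimplex

lemma exists_simplices_map {r p : SimplexCategory} (k : simplices.{v}.obj r ⟶ simplices.obj p) :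
    ∃ a : r ⟶ p, simplices.map a = k :=
  SSet.stdSimplex.map_surjective k

lemma simplices_map_injective {r p : SimplexCategory} {a b : r ⟶ p}
    (h : simplices.{v}.map a = simplices.map b) : a = b :=
  SSet.stdSimplex.map_injective h

/-- The Yoneda bijection between the morphisms from a standard simplex and the simplices. -/
def simplicesEquiv {K : SSet.{v}} {r : SimplexCategory} :
    (simplices.obj r ⟶ K) ≃ K.obj (op r) :=
  SSet.yonedaEquiv

lemma simplicesEquiv_symm_comp {K L : SSet.{v}} {r : SimplexCategory} (x : K.obj (op r))
    (f : K ⟶ L) : simplicesEquiv.symm x ≫ f = simplicesEquiv.symm (f.app _ x) :=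
  SSet.yonedaEquiv_symm_comp x f

lemma simplicesEquiv_map_comp {K : SSet.{v}} {r s : SimplexCategory} (θ : r ⟶ s)
    (k : simplices.obj s ⟶ K) :
    simplicesEquiv (simplices.map θ ≫ k) = K.map θ.op (simplicesEquiv k) :=
  (uliftYonedaEquiv_naturality (X := op s) (Y := op r) k θ.op).symm

lemma sset_hom_ext {K L : SSet.{v}} {f g : K ⟶ L}
    (h : ∀ (r : SimplexCategory) (k : simplices.obj r ⟶ K), k ≫ f = k ≫ g) : f = g := by
  refine NatTrans.ext (funext fun r => ?_)
  ext x
  have := h r.unop (simplicesEquiv.symm x)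
  rw [simplicesEquiv_symm_comp, simplicesEquiv_symm_comp] at this
  exact simplicesEquiv.symm.injective this

lemma exists_sset_desc {K L : SSet.{v}}
    (φ : ∀ r : SimplexCategory, (simplices.obj r ⟶ K) → (simplices.obj r ⟶ L))
    (hφ : ∀ ⦃r s : SimplexCategory⦄ (θ : r ⟶ s) (k : simplices.obj s ⟶ K),
      simplices.map θ ≫ φ s k = φ r (simplices.map θ ≫ k)) :
    ∃ h : K ⟶ L, ∀ (r : SimplexCategory) (k : simplices.obj r ⟶ K), k ≫ h = φ r k := by
  let h : K ⟶ L :=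
    { app := fun r => TypeCat.ofHom fun x => simplicesEquiv (φ r.unop (simplicesEquiv.symm x))
      naturality := fun r s θ => by
        ext x
        have e : simplices.map θ.unop ≫ simplicesEquiv.symm x = simplicesEquiv.symm (K.map θ x) :=
          simplicesEquiv.injective (by
            rw [simplicesEquiv_map_comp, Equiv.apply_symm_apply, Equiv.apply_symm_apply,
              Quiver.Hom.op_unop])
        have h₁ := congrArg simplicesEquiv
          ((hφ θ.unop (simplicesEquiv.symm x)).trans (congrArg (φ _) e))
        exact h₁.symm.trans (simplicesEquiv_map_comp _ _) }
  refine ⟨h, fun r k => ?_⟩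
  obtain ⟨x, rfl⟩ := simplicesEquiv.symm.surjective k
  rw [simplicesEquiv_symm_comp]
  exact simplicesEquiv.symm_apply_apply _

variable {V : Type u} [Category.{v} V] [MonoidalCategory V]
  [MonoidalClosed V] (F : SSet.{v} ⥤ V) [F.IsLeftAdjoint]

/-- Tensoring with `Z` and a functor `F` that is a left adjoint preserve the presentation of a
simplicial set as the colimit of its simplices. -/
lemma tensor_hom_ext {Z T : V} {K : SSet.{v}} {f g : Z ⊗ F.obj K ⟶ T}
    (h : ∀ (r : SimplexCategory) (k : simplices.obj r ⟶ K),
      Z ◁ F.map k ≫ f = Z ◁ F.map k ≫ g) : f = g := by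
  refine MonoidalClosed.curry_injective
    ((Adjunction.ofIsLeftAdjoint F).homEquiv _ _ |>.injective (sset_hom_ext fun r k => ?_))
  rw [← Adjunction.homEquiv_naturality_left, ← Adjunction.homEquiv_naturality_left,
    ← MonoidalClosed.curry_natural_left, ← MonoidalClosed.curry_natural_left, h]

lemma exists_tensor_desc {Z T : V} {K : SSet.{v}}
    (φ : ∀ r : SimplexCategory, (simplices.obj r ⟶ K) → (Z ⊗ F.obj (simplices.obj r) ⟶ T))
    (hφ : ∀ ⦃r s : SimplexCategory⦄ (θ : r ⟶ s) (k : simplices.obj s ⟶ K),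
      Z ◁ F.map (simplices.map θ) ≫ φ s k = φ r (simplices.map θ ≫ k)) :
    ∃ h : Z ⊗ F.obj K ⟶ T, ∀ (r : SimplexCategory) (k : simplices.obj r ⟶ K),
      Z ◁ F.map k ≫ h = φ r k := by
  let adj := Adjunction.ofIsLeftAdjoint F
  obtain ⟨h, hh⟩ := exists_sset_desc
    (fun r k => adj.homEquiv _ _ (MonoidalClosed.curry (φ r k))) (fun r s θ k => by
      rw [← Adjunction.homEquiv_naturality_left, ← MonoidalClosed.curry_natural_left, hφ])
  refine ⟨MonoidalClosed.uncurry ((adj.homEquiv _ _).symm h), fun r k => ?_⟩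
  rw [← MonoidalClosed.uncurry_natural_left, ← Adjunction.homEquiv_naturality_left_symm, hh,
    Equiv.symm_apply_apply, MonoidalClosed.uncurry_curry]

end Density

section Simplices

lemma exists_eq_lift_simplices {p q r : SimplexCategory}
    (k : simplices.obj r ⟶ simplices.{v}.obj p ⊗ simplices.obj q) :
    ∃ (a : r ⟶ p) (b : r ⟶ q), k = lift (simplices.map a) (simplices.map b) := by
  obtain ⟨a, ha⟩ := exists_simplices_map (k ≫ fst _ _)
  obtain ⟨b, hb⟩ := exists_simplices_map (k ≫ snd _ _)
  exact ⟨a, b, by rw [ha, hb]; ext1 <;> simp⟩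

variable {V : Type u} [Category.{v} V] [MonoidalCategory V] [SymmetricCategory V]
  (F : SSet.{v} ⥤ V) [F.Braided]

lemma homOf_lift_cosimplicial {p q r : SimplexCategory} (a : r ⟶ p) (b : r ⟶ q) :
    homOf (lift ((cosimplicial F).map a) ((cosimplicial F).map b)) =
      F.map (lift (simplices.map a) (simplices.map b)) ≫
        Functor.OplaxMonoidal.δ F _ _ := by
  change (F.map (lift (𝟙 (simplices.obj r)) (𝟙 _)) ≫ Functor.OplaxMonoidal.δ F _ _) ≫
    (F.map (simplices.map a) ⊗ₘ F.map (simplices.map b)) = _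
  rw [Category.assoc, Functor.OplaxMonoidal.δ_natural, ← F.map_comp_assoc]
  simp

lemma whiskerLeft_lift_cosimplicial_comp {p q r : SimplexCategory} (a : r ⟶ p) (b : r ⟶ q)
    (C : V) {Z : V} (f : C ⊗ (F.obj (simplices.obj p) ⊗ F.obj (simplices.obj q)) ⟶ Z) :
    C ◁ homOf (lift ((cosimplicial F).map a) ((cosimplicial F).map b)) ≫ f =
      C ◁ F.map (lift (simplices.map a) (simplices.map b)) ≫
        C ◁ Functor.OplaxMonoidal.δ F _ _ ≫ f :=
  (congrArg (fun t => C ◁ t ≫ f) (homOf_lift_cosimplicial F a b)).trans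
    (whiskerLeft_comp_assoc _ _ _ _)

variable [MonoidalClosed V] [F.IsLeftAdjoint]

/-- The coalgebraic form of the triangulation of a product of two simplices: `F Δ^p ⊗ F Δ^q` is
covered by the images of the simplices of `Δ^p × Δ^q`. -/
lemma covering_lift_cosimplicial (p q : SimplexCategory) :
    Covering (Presieve.ofArrows (fun i : Σ r : SimplexCategory, (r ⟶ p) × (r ⟶ q) =>
        (cosimplicial F).obj i.1)
      fun i => lift ((cosimplicial F).map i.2.1) ((cosimplicial F).map i.2.2)) :=
  Covering.family_iff.2 fun C Z f g hfg => by
    have key : C ◁ Functor.OplaxMonoidal.δ F (simplices.obj p) (simplices.obj q) ≫ f =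
        C ◁ Functor.OplaxMonoidal.δ F (simplices.obj p) (simplices.obj q) ≫ g :=
      tensor_hom_ext F fun r k => by
        obtain ⟨a, b, rfl⟩ := exists_eq_lift_simplices k
        exact (whiskerLeft_lift_cosimplicial_comp F a b C f).symm.trans
          ((hfg ⟨r, a, b⟩).trans (whiskerLeft_lift_cosimplicial_comp F a b C g))
    have hδ : IsIso (Functor.OplaxMonoidal.δ F (simplices.obj p) (simplices.obj q)) :=
      (Functor.Monoidal.μIso F (simplices.obj p) (simplices.obj q)).isIso_inv
    exact (cancel_epi (C ◁ Functor.OplaxMonoidal.δ F (simplices.obj p) (simplices.obj q))).1 key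

lemma exists_cosimplicial_desc {C T : CommComon V} {p q : SimplexCategory}
    (φ : ∀ r : SimplexCategory, (r ⟶ p) → (r ⟶ q) → (C ⊗ (cosimplicial F).obj r ⟶ T))
    (hφ : ∀ ⦃r s : SimplexCategory⦄ (θ : r ⟶ s) (a : s ⟶ p) (b : s ⟶ q),
      C ◁ (cosimplicial F).map θ ≫ φ s a b = φ r (θ ≫ a) (θ ≫ b)) :
    ∃ h : C ⊗ ((cosimplicial F).obj p ⊗ (cosimplicial F).obj q) ⟶ T,
      ∀ (r : SimplexCategory) (a : r ⟶ p) (b : r ⟶ q),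
        C ◁ lift ((cosimplicial F).map a) ((cosimplicial F).map b) ≫ h = φ r a b := by
  choose α β hαβ using fun r (k : simplices.obj r ⟶ simplices.{v}.obj p ⊗ simplices.obj q) =>
    exists_eq_lift_simplices k
  have hα {r} (a : r ⟶ p) (b : r ⟶ q) : α r (lift (simplices.map a) (simplices.map b)) = a :=
    simplices_map_injective (by
      simpa using congrArg (· ≫ fst _ _) (hαβ r (lift (simplices.map a) (simplices.map b))).symm)
  have hβ {r} (a : r ⟶ p) (b : r ⟶ q) : β r (lift (simplices.map a) (simplices.map b)) = b :=
    simplices_map_injective (by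
      simpa using congrArg (· ≫ snd _ _) (hαβ r (lift (simplices.map a) (simplices.map b))).symm)
  obtain ⟨h₀, hh₀⟩ := exists_tensor_desc F (Z := C.X) (T := T.X)
    (K := simplices.obj p ⊗ simplices.obj q)
    (fun r k => homOf (φ r (α r k) (β r k))) (fun r s θ k => by
        obtain ⟨a, b, rfl⟩ := exists_eq_lift_simplices k
        rw [comp_lift, ← Functor.map_comp, ← Functor.map_comp, hα, hβ, hα, hβ]
        exact congrArg homOf (hφ θ a b))
  let h₁ : C.X ⊗ (F.obj (simplices.obj p) ⊗ F.obj (simplices.obj q)) ⟶ T.X :=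
    C.X ◁ Functor.LaxMonoidal.μ F _ _ ≫ h₀
  have h₂ {r : SimplexCategory} (a : r ⟶ p) (b : r ⟶ q) :
      homOf (C ◁ lift ((cosimplicial F).map a) ((cosimplicial F).map b)) ≫ h₁ =
        homOf (φ r a b) := by
    have := hh₀ r (lift (simplices.map a) (simplices.map b))
    rw [hα, hβ] at this
    refine (whiskerLeft_lift_cosimplicial_comp F a b C.X h₁).trans ?_
    simp only [h₁, ← whiskerLeft_comp_assoc, Functor.Monoidal.δ_μ,
      Category.comp_id]
    exact this
  have h₃ : IsComonHom (M := (C ⊗ ((cosimplicial F).obj p ⊗ (cosimplicial F).obj q)).X) h₁ :=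
    ((covering_lift_cosimplicial F p q).whiskerLeft C).isComonHom _ (by
      rintro _ _ ⟨⟨r, a, b⟩⟩
      refine Eq.mpr (congrArg _ (h₂ a b)) ?_
      infer_instance)
  exact ⟨homMk (A := C ⊗ ((cosimplicial F).obj p ⊗ (cosimplicial F).obj q)) _ h₃,
    fun r a b => homOf_injective (h₂ a b)⟩

end Simplices
/-! ### Classes in geometric realizations -/

section SimplexCls

variable {V : Type u} [Category.{v} V] [MonoidalCategory V] [SymmetricCategory V]
  [HasColimits V] (D : SimplexCategory ⥤ CommComon V)

/-- The structure maps `X p ⊗ D p ⟶ |X|`, typed with the value of the functor `realization`. -/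
noncomputable def geomι (X : SimplexCategoryᵒᵖ ⥤ CommComon V) (p : SimplexCategory) :
    X.obj (op p) ⊗ D.obj p ⟶ (realization D).obj X :=
  realizationι D X p

variable {X Y Z : SimplexCategoryᵒᵖ ⥤ CommComon V}

lemma geomι_condition {p q : SimplexCategory} (θ : p ⟶ q) :
    X.map θ.op ▷ D.obj p ≫ geomι D X p = X.obj (op q) ◁ D.map θ ≫ geomι D X q :=
  realizationι_condition D X θ

lemma geomι_map (f : X ⟶ Y) (p : SimplexCategory) :
    geomι D X p ≫ (realization D).map f = f.app (op p) ▷ D.obj p ≫ geomι D Y p :=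
  realizationι_map D f p

variable (X) in
/-- The class `[x ; d]` in the geometric realization of `X` of a generalized element of
`X p ⊗ D p`. -/
noncomputable def simplexCls {T : CommComon V}
    {p : SimplexCategory} (x : T ⟶ X.obj (op p)) (d : T ⟶ D.obj p) : T ⟶ (realization D).obj X :=
  lift x d ≫ geomι D X p

lemma comp_simplexCls {T T' : CommComon V} (f : T' ⟶ T) {p : SimplexCategory}
    (x : T ⟶ X.obj (op p)) (d : T ⟶ D.obj p) :
    f ≫ simplexCls D X x d = simplexCls D X (f ≫ x) (f ≫ d) := by
  rw [simplexCls, simplexCls, ← comp_lift, Category.assoc]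

lemma simplexCls_map {T : CommComon V} {p q : SimplexCategory} (θ : p ⟶ q)
    (x : T ⟶ X.obj (op q)) (d : T ⟶ D.obj p) :
    simplexCls D X (x ≫ X.map θ.op) d = simplexCls D X x (d ≫ D.map θ) := by
  have := congrArg (fun t => lift x d ≫ t) (geomι_condition D (X := X) θ)
  simpa [simplexCls] using this

lemma simplexCls_comp_map (f : X ⟶ Y) {T : CommComon V} {p : SimplexCategory}
    (x : T ⟶ X.obj (op p)) (d : T ⟶ D.obj p) :
    simplexCls D X x d ≫ (realization D).map f = simplexCls D Y (x ≫ f.app (op p)) d := by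
  rw [simplexCls, Category.assoc, geomι_map]
  simp [simplexCls]

variable (X) in
lemma geomι_eq (p : SimplexCategory) : geomι D X p = simplexCls D X (fst _ _) (snd _ _) := by
  rw [simplexCls, lift_fst_snd, Category.id_comp]

variable [MonoidalClosed V]

variable (X) in
lemma covering_geomι :
    Covering (Presieve.ofArrows (fun p => X.obj (op p) ⊗ D.obj p) (geomι D X)) :=
  covering_coCoendι (realizationBifunctor D X)

variable {D}

lemma exists_geomι_desc {C T : CommComon V}
    (f : ∀ p : SimplexCategory, C ⊗ (X.obj (op p) ⊗ D.obj p) ⟶ T)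
    (hf : ∀ ⦃p q : SimplexCategory⦄ (θ : p ⟶ q),
      C ◁ X.map θ.op ▷ D.obj p ≫ f p = C ◁ X.obj (op q) ◁ D.map θ ≫ f q) :
    ∃ h : C ⊗ (realization D).obj X ⟶ T, ∀ p, C ◁ geomι D X p ≫ h = f p :=
  exists_coCoend_desc (K := realizationBifunctor D X) f hf

lemma realization_hom_ext_right {C T : CommComon V} {f g : C ⊗ (realization D).obj X ⟶ T}
    (h : ∀ ⦃Q : CommComon V⦄ ⦃p : SimplexCategory⦄ (c : Q ⟶ C) (x : Q ⟶ X.obj (op p))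
      (d : Q ⟶ D.obj p), lift c (simplexCls D X x d) ≫ f = lift c (simplexCls D X x d) ≫ g) :
    f = g :=
  ((covering_geomι D X).whiskerLeft C).family_hom_ext (fun p => by
    have : C ◁ geomι D X p =
        lift (fst _ _) (simplexCls D X (snd _ _ ≫ fst _ _) (snd _ _ ≫ snd _ _)) := by
      rw [← comp_simplexCls, ← geomι_eq]
      exact CartesianMonoidalCategory.hom_ext _ _ (by simp) (by simp)
    rw [this]
    exact h _ _ _)

lemma realization_hom_ext_left {C T : CommComon V} {f g : (realization D).obj X ⊗ C ⟶ T}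
    (h : ∀ ⦃Q : CommComon V⦄ ⦃p : SimplexCategory⦄ (x : Q ⟶ X.obj (op p))
      (d : Q ⟶ D.obj p) (c : Q ⟶ C),
      lift (simplexCls D X x d) c ≫ f = lift (simplexCls D X x d) c ≫ g) :
    f = g := by
  rw [← cancel_epi (β_ _ _).hom]
  exact realization_hom_ext_right fun Q p c x d => by simpa using h x d c

lemma realization_hom_ext {T : CommComon V} {f g : (realization D).obj X ⟶ T}
    (h : ∀ ⦃Q : CommComon V⦄ ⦃p : SimplexCategory⦄ (x : Q ⟶ X.obj (op p))
      (d : Q ⟶ D.obj p), simplexCls D X x d ≫ f = simplexCls D X x d ≫ g) : f = g :=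
  (covering_geomι D X).family_hom_ext (fun p => by
    rw [geomι_eq]
    exact h _ _)

/-- Descent along the geometric realization, with a parameter in `C`. -/
lemma exists_realization_desc_right {C T : CommComon V}
    (f : ∀ ⦃Q : CommComon V⦄ ⦃p : SimplexCategory⦄,
      (Q ⟶ C) → (Q ⟶ X.obj (op p)) → (Q ⟶ D.obj p) → (Q ⟶ T))
    (hf : ∀ ⦃Q Q' : CommComon V⦄ (t : Q' ⟶ Q) ⦃p : SimplexCategory⦄ (c : Q ⟶ C)
      (x : Q ⟶ X.obj (op p)) (d : Q ⟶ D.obj p), t ≫ f c x d = f (t ≫ c) (t ≫ x) (t ≫ d))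
    (hθ : ∀ ⦃Q : CommComon V⦄ ⦃p q : SimplexCategory⦄ (θ : p ⟶ q) (c : Q ⟶ C)
      (x : Q ⟶ X.obj (op q)) (d : Q ⟶ D.obj p), f c (x ≫ X.map θ.op) d = f c x (d ≫ D.map θ)) :
    ∃ h : C ⊗ (realization D).obj X ⟶ T, ∀ ⦃Q : CommComon V⦄ ⦃p : SimplexCategory⦄
      (c : Q ⟶ C) (x : Q ⟶ X.obj (op p)) (d : Q ⟶ D.obj p),
      lift c (simplexCls D X x d) ≫ h = f c x d := by
  obtain ⟨h, hh⟩ := exists_geomι_desc (D := D) (X := X) (C := C) (T := T)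
    (fun p => f (fst _ _) (snd _ _ ≫ fst _ _) (snd _ _ ≫ snd _ _))
    (fun p q θ => by
      rw [hf, hf]
      have := hθ θ (fst C (X.obj (op q) ⊗ D.obj p)) (snd _ _ ≫ fst _ _) (snd _ _ ≫ snd _ _)
      simpa using this)
  refine ⟨h, fun Q p c x d => ?_⟩
  have := congrArg (fun t => lift c (lift x d) ≫ t) (hh p)
  rw [hf, lift_whiskerLeft_assoc] at this
  simpa [simplexCls] using this

lemma exists_realization_desc_left {C T : CommComon V}
    (f : ∀ ⦃Q : CommComon V⦄ ⦃p : SimplexCategory⦄,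
      (Q ⟶ X.obj (op p)) → (Q ⟶ D.obj p) → (Q ⟶ C) → (Q ⟶ T))
    (hf : ∀ ⦃Q Q' : CommComon V⦄ (t : Q' ⟶ Q) ⦃p : SimplexCategory⦄
      (x : Q ⟶ X.obj (op p)) (d : Q ⟶ D.obj p) (c : Q ⟶ C),
      t ≫ f x d c = f (t ≫ x) (t ≫ d) (t ≫ c))
    (hθ : ∀ ⦃Q : CommComon V⦄ ⦃p q : SimplexCategory⦄ (θ : p ⟶ q)
      (x : Q ⟶ X.obj (op q)) (d : Q ⟶ D.obj p) (c : Q ⟶ C),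
      f (x ≫ X.map θ.op) d c = f x (d ≫ D.map θ) c) :
    ∃ h : (realization D).obj X ⊗ C ⟶ T, ∀ ⦃Q : CommComon V⦄ ⦃p : SimplexCategory⦄
      (x : Q ⟶ X.obj (op p)) (d : Q ⟶ D.obj p) (c : Q ⟶ C),
      lift (simplexCls D X x d) c ≫ h = f x d c := by
  obtain ⟨h, hh⟩ := exists_realization_desc_right (C := C) (T := T) (X := X) (D := D)
    (fun Q p c x d => f x d c) (fun Q Q' t p c x d => hf t x d c)
    (fun Q p q θ c x d => hθ θ x d c)
  exact ⟨(β_ _ _).hom ≫ h, fun Q p x d c => by rw [← hh]; simp⟩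

end SimplexCls

section Product

variable {V : Type u} [Category.{v} V] [MonoidalCategory V] [SymmetricCategory V]
  [MonoidalClosed V] (F : SSet.{v} ⥤ V) [F.Braided] [F.IsLeftAdjoint]

local notation "𝔻" => cosimplicial F

variable {F}

/-- Equality of morphisms out of a product with two simplices can be checked on the simplices of
the product of the simplices. -/
lemma Covering.of_cosimplicial {B : CommComon V} {p q : SimplexCategory}
    {S : Presieve (B ⊗ ((𝔻).obj p ⊗ (𝔻).obj q))}
    (h : ∀ ⦃r : SimplexCategory⦄ ⦃Q : CommComon V⦄ (b : Q ⟶ B) (d : Q ⟶ (𝔻).obj r)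
      (α : r ⟶ p) (β : r ⟶ q), S (lift b (lift (d ≫ (𝔻).map α) (d ≫ (𝔻).map β)))) :
    Covering S :=
  ((covering_lift_cosimplicial F p q).whiskerLeft B).of_mem fun ⟨r, α, β⟩ => by
    have := h (fst B ((𝔻).obj r)) (snd _ _) α β
    rw [← comp_lift] at this
    convert this using 1
    exact CartesianMonoidalCategory.hom_ext _ _ (by simp) (by simp)

lemma cosimplicial_hom_ext {B T : CommComon V} {p q : SimplexCategory}
    {f g : B ⊗ ((𝔻).obj p ⊗ (𝔻).obj q) ⟶ T}
    (h : ∀ ⦃r : SimplexCategory⦄ ⦃Q : CommComon V⦄ (b : Q ⟶ B) (d : Q ⟶ (𝔻).obj r)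
      (α : r ⟶ p) (β : r ⟶ q), lift b (lift (d ≫ (𝔻).map α) (d ≫ (𝔻).map β)) ≫ f =
        lift b (lift (d ≫ (𝔻).map α) (d ≫ (𝔻).map β)) ≫ g) : f = g :=
  (Covering.of_cosimplicial (S := fun _ t => t ≫ f = t ≫ g) h).hom_ext fun _ _ => id

variable [HasColimits V]

variable (F) in
/-- The canonical morphisms `(X r ⊗ Y r) ⊗ F Δ^r ⟶ |X| ⊗ |Y|`. -/
noncomputable def geomPair (X Y : SimplexCategoryᵒᵖ ⥤ CommComon V) (r : SimplexCategory) :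
    (X.obj (op r) ⊗ Y.obj (op r)) ⊗ (𝔻).obj r ⟶ (realization 𝔻).obj X ⊗ (realization 𝔻).obj Y :=
  lift (simplexCls 𝔻 X (fst _ _ ≫ fst _ _) (snd _ _))
    (simplexCls 𝔻 Y (fst _ _ ≫ snd _ _) (snd _ _))

/-- The realization commutes with products: `|X| ⊗ |Y|` is covered by the classes
`([x ; d], [y ; d])` with the same second component. -/
lemma covering_geomPair (X Y : SimplexCategoryᵒᵖ ⥤ CommComon V) :
    Covering (Presieve.ofArrows _ (geomPair F X Y)) := by
  have h : Covering (P := (realization 𝔻).obj X ⊗ (realization 𝔻).obj Y) (fun Q t =>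
      ∃ (r : SimplexCategory) (x : Q ⟶ X.obj (op r)) (y : Q ⟶ Y.obj (op r)) (d : Q ⟶ (𝔻).obj r),
        t = lift (simplexCls 𝔻 X x d) (simplexCls 𝔻 Y y d)) := by
    refine ((covering_geomι 𝔻 X).whiskerRight _).trans fun p =>
      ((covering_geomι 𝔻 Y).whiskerLeft _).trans fun q => ?_
    refine Covering.of_section
      (R := (X.obj (op p) ⊗ Y.obj (op q)) ⊗ ((𝔻).obj p ⊗ (𝔻).obj q))
      (lift (lift (fst _ _ ≫ fst _ _) (snd _ _ ≫ fst _ _))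
        (lift (fst _ _ ≫ snd _ _) (snd _ _ ≫ snd _ _)))
      (lift (lift (fst _ _ ≫ fst _ _) (snd _ _ ≫ fst _ _))
        (lift (fst _ _ ≫ snd _ _) (snd _ _ ≫ snd _ _))) ?_
      (Covering.of_cosimplicial fun r Q b d α β => ?_)
    · refine CartesianMonoidalCategory.hom_ext _ _ ?_ ?_ <;>
        refine CartesianMonoidalCategory.hom_ext _ _ ?_ ?_ <;> simp
    · refine ⟨r, b ≫ fst _ _ ≫ X.map α.op, b ≫ snd _ _ ≫ Y.map β.op, d, ?_⟩
      have h₁ := simplexCls_map 𝔻 (X := X) α (b ≫ fst _ _) d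
      have h₂ := simplexCls_map 𝔻 (X := Y) β (b ≫ snd _ _) d
      rw [Category.assoc] at h₁ h₂
      rw [h₁, h₂, simplexCls, simplexCls]
      refine CartesianMonoidalCategory.hom_ext _ _ ?_ ?_ <;> simp
  refine h.of_factors ?_
  rintro Q _ ⟨r, x, y, d, rfl⟩
  refine ⟨r, lift (lift x y) d, ?_⟩
  rw [geomPair, comp_lift, comp_simplexCls, comp_simplexCls]
  simp

variable {X Y Z : SimplexCategoryᵒᵖ ⥤ CommComon V}

lemma realization_pair_hom_ext_left {C T : CommComon V}
    {f g : ((realization 𝔻).obj X ⊗ (realization 𝔻).obj Y) ⊗ C ⟶ T}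
    (h : ∀ ⦃Q : CommComon V⦄ ⦃r : SimplexCategory⦄ (x : Q ⟶ X.obj (op r)) (y : Q ⟶ Y.obj (op r))
      (d : Q ⟶ (𝔻).obj r) (c : Q ⟶ C),
      lift (lift (simplexCls 𝔻 X x d) (simplexCls 𝔻 Y y d)) c ≫ f =
        lift (lift (simplexCls 𝔻 X x d) (simplexCls 𝔻 Y y d)) c ≫ g) : f = g :=
  ((covering_geomPair X Y).whiskerRight C).family_hom_ext (fun r => by
    have : geomPair F X Y r ▷ C = lift (fst _ _ ≫ geomPair F X Y r) (snd _ _) :=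
      CartesianMonoidalCategory.hom_ext _ _ (by simp) (by simp)
    rw [this, geomPair, comp_lift, comp_simplexCls, comp_simplexCls]
    exact h _ _ _ _)

lemma realization_pair_hom_ext {T : CommComon V}
    {f g : (realization 𝔻).obj X ⊗ (realization 𝔻).obj Y ⟶ T}
    (h : ∀ ⦃Q : CommComon V⦄ ⦃r : SimplexCategory⦄ (x : Q ⟶ X.obj (op r)) (y : Q ⟶ Y.obj (op r))
      (d : Q ⟶ (𝔻).obj r), lift (simplexCls 𝔻 X x d) (simplexCls 𝔻 Y y d) ≫ f =
        lift (simplexCls 𝔻 X x d) (simplexCls 𝔻 Y y d) ≫ g) : f = g :=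
  (covering_geomPair X Y).family_hom_ext (fun r => by
    exact h _ _ _)

lemma realization_triple_hom_ext {T : CommComon V}
    {f g : ((realization 𝔻).obj X ⊗ (realization 𝔻).obj Y) ⊗ (realization 𝔻).obj Z ⟶ T}
    (h : ∀ ⦃Q : CommComon V⦄ ⦃r : SimplexCategory⦄ (x : Q ⟶ X.obj (op r)) (y : Q ⟶ Y.obj (op r))
      (z : Q ⟶ Z.obj (op r)) (d : Q ⟶ (𝔻).obj r),
      lift (lift (simplexCls 𝔻 X x d) (simplexCls 𝔻 Y y d)) (simplexCls 𝔻 Z z d) ≫ f =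
        lift (lift (simplexCls 𝔻 X x d) (simplexCls 𝔻 Y y d)) (simplexCls 𝔻 Z z d) ≫ g) :
    f = g := by
  have key {Q : CommComon V} {p q : SimplexCategory} (x : Q ⟶ X.obj (op p)) (y : Q ⟶ Y.obj (op p))
      (z : Q ⟶ Z.obj (op q)) (d : Q ⟶ (𝔻).obj p) (e : Q ⟶ (𝔻).obj q) :
      lift (lift (simplexCls 𝔻 X x d) (simplexCls 𝔻 Y y d)) (simplexCls 𝔻 Z z e) ≫ f =
        lift (lift (simplexCls 𝔻 X x d) (simplexCls 𝔻 Y y d)) (simplexCls 𝔻 Z z e) ≫ g := by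
    let B := (X.obj (op p) ⊗ Y.obj (op p)) ⊗ Z.obj (op q)
    let u : B ⊗ ((𝔻).obj p ⊗ (𝔻).obj q) ⟶ _ :=
      lift (lift (simplexCls 𝔻 X (fst _ _ ≫ fst _ _ ≫ fst _ _) (snd _ _ ≫ fst _ _))
        (simplexCls 𝔻 Y (fst _ _ ≫ fst _ _ ≫ snd _ _) (snd _ _ ≫ fst _ _)))
        (simplexCls 𝔻 Z (fst _ _ ≫ snd _ _) (snd _ _ ≫ snd _ _))
    have hu {Q : CommComon V} (b : Q ⟶ B) (d : Q ⟶ (𝔻).obj p) (e : Q ⟶ (𝔻).obj q) :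
        lift b (lift d e) ≫ u = lift (lift (simplexCls 𝔻 X (b ≫ fst _ _ ≫ fst _ _) d)
          (simplexCls 𝔻 Y (b ≫ fst _ _ ≫ snd _ _) d)) (simplexCls 𝔻 Z (b ≫ snd _ _) e) := by
      simp [u, comp_lift, comp_simplexCls]
    have : u ≫ f = u ≫ g := cosimplicial_hom_ext fun r Q b d α β => by
      rw [reassoc_of% hu, reassoc_of% hu, ← simplexCls_map, ← simplexCls_map, ← simplexCls_map]
      exact h _ _ _ _
    have := congrArg (fun t => lift (lift (lift x y) z) (lift d e) ≫ t) this
    simpa [reassoc_of% hu, B] using this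
  refine ((covering_geomPair X Y).whiskerRight _).family_hom_ext fun r => ?_
  refine realization_hom_ext_right fun Q q c z e => ?_
  rw [lift_whiskerRight_assoc, lift_whiskerRight_assoc, geomPair, comp_lift, comp_simplexCls,
    comp_simplexCls]
  exact key _ _ _ _ _

/-- Descent along `|X| ⊗ |Y|`: a family of morphisms on the classes `([x ; d], [y ; d])` that is
compatible with the simplicial operators comes from a morphism. -/
lemma exists_realization_pair_desc {T : CommComon V}
    (f : ∀ ⦃Q : CommComon V⦄ ⦃r : SimplexCategory⦄,
      (Q ⟶ X.obj (op r)) → (Q ⟶ Y.obj (op r)) → (Q ⟶ (𝔻).obj r) → (Q ⟶ T))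
    (hf : ∀ ⦃Q Q' : CommComon V⦄ (t : Q' ⟶ Q) ⦃r : SimplexCategory⦄ (x : Q ⟶ X.obj (op r))
      (y : Q ⟶ Y.obj (op r)) (d : Q ⟶ (𝔻).obj r), t ≫ f x y d = f (t ≫ x) (t ≫ y) (t ≫ d))
    (hθ : ∀ ⦃Q : CommComon V⦄ ⦃r s : SimplexCategory⦄ (θ : r ⟶ s) (x : Q ⟶ X.obj (op s))
      (y : Q ⟶ Y.obj (op s)) (d : Q ⟶ (𝔻).obj r),
      f (x ≫ X.map θ.op) (y ≫ Y.map θ.op) d = f x y (d ≫ (𝔻).map θ)) :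
    ∃ h : (realization 𝔻).obj X ⊗ (realization 𝔻).obj Y ⟶ T,
      ∀ ⦃Q : CommComon V⦄ ⦃r : SimplexCategory⦄ (x : Q ⟶ X.obj (op r)) (y : Q ⟶ Y.obj (op r))
        (d : Q ⟶ (𝔻).obj r), lift (simplexCls 𝔻 X x d) (simplexCls 𝔻 Y y d) ≫ h = f x y d := by
  -- For fixed `p` and `q`, descent along the simplices of `Δ^p × Δ^q` defines the morphism on
  -- `(X p ⊗ Y q) ⊗ (F Δ^p ⊗ F Δ^q)`.
  have step₁ (p q : SimplexCategory) :
      ∃ h : (X.obj (op p) ⊗ Y.obj (op q)) ⊗ ((𝔻).obj p ⊗ (𝔻).obj q) ⟶ T,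
      ∀ ⦃Q : CommComon V⦄ ⦃r : SimplexCategory⦄ (x : Q ⟶ X.obj (op p)) (y : Q ⟶ Y.obj (op q))
        (d : Q ⟶ (𝔻).obj r) (α : r ⟶ p) (β : r ⟶ q),
        lift (lift x y) (lift (d ≫ (𝔻).map α) (d ≫ (𝔻).map β)) ≫ h =
          f (x ≫ X.map α.op) (y ≫ Y.map β.op) d := by
    obtain ⟨h, hh⟩ := exists_cosimplicial_desc F (p := p) (q := q) (T := T)
      (C := X.obj (op p) ⊗ Y.obj (op q))
      (fun r α β => f (fst _ _ ≫ fst _ _ ≫ X.map α.op) (fst _ _ ≫ snd _ _ ≫ Y.map β.op) (snd _ _))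
      (fun r s θ α β => by
        have := hθ θ (fst _ ((𝔻).obj r) ≫ fst _ _ ≫ X.map α.op) (fst _ _ ≫ snd _ _ ≫ Y.map β.op)
          (snd _ _)
        rw [hf]
        simpa using this.symm)
    refine ⟨h, fun Q r x y d α β => ?_⟩
    have := congrArg (fun t => lift (lift x y) d ≫ t) (hh r α β)
    simpa [hf] using this
  choose H hH using step₁
  -- These morphisms are compatible with simplicial operators in both variables separately.
  have step₂ {p p' q q' : SimplexCategory} (θ : p ⟶ p') (ψ : q ⟶ q') ⦃Q : CommComon V⦄
      (x : Q ⟶ X.obj (op p')) (y : Q ⟶ Y.obj (op q')) (d : Q ⟶ (𝔻).obj p) (e : Q ⟶ (𝔻).obj q) :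
      lift (lift (x ≫ X.map θ.op) (y ≫ Y.map ψ.op)) (lift d e) ≫ H p q =
        lift (lift x y) (lift (d ≫ (𝔻).map θ) (e ≫ (𝔻).map ψ)) ≫ H p' q' := by
    have : (X.map θ.op ⊗ₘ Y.map ψ.op) ▷ _ ≫ H p q =
        _ ◁ ((𝔻).map θ ⊗ₘ (𝔻).map ψ) ≫ H p' q' :=
      cosimplicial_hom_ext fun r Q b d α β => by
        have h₁ := hH p q (b ≫ fst _ _ ≫ X.map θ.op) (b ≫ snd _ _ ≫ Y.map ψ.op) d α β
        have h₂ := hH p' q' (b ≫ fst _ _) (b ≫ snd _ _) d (α ≫ θ) (β ≫ ψ)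
        have hb : b ≫ (X.map θ.op ⊗ₘ Y.map ψ.op) =
            lift (b ≫ fst _ _ ≫ X.map θ.op) (b ≫ snd _ _ ≫ Y.map ψ.op) :=
          CartesianMonoidalCategory.hom_ext _ _ (by simp) (by simp)
        have hb' : b = lift (b ≫ fst _ _) (b ≫ snd _ _) :=
          CartesianMonoidalCategory.hom_ext _ _ (by simp) (by simp)
        rw [lift_whiskerRight_assoc, lift_whiskerLeft_assoc, hb, h₁, lift_map]
        simp only [Functor.map_comp, op_comp, Category.assoc] at h₂ ⊢
        rw [← h₂, ← hb']
    have := congrArg (fun t => lift (lift x y) (lift d e) ≫ t) this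
    simpa using this
  -- Hence they descend to `|Y|`, for fixed `p`, and then to `|X|`.
  have step₃ := fun p : SimplexCategory => exists_realization_desc_right (X := Y) (D := 𝔻)
    (C := X.obj (op p) ⊗ (𝔻).obj p) (T := T)
    (fun Q q c y e => lift (lift (c ≫ fst _ _) y) (lift (c ≫ snd _ _) e) ≫ H p q)
    (fun Q Q' t q c y e => by simp only [comp_lift_assoc, comp_lift, Category.assoc])
    (fun Q q q' ψ c y e => by simpa using step₂ (𝟙 p) ψ (c ≫ fst _ _) y (c ≫ snd _ _) e)
  choose K hK using step₃
  obtain ⟨h, hh⟩ := exists_realization_desc_left (X := X) (D := 𝔻)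
    (C := (realization 𝔻).obj Y) (T := T) (fun Q p x d t => lift (lift x d) t ≫ K p)
    (fun Q Q' t p x d c => by simp only [comp_lift_assoc, comp_lift])
    (fun Q p p' θ x d t => by
      have : (X.map θ.op ▷ (𝔻).obj p) ▷ _ ≫ K p = (_ ◁ (𝔻).map θ) ▷ _ ≫ K p' :=
        realization_hom_ext_right fun Q q c y e => by
          rw [lift_whiskerRight_assoc, lift_whiskerRight_assoc, hK, hK]
          simpa using step₂ θ (𝟙 q) (c ≫ fst _ _) y (c ≫ snd _ _) e
      have := congrArg (fun u => lift (lift x d) t ≫ u) this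
      simpa using this)
  refine ⟨h, fun Q r x y d => ?_⟩
  rw [hh, hK]
  simpa using hH r r x y d (𝟙 r) (𝟙 r)

end Product
/-! ### Classes in bar constructions -/

section Pow

variable {C : Type u} [Category.{v} C] [CartesianMonoidalCategory C]

lemma comp_powLift {T T' A : C} (f : T' ⟶ T) {n : ℕ} (x : Fin n → (T ⟶ A)) :
    f ≫ powLift x = powLift fun i => f ≫ x i :=
  pow_hom_ext fun i => by rw [Category.assoc, powLift_proj, powLift_proj]

lemma powLift_comp_proj {T A : C} {n : ℕ} (x : T ⟶ pow A n) :
    (powLift fun i => x ≫ powProj A n i) = x :=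
  pow_hom_ext fun i => by rw [powLift_proj]

end Pow

section Bar

variable {V : Type u} [Category.{v} V] [MonoidalCategory V] [SymmetricCategory V]

/-- The components of a generalized element of `B_p A = A ^ p`. -/
def barEntries {A : AbObj (CommComon V)} {T : CommComon V} {p : SimplexCategory}
    (x : T ⟶ ((simplicialBar (CommComon V)).obj A).obj (op p)) (i : Fin p.len) : T ⟶ A.X :=
  x ≫ powProj A.X p.len i

lemma barEntries_comp {A : AbObj (CommComon V)} {T T' : CommComon V} (f : T' ⟶ T)
    {p : SimplexCategory} (x : T ⟶ ((simplicialBar (CommComon V)).obj A).obj (op p)) :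
    barEntries (f ≫ x) = fun i => f ≫ barEntries x i :=
  funext fun i => Category.assoc f x (powProj A.X p.len i)

lemma barEntries_powLift {A : AbObj (CommComon V)} {T : CommComon V} {p : SimplexCategory}
    (x : Fin p.len → (T ⟶ A.X)) : barEntries (A := A) (p := p) (powLift x) = x :=
  funext fun i => powLift_proj x i

lemma barEntries_map {A : AbObj (CommComon V)} {T : CommComon V} {p q : SimplexCategory}
    (θ : p ⟶ q) (x : T ⟶ ((simplicialBar (CommComon V)).obj A).obj (op q)) :
    barEntries (x ≫ ((simplicialBar (CommComon V)).obj A).map θ.op) =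
      segSum θ.toOrderHom (barEntries x) :=
  funext fun i => (Category.assoc x _ (powProj A.X p.len i)).trans
    ((congrArg (fun t => x ≫ t) (powLift_proj _ i)).trans (comp_segSum _ _ _ _))

lemma powLift_comp_simplicialBar_map (A : AbObj (CommComon V)) {T : CommComon V}
    {p q : SimplexCategory} (θ : p ⟶ q) (x : Fin q.len → (T ⟶ A.X)) :
    powLift x ≫ ((simplicialBar (CommComon V)).obj A).map θ.op =
      powLift (segSum θ.toOrderHom x) :=
  (comp_powLift (powLift x) _).trans (congrArg powLift (funext fun i => by
    dsimp
    rw [comp_segSum]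
    simp only [powLift_proj]))

variable [HasColimits V] (D : SimplexCategory ⥤ CommComon V) (A : AbObj (CommComon V))

lemma simplexCls_eq {T : CommComon V} {p : SimplexCategory}
    (x : T ⟶ ((simplicialBar (CommComon V)).obj A).obj (op p)) (d : T ⟶ D.obj p) :
    simplexCls D ((simplicialBar (CommComon V)).obj A) x d =
      barCls D A (p := p.len) (barEntries x) d :=
  (congrArg (fun t => simplexCls D ((simplicialBar (CommComon V)).obj A) t d)
    (powLift_comp_proj (A := A.X) (n := p.len) x)).symm

lemma comp_barCls {T T' : CommComon V} (f : T' ⟶ T) {p : ℕ} (x : Fin p → (T ⟶ A.X))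
    (d : T ⟶ D.obj (SimplexCategory.mk p)) :
    f ≫ barCls D A x d = barCls D A (fun i => f ≫ x i) (f ≫ d) :=
  (comp_simplexCls D f (X := (simplicialBar (CommComon V)).obj A)
    (p := SimplexCategory.mk p) (powLift x) d).trans
    (congrArg (fun t => simplexCls D ((simplicialBar (CommComon V)).obj A)
      (p := SimplexCategory.mk p) t (f ≫ d)) (comp_powLift f x))

variable {A} in
lemma barCls_comp_map {A' : AbObj (CommComon V)} (f : A ⟶ A') {T : CommComon V} {p : ℕ}
    (x : Fin p → (T ⟶ A.X)) (d : T ⟶ D.obj (SimplexCategory.mk p)) :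
    barCls D A x d ≫ (bar D).map f = barCls D A' (fun i => x i ≫ f.hom) d :=
  (simplexCls_comp_map D ((simplicialBar (CommComon V)).map f)
    (p := SimplexCategory.mk p) (powLift x) d).trans
    (congrArg (fun t => simplexCls D ((simplicialBar (CommComon V)).obj A')
      (p := SimplexCategory.mk p) t d)
      ((comp_powLift (powLift x) _).trans (congrArg powLift
        (funext fun i => powLift_proj_assoc x i f.hom))))

/-- The defining relation of the coend: simplicial operators can be moved between the components
of a class. -/
lemma barCls_segSum {T : CommComon V} {p q : SimplexCategory} (θ : p ⟶ q)
    (x : Fin q.len → (T ⟶ A.X)) (d : T ⟶ D.obj p) :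
    barCls D A (p := p.len) (segSum θ.toOrderHom x) d =
      barCls D A (p := q.len) x (d ≫ D.map θ) :=
  (congrArg (fun t => simplexCls D ((simplicialBar (CommComon V)).obj A) (p := p) t d)
    (powLift_comp_simplicialBar_map A θ x).symm).trans
    (simplexCls_map D (X := (simplicialBar (CommComon V)).obj A) θ (powLift x) d)

variable {D A} [MonoidalClosed V]

lemma bar_hom_ext {T : CommComon V} {f g : (bar D).obj A ⟶ T}
    (h : ∀ ⦃Q : CommComon V⦄ ⦃p : ℕ⦄ (x : Fin p → (Q ⟶ A.X))
      (d : Q ⟶ D.obj (SimplexCategory.mk p)), barCls D A x d ≫ f = barCls D A x d ≫ g) : f = g :=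
  realization_hom_ext fun Q p x d => by
    rw [simplexCls_eq]
    exact h _ _

lemma bar_hom_ext_right {C T : CommComon V} {f g : C ⊗ (bar D).obj A ⟶ T}
    (h : ∀ ⦃Q : CommComon V⦄ ⦃p : ℕ⦄ (c : Q ⟶ C) (x : Fin p → (Q ⟶ A.X))
      (d : Q ⟶ D.obj (SimplexCategory.mk p)),
      lift c (barCls D A x d) ≫ f = lift c (barCls D A x d) ≫ g) : f = g :=
  realization_hom_ext_right (X := (simplicialBar (CommComon V)).obj A) fun Q p c x d => by
    rw [simplexCls_eq]
    exact h _ _ _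

lemma bar_hom_ext_left {C T : CommComon V} {f g : (bar D).obj A ⊗ C ⟶ T}
    (h : ∀ ⦃Q : CommComon V⦄ ⦃p : ℕ⦄ (x : Fin p → (Q ⟶ A.X))
      (d : Q ⟶ D.obj (SimplexCategory.mk p)) (c : Q ⟶ C),
      lift (barCls D A x d) c ≫ f = lift (barCls D A x d) c ≫ g) : f = g :=
  realization_hom_ext_left (X := (simplicialBar (CommComon V)).obj A) fun Q p x d c => by
    rw [simplexCls_eq]
    exact h _ _ _

lemma exists_bar_desc_right {C T : CommComon V}
    (f : ∀ ⦃Q : CommComon V⦄ ⦃p : ℕ⦄, (Q ⟶ C) → (Fin p → (Q ⟶ A.X)) →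
      (Q ⟶ D.obj (SimplexCategory.mk p)) → (Q ⟶ T))
    (hf : ∀ ⦃Q Q' : CommComon V⦄ (t : Q' ⟶ Q) ⦃p : ℕ⦄ (c : Q ⟶ C) (x : Fin p → (Q ⟶ A.X))
      (d : Q ⟶ D.obj (SimplexCategory.mk p)),
      t ≫ f c x d = f (t ≫ c) (fun i => t ≫ x i) (t ≫ d))
    (hθ : ∀ ⦃Q : CommComon V⦄ ⦃p q : SimplexCategory⦄ (θ : p ⟶ q) (c : Q ⟶ C)
      (x : Fin q.len → (Q ⟶ A.X)) (d : Q ⟶ D.obj p),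
      f (p := p.len) c (segSum θ.toOrderHom x) d = f (p := q.len) c x (d ≫ D.map θ)) :
    ∃ h : C ⊗ (bar D).obj A ⟶ T, ∀ ⦃Q : CommComon V⦄ ⦃p : ℕ⦄ (c : Q ⟶ C)
      (x : Fin p → (Q ⟶ A.X)) (d : Q ⟶ D.obj (SimplexCategory.mk p)),
      lift c (barCls D A x d) ≫ h = f c x d := by
  obtain ⟨h, hh⟩ := exists_realization_desc_right (X := (simplicialBar (CommComon V)).obj A)
    (D := D) (C := C) (T := T) (fun Q p c x d => f (p := p.len) c (barEntries x) d)
    (fun Q Q' t p c x d => by simp only [hf, barEntries_comp])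
    (fun Q p q θ c x d => by rw [← hθ θ, barEntries_map])
  exact ⟨h, fun Q p c x d => (hh c (p := SimplexCategory.mk p) (powLift x) d).trans
    (congrArg (fun t => f c t d) (barEntries_powLift (p := SimplexCategory.mk p) x))⟩

lemma exists_bar_desc_left {C T : CommComon V}
    (f : ∀ ⦃Q : CommComon V⦄ ⦃p : ℕ⦄, (Fin p → (Q ⟶ A.X)) →
      (Q ⟶ D.obj (SimplexCategory.mk p)) → (Q ⟶ C) → (Q ⟶ T))
    (hf : ∀ ⦃Q Q' : CommComon V⦄ (t : Q' ⟶ Q) ⦃p : ℕ⦄ (x : Fin p → (Q ⟶ A.X))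
      (d : Q ⟶ D.obj (SimplexCategory.mk p)) (c : Q ⟶ C),
      t ≫ f x d c = f (fun i => t ≫ x i) (t ≫ d) (t ≫ c))
    (hθ : ∀ ⦃Q : CommComon V⦄ ⦃p q : SimplexCategory⦄ (θ : p ⟶ q)
      (x : Fin q.len → (Q ⟶ A.X)) (d : Q ⟶ D.obj p) (c : Q ⟶ C),
      f (p := p.len) (segSum θ.toOrderHom x) d c = f (p := q.len) x (d ≫ D.map θ) c) :
    ∃ h : (bar D).obj A ⊗ C ⟶ T, ∀ ⦃Q : CommComon V⦄ ⦃p : ℕ⦄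
      (x : Fin p → (Q ⟶ A.X)) (d : Q ⟶ D.obj (SimplexCategory.mk p)) (c : Q ⟶ C),
      lift (barCls D A x d) c ≫ h = f x d c := by
  obtain ⟨h, hh⟩ := exists_bar_desc_right (fun Q p c x d => f x d c)
    (fun Q Q' t p c x d => hf t x d c) (fun Q p q θ c x d => hθ θ x d c)
  exact ⟨(β_ _ _).hom ≫ h, fun Q p x d c => by rw [← hh]; simp⟩

end Bar

section BarPair

variable {V : Type u} [Category.{v} V] [MonoidalCategory V] [SymmetricCategory V]
  [HasColimits V] [MonoidalClosed V] {F : SSet.{v} ⥤ V} [F.Braided] [F.IsLeftAdjoint]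
  {A : AbObj (CommComon V)}

local notation "𝔻" => cosimplicial F

lemma bar_pair_hom_ext_left {C T : CommComon V}
    {f g : ((bar 𝔻).obj A ⊗ (bar 𝔻).obj A) ⊗ C ⟶ T}
    (h : ∀ ⦃Q : CommComon V⦄ ⦃p : ℕ⦄ (x y : Fin p → (Q ⟶ A.X))
      (d : Q ⟶ (𝔻).obj (SimplexCategory.mk p)) (c : Q ⟶ C),
      lift (lift (barCls 𝔻 A x d) (barCls 𝔻 A y d)) c ≫ f =
        lift (lift (barCls 𝔻 A x d) (barCls 𝔻 A y d)) c ≫ g) : f = g :=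
  realization_pair_hom_ext_left (X := (simplicialBar (CommComon V)).obj A)
    (Y := (simplicialBar (CommComon V)).obj A) fun Q p x y d c => by
    rw [simplexCls_eq, simplexCls_eq]
    exact h _ _ _ _

lemma bar_pair_hom_ext {T : CommComon V} {f g : (bar 𝔻).obj A ⊗ (bar 𝔻).obj A ⟶ T}
    (h : ∀ ⦃Q : CommComon V⦄ ⦃p : ℕ⦄ (x y : Fin p → (Q ⟶ A.X))
      (d : Q ⟶ (𝔻).obj (SimplexCategory.mk p)),
      lift (barCls 𝔻 A x d) (barCls 𝔻 A y d) ≫ f =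
        lift (barCls 𝔻 A x d) (barCls 𝔻 A y d) ≫ g) : f = g :=
  realization_pair_hom_ext (X := (simplicialBar (CommComon V)).obj A)
    (Y := (simplicialBar (CommComon V)).obj A) fun Q p x y d => by
    rw [simplexCls_eq, simplexCls_eq]
    exact h _ _ _

lemma bar_triple_hom_ext {T : CommComon V}
    {f g : ((bar 𝔻).obj A ⊗ (bar 𝔻).obj A) ⊗ (bar 𝔻).obj A ⟶ T}
    (h : ∀ ⦃Q : CommComon V⦄ ⦃p : ℕ⦄ (x y z : Fin p → (Q ⟶ A.X))
      (d : Q ⟶ (𝔻).obj (SimplexCategory.mk p)),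
      lift (lift (barCls 𝔻 A x d) (barCls 𝔻 A y d)) (barCls 𝔻 A z d) ≫ f =
        lift (lift (barCls 𝔻 A x d) (barCls 𝔻 A y d)) (barCls 𝔻 A z d) ≫ g) : f = g :=
  realization_triple_hom_ext (X := (simplicialBar (CommComon V)).obj A)
    (Y := (simplicialBar (CommComon V)).obj A) (Z := (simplicialBar (CommComon V)).obj A)
    fun Q p x y z d => by
    rw [simplexCls_eq, simplexCls_eq, simplexCls_eq]
    exact h _ _ _ _

lemma exists_bar_pair_desc {T : CommComon V}
    (f : ∀ ⦃Q : CommComon V⦄ ⦃p : ℕ⦄, (Fin p → (Q ⟶ A.X)) → (Fin p → (Q ⟶ A.X)) →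
      (Q ⟶ (𝔻).obj (SimplexCategory.mk p)) → (Q ⟶ T))
    (hf : ∀ ⦃Q Q' : CommComon V⦄ (t : Q' ⟶ Q) ⦃p : ℕ⦄ (x y : Fin p → (Q ⟶ A.X))
      (d : Q ⟶ (𝔻).obj (SimplexCategory.mk p)),
      t ≫ f x y d = f (fun i => t ≫ x i) (fun i => t ≫ y i) (t ≫ d))
    (hθ : ∀ ⦃Q : CommComon V⦄ ⦃p q : SimplexCategory⦄ (θ : p ⟶ q)
      (x y : Fin q.len → (Q ⟶ A.X)) (d : Q ⟶ (𝔻).obj p),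
      f (p := p.len) (segSum θ.toOrderHom x) (segSum θ.toOrderHom y) d =
        f (p := q.len) x y (d ≫ (𝔻).map θ)) :
    ∃ h : (bar 𝔻).obj A ⊗ (bar 𝔻).obj A ⟶ T, ∀ ⦃Q : CommComon V⦄ ⦃p : ℕ⦄
      (x y : Fin p → (Q ⟶ A.X)) (d : Q ⟶ (𝔻).obj (SimplexCategory.mk p)),
      lift (barCls 𝔻 A x d) (barCls 𝔻 A y d) ≫ h = f x y d := by
  obtain ⟨h, hh⟩ := exists_realization_pair_desc (X := (simplicialBar (CommComon V)).obj A)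
    (Y := (simplicialBar (CommComon V)).obj A) (F := F) (T := T)
    (fun Q p x y d => f (p := p.len) (barEntries x) (barEntries y) d)
    (fun Q Q' t p x y d => by simp only [hf, barEntries_comp])
    (fun Q p q θ x y d => by rw [← hθ θ, barEntries_map, barEntries_map])
  exact ⟨h, fun Q p x y d =>
    (hh (r := SimplexCategory.mk p) (powLift x) (powLift y) d).trans
      (congrArg₂ (fun a b => f a b d) (barEntries_powLift (p := SimplexCategory.mk p) x)
        (barEntries_powLift (p := SimplexCategory.mk p) y))⟩

end BarPair
/-! ### The group structure of the bar construction -/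

section Additive

variable {C : Type u} [Category.{v} C] [CartesianMonoidalCategory C]

/-- A morphism of group objects that preserves addition is a morphism of additive monoids. -/
lemma isAddMonHom_of_add {M N : C} [AddGrpObj M] [AddGrpObj N] (f : M ⟶ N)
    (h : σ[M] ≫ f = (f ⊗ₘ f) ≫ σ[N]) : IsAddMonHom f where
  add_hom := h
  zero_hom := by
    have h₀ : ζ[M] ≫ f + ζ[M] ≫ f = ζ[M] ≫ f := by
      have := congrArg (fun t => lift ζ[M] ζ[M] ≫ t) h
      have e : lift ζ[M] ζ[M] ≫ σ[M] = ζ[M] := by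
        change ζ[M] + ζ[M] = ζ[M]
        rw [AddMonObj.zero_eq_zero, add_zero]
      simp only [reassoc_of% e, lift_map_assoc] at this
      exact this.symm
    rw [AddMonObj.zero_eq_zero (M := N)]
    exact add_eq_left.1 h₀

lemma segSum_add {M : Type*} [AddCommMonoid M] {m n : ℕ} (θ : Fin (m + 1) →o Fin (n + 1))
    (x y : Fin n → M) (j : Fin m) :
    segSum θ (fun i => x i + y i) j = segSum θ x j + segSum θ y j :=
  Finset.sum_add_distrib

end Additive

section BarGroup

variable {V : Type u} [Category.{v} V] [MonoidalCategory V] [SymmetricCategory V]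
  (F : SSet.{v} ⥤ V) [F.Braided]

local notation "𝔻" => cosimplicial F

instance isIso_counitHom_cosimplicial_zero :
    IsIso (counitHom ((𝔻).obj (SimplexCategory.mk 0))) := by
  have h : IsIso (toUnit (SSet.stdSimplex.{v}.obj (SimplexCategory.mk 0))) :=
    isIso_of_isTerminal SSet.stdSimplex.isTerminalObj₀ isTerminalTensorUnit _
  have : IsIso (homOf (counitHom ((𝔻).obj (SimplexCategory.mk 0)))) := by
    change IsIso (F.map (toUnit (SSet.stdSimplex.{v}.obj (SimplexCategory.mk 0))) ≫
      Functor.OplaxMonoidal.η F)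
    have : IsIso (Functor.OplaxMonoidal.η F) := (Functor.Monoidal.εIso F).isIso_inv
    infer_instance
  exact isIso_of_homOf _

/-- The point of `F Δ^0`. -/
noncomputable def cosimplicialPoint : 𝟙_ (CommComon V) ⟶ (𝔻).obj (SimplexCategory.mk 0) :=
  inv (counitHom ((𝔻).obj (SimplexCategory.mk 0)))

lemma eq_cosimplicialPoint {T : CommComon V} (d : T ⟶ (𝔻).obj (SimplexCategory.mk 0)) :
    d = toUnit T ≫ cosimplicialPoint F := by
  rw [cosimplicialPoint, IsIso.eq_comp_inv]
  exact toUnit_unique _ _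

variable [HasColimits V] (A : AbObj (CommComon V))

/-- The zero of the bar construction: the class of the empty sequence over the point of `F Δ^0`. -/
noncomputable def barZero : 𝟙_ (CommComon V) ⟶ (bar 𝔻).obj A :=
  barCls 𝔻 A Fin.elim0 (cosimplicialPoint F)

lemma barCls_zero {T : CommComon V} {p : ℕ} (d : T ⟶ (𝔻).obj (SimplexCategory.mk p)) :
    barCls 𝔻 A (fun _ => 0) d = toUnit T ≫ barZero F A := by
  let θ : SimplexCategory.mk p ⟶ SimplexCategory.mk 0 :=
    SimplexCategory.Hom.mk ⟨fun _ => 0, fun _ _ _ => le_rfl⟩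
  have h := barCls_segSum 𝔻 A θ (fun i : Fin 0 => i.elim0) d
  rw [eq_cosimplicialPoint F (d ≫ (𝔻).map θ)] at h
  rw [barZero, comp_barCls]
  refine Eq.trans ?_ (h.trans ?_)
  · congr 1
  · congr 1
    funext i
    exact i.elim0

variable [MonoidalClosed V] [F.IsLeftAdjoint]

lemma exists_barAdd : ∃ h : (bar 𝔻).obj A ⊗ (bar 𝔻).obj A ⟶ (bar 𝔻).obj A,
    ∀ ⦃Q : CommComon V⦄ ⦃p : ℕ⦄ (x y : Fin p → (Q ⟶ A.X))
      (d : Q ⟶ (𝔻).obj (SimplexCategory.mk p)),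
      lift (barCls 𝔻 A x d) (barCls 𝔻 A y d) ≫ h = barCls 𝔻 A (fun i => x i + y i) d :=
  exists_bar_pair_desc (fun Q p x y d => barCls 𝔻 A (fun i => x i + y i) d)
    (fun Q Q' t p x y d => by simp only [comp_barCls, AddMonObj.comp_add])
    (fun Q p q θ x y d => by
      rw [← barCls_segSum]
      congr 1
      funext j
      exact (segSum_add _ _ _ _).symm)

/-- The addition of the bar construction. -/
noncomputable def barAdd : (bar 𝔻).obj A ⊗ (bar 𝔻).obj A ⟶ (bar 𝔻).obj A :=
  (exists_barAdd F A).choose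

lemma lift_barCls_add {T : CommComon V} {p : ℕ} (x y : Fin p → (T ⟶ A.X))
    (d : T ⟶ (𝔻).obj (SimplexCategory.mk p)) :
    lift (barCls 𝔻 A x d) (barCls 𝔻 A y d) ≫ barAdd F A = barCls 𝔻 A (fun i => x i + y i) d :=
  (exists_barAdd F A).choose_spec x y d

/-- The negation of an abelian group object, as a morphism of abelian group objects. -/
def negHom : A ⟶ A := AbObj.Hom.mk (A := A) (B := A) (AddGrpObj.neg (X := A.X))

lemma lift_zero_barCls_add {T : CommComon V} {p : ℕ} (x : Fin p → (T ⟶ A.X))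
    (d : T ⟶ (𝔻).obj (SimplexCategory.mk p)) (c : T ⟶ 𝟙_ (CommComon V)) :
    lift (c ≫ barZero F A) (barCls 𝔻 A x d) ≫ barAdd F A = barCls 𝔻 A x d := by
  rw [toUnit_unique c (toUnit T), ← barCls_zero F A d, lift_barCls_add]
  congr 1
  funext i
  exact zero_add (x i)

lemma lift_barCls_zero_add {T : CommComon V} {p : ℕ} (x : Fin p → (T ⟶ A.X))
    (d : T ⟶ (𝔻).obj (SimplexCategory.mk p)) (c : T ⟶ 𝟙_ (CommComon V)) :
    lift (barCls 𝔻 A x d) (c ≫ barZero F A) ≫ barAdd F A = barCls 𝔻 A x d := by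
  rw [toUnit_unique c (toUnit T), ← barCls_zero F A d, lift_barCls_add]
  congr 1
  funext i
  exact add_zero (x i)

/-- The bar construction of an abelian group object is a group object. The axioms hold on
classes, where they are the axioms of the simplicial abelian group object `B_• A`. -/
noncomputable abbrev barAddGrpObj : AddGrpObj ((bar 𝔻).obj A) where
  zero := barZero F A
  add := barAdd F A
  zero_add := bar_hom_ext_right fun Q p c x d => by
    rw [lift_whiskerRight_assoc, lift_zero_barCls_add, lift_leftUnitor_hom]
  add_zero := bar_hom_ext_left fun Q p x d c => by
    rw [lift_whiskerLeft_assoc, lift_barCls_zero_add, lift_rightUnitor_hom]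
  add_assoc := bar_triple_hom_ext fun Q p x y z d => by
    rw [lift_whiskerRight_assoc, lift_barCls_add, lift_barCls_add,
      lift_lift_associator_hom_assoc, lift_whiskerLeft_assoc, lift_barCls_add, lift_barCls_add]
    congr 1
    funext i
    exact add_assoc (x i) (y i) (z i)
  neg := (bar 𝔻).map (negHom A)
  left_neg := bar_hom_ext fun Q p x d => by
    rw [comp_lift_assoc, barCls_comp_map, Category.comp_id, lift_barCls_add, comp_toUnit_assoc,
      ← barCls_zero]
    congr 1
    funext i
    exact neg_add_cancel (x i)
  right_neg := bar_hom_ext fun Q p x d => by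
    rw [comp_lift_assoc, barCls_comp_map, Category.comp_id, lift_barCls_add, comp_toUnit_assoc,
      ← barCls_zero]
    congr 1
    funext i
    exact add_neg_cancel (x i)

/-- The group structures of the bar constructions. -/
noncomputable def barGroup : BarGroup 𝔻 where
  grp A := barAddGrpObj F A
  comm A := by
    let _ := barAddGrpObj F A
    exact ⟨bar_pair_hom_ext fun Q p x y d => by
      change _ ≫ (β_ _ _).hom ≫ barAdd F A = _ ≫ barAdd F A
      rw [lift_braiding_hom_assoc, lift_barCls_add, lift_barCls_add]
      congr 1
      funext i
      exact add_comm (y i) (x i)⟩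
  add_barCls A T p x y d := lift_barCls_add F A x y d
  isAddMonHom_map {A A'} f := by
    let _ := barAddGrpObj F A
    let _ := barAddGrpObj F A'
    exact isAddMonHom_of_add _ (bar_pair_hom_ext fun Q p x y d => by
      change _ ≫ barAdd F A ≫ _ = _ ≫ _ ≫ barAdd F A'
      rw [← Category.assoc, lift_barCls_add, lift_map_assoc, barCls_comp_map, barCls_comp_map,
        barCls_comp_map, lift_barCls_add]
      congr 1
      funext i
      exact AddMonObj.add_comp (x i) (y i) f.hom)

variable {F} in
/-- The addition is determined by its values on classes with a common second component; zero and
negation are determined by the addition. -/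
lemma barGroup_unique (b b' : BarGroup 𝔻) : b = b' := by
  have h : b.grp = b'.grp := funext fun A => AddGrpObj.ext _ _ (AddMonObj.ext _ _
    (bar_pair_hom_ext fun Q p x y d => (b.add_barCls A x y d).trans (b'.add_barCls A x y d).symm))
  cases b
  cases b'
  cases h
  rfl

end BarGroup
/-! ### Pairings and the bar construction -/

section Pairing

variable {C : Type u} [Category.{v} C] [CartesianMonoidalCategory C] [BraidedCategory C]

/-- A biadditive morphism of abelian group objects. -/
structure Pairing (A B E : AbObj C) where
  /-- The underlying morphism. -/
  hom : A.X ⊗ B.X ⟶ E.X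
  mul_add : ∀ {T : C} (x : T ⟶ A.X) (y z : T ⟶ B.X),
    lift x (y + z) ≫ hom = lift x y ≫ hom + lift x z ≫ hom
  add_mul : ∀ {T : C} (x y : T ⟶ A.X) (z : T ⟶ B.X),
    lift (x + y) z ≫ hom = lift x z ≫ hom + lift y z ≫ hom

namespace Pairing

variable {A B E : AbObj C}

lemma mul_add_of_universal (g : A.X ⊗ B.X ⟶ E.X)
    (h : lift (fst A.X (B.X ⊗ B.X)) (snd _ _ ≫ fst _ _ + snd _ _ ≫ snd _ _) ≫ g =
      lift (fst _ _) (snd _ _ ≫ fst _ _) ≫ g + lift (fst _ _) (snd _ _ ≫ snd _ _) ≫ g)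
    {T : C} (x : T ⟶ A.X) (y z : T ⟶ B.X) :
    lift x (y + z) ≫ g = lift x y ≫ g + lift x z ≫ g := by
  simpa [AddMonObj.comp_add, comp_lift_assoc] using congrArg (fun t => lift x (lift y z) ≫ t) h

lemma add_mul_of_universal (g : A.X ⊗ B.X ⟶ E.X)
    (h : lift (fst (A.X ⊗ A.X) B.X ≫ fst _ _ + fst _ _ ≫ snd _ _) (snd _ _) ≫ g =
      lift (fst _ _ ≫ fst _ _) (snd _ _) ≫ g + lift (fst _ _ ≫ snd _ _) (snd _ _) ≫ g)
    {T : C} (x y : T ⟶ A.X) (z : T ⟶ B.X) :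
    lift (x + y) z ≫ g = lift x z ≫ g + lift y z ≫ g := by
  simpa [AddMonObj.comp_add, comp_lift_assoc] using congrArg (fun t => lift (lift x y) z ≫ t) h

variable (f : Pairing A B E) {T : C}

/-- The pairing with the two variables exchanged. -/
def swap : Pairing B A E where
  hom := lift (snd _ _) (fst _ _) ≫ f.hom
  mul_add x y z := by
    simpa [comp_lift_assoc] using f.add_mul y z x
  add_mul x y z := by
    simpa [comp_lift_assoc] using f.mul_add z x y

lemma lift_swap_hom (x : T ⟶ B.X) (y : T ⟶ A.X) : lift x y ≫ f.swap.hom = lift y x ≫ f.hom := by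
  rw [swap, comp_lift_assoc, lift_fst, lift_snd]

lemma lift_segSum_left {m n : ℕ} (θ : Fin (m + 1) →o Fin (n + 1)) (x : Fin n → (T ⟶ A.X))
    (y : T ⟶ B.X) (j : Fin m) :
    lift (segSum θ x j) y ≫ f.hom = segSum θ (fun i => lift (x i) y ≫ f.hom) j := by
  let φ : (T ⟶ A.X) →+ (T ⟶ E.X) :=
    AddMonoidHom.mk' (fun x => lift x y ≫ f.hom) fun x x' => f.add_mul x x' y
  exact map_sum φ _ _

end Pairing

end Pairing

namespace BarGroup

section Elements

variable {V : Type u} [Category.{v} V] [MonoidalCategory V] [SymmetricCategory V]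
  [HasColimits V] {D : SimplexCategory ⥤ CommComon V} (b : BarGroup D)

/-- The class `[x_1 | … | x_p ; d]` as a generalized element of the abelian group object `B A`. -/
noncomputable def elt (A : AbObj (CommComon V)) {T : CommComon V} {p : ℕ}
    (x : Fin p → (T ⟶ A.X)) (d : T ⟶ D.obj (SimplexCategory.mk p)) : T ⟶ (b.obj A).X :=
  barCls D A x d

variable {A A' : AbObj (CommComon V)} {T : CommComon V} {p : ℕ}

lemma comp_elt {T' : CommComon V} (f : T' ⟶ T) (x : Fin p → (T ⟶ A.X))
    (d : T ⟶ D.obj (SimplexCategory.mk p)) :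
    f ≫ b.elt A x d = b.elt A (fun i => f ≫ x i) (f ≫ d) :=
  comp_barCls D A f x d

lemma elt_comp_map (f : A ⟶ A') (x : Fin p → (T ⟶ A.X)) (d : T ⟶ D.obj (SimplexCategory.mk p)) :
    b.elt A x d ≫ (b.functor.map f).hom = b.elt A' (fun i => x i ≫ f.hom) d :=
  barCls_comp_map D f x d

lemma elt_segSum {p q : SimplexCategory} (θ : p ⟶ q) (x : Fin q.len → (T ⟶ A.X))
    (d : T ⟶ D.obj p) :
    b.elt A (p := p.len) (segSum θ.toOrderHom x) d = b.elt A (p := q.len) x (d ≫ D.map θ) :=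
  barCls_segSum D A θ x d

lemma elt_add_elt (x y : Fin p → (T ⟶ A.X)) (d : T ⟶ D.obj (SimplexCategory.mk p)) :
    b.elt A x d + b.elt A y d = b.elt A (fun i => x i + y i) d :=
  b.add_barCls A x y d

variable [MonoidalClosed V]

lemma obj_hom_ext {f g : (b.obj A).X ⟶ T}
    (h : ∀ ⦃Q : CommComon V⦄ ⦃p : ℕ⦄ (x : Fin p → (Q ⟶ A.X))
      (d : Q ⟶ D.obj (SimplexCategory.mk p)), b.elt A x d ≫ f = b.elt A x d ≫ g) : f = g :=
  bar_hom_ext h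

lemma obj_hom_ext_left {C : CommComon V} {f g : (b.obj A).X ⊗ C ⟶ T}
    (h : ∀ ⦃Q : CommComon V⦄ ⦃p : ℕ⦄ (x : Fin p → (Q ⟶ A.X))
      (d : Q ⟶ D.obj (SimplexCategory.mk p)) (c : Q ⟶ C),
      lift (b.elt A x d) c ≫ f = lift (b.elt A x d) c ≫ g) : f = g :=
  bar_hom_ext_left h

lemma obj_hom_ext_right {C : CommComon V} {f g : C ⊗ (b.obj A).X ⟶ T}
    (h : ∀ ⦃Q : CommComon V⦄ ⦃p : ℕ⦄ (c : Q ⟶ C) (x : Fin p → (Q ⟶ A.X))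
      (d : Q ⟶ D.obj (SimplexCategory.mk p)),
      lift c (b.elt A x d) ≫ f = lift c (b.elt A x d) ≫ g) : f = g :=
  bar_hom_ext_right h

/-- An operation on generalized elements that is additive in the first variable induces a morphism
on the bar construction. -/
lemma exists_obj_desc_left {E : AbObj (CommComon V)} {C : CommComon V}
    (f : ∀ ⦃Q : CommComon V⦄, (Q ⟶ A.X) → (Q ⟶ C) → (Q ⟶ E.X))
    (hf : ∀ ⦃Q Q' : CommComon V⦄ (t : Q' ⟶ Q) (x : Q ⟶ A.X) (c : Q ⟶ C),
      t ≫ f x c = f (t ≫ x) (t ≫ c))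
    (hθ : ∀ ⦃Q : CommComon V⦄ ⦃m n : ℕ⦄ (θ : Fin (m + 1) →o Fin (n + 1)) (x : Fin n → (Q ⟶ A.X))
      (c : Q ⟶ C) (j : Fin m), f (segSum θ x j) c = segSum θ (fun i => f (x i) c) j) :
    ∃ g : (b.obj A).X ⊗ C ⟶ (b.obj E).X, ∀ ⦃Q : CommComon V⦄ ⦃p : ℕ⦄ (x : Fin p → (Q ⟶ A.X))
      (d : Q ⟶ D.obj (SimplexCategory.mk p)) (c : Q ⟶ C),
      lift (b.elt A x d) c ≫ g = b.elt E (fun i => f (x i) c) d :=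
  exists_bar_desc_left (fun Q p x d c => b.elt E (fun i => f (x i) c) d)
    (fun Q Q' t p x d y => by simp only [comp_elt, hf])
    (fun Q p q θ x d y => by
      rw [← elt_segSum]
      congr 1
      funext j
      exact hθ _ _ _ _)

end Elements

section Pairing

variable {V : Type u} [Category.{v} V] [MonoidalCategory V] [SymmetricCategory V]
  [HasColimits V] [MonoidalClosed V] {F : SSet.{v} ⥤ V} [F.Braided] [F.IsLeftAdjoint]

local notation "𝔻" => cosimplicial F

variable (b : BarGroup (cosimplicial F)) {A B E : AbObj (CommComon V)}

lemma obj_pair_hom_ext {T : CommComon V} {f g : (b.obj A).X ⊗ (b.obj A).X ⟶ T}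
    (h : ∀ ⦃Q : CommComon V⦄ ⦃p : ℕ⦄ (x y : Fin p → (Q ⟶ A.X))
      (d : Q ⟶ (𝔻).obj (SimplexCategory.mk p)),
      lift (b.elt A x d) (b.elt A y d) ≫ f = lift (b.elt A x d) (b.elt A y d) ≫ g) : f = g :=
  bar_pair_hom_ext h

lemma obj_pair_hom_ext_left {C T : CommComon V} {f g : ((b.obj A).X ⊗ (b.obj A).X) ⊗ C ⟶ T}
    (h : ∀ ⦃Q : CommComon V⦄ ⦃p : ℕ⦄ (x y : Fin p → (Q ⟶ A.X))
      (d : Q ⟶ (𝔻).obj (SimplexCategory.mk p)) (c : Q ⟶ C),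
      lift (lift (b.elt A x d) (b.elt A y d)) c ≫ f =
        lift (lift (b.elt A x d) (b.elt A y d)) c ≫ g) : f = g :=
  bar_pair_hom_ext_left h

/-- A pairing `A × B → E` extends to the bar construction of the first variable:
`[x_1 | … | x_p ; d] * y = [x_1 * y | … | x_p * y ; d]`. -/
lemma exists_pairing_left (f : Pairing A B E) : ∃ g : Pairing (b.obj A) B (b.obj E),
    ∀ ⦃Q : CommComon V⦄ ⦃p : ℕ⦄ (x : Fin p → (Q ⟶ A.X)) (d : Q ⟶ (𝔻).obj (SimplexCategory.mk p))
      (y : Q ⟶ B.X),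
      lift (b.elt A x d) y ≫ g.hom = b.elt E (fun i => lift (x i) y ≫ f.hom) d := by
  obtain ⟨g, hg⟩ := b.exists_obj_desc_left (fun Q (x : Q ⟶ A.X) (y : Q ⟶ B.X) => lift x y ≫ f.hom)
    (fun Q Q' t x y => by rw [comp_lift_assoc]) (fun Q m n θ x y j => f.lift_segSum_left θ x y j)
  refine ⟨{ hom := g, mul_add := Pairing.mul_add_of_universal g ?_,
            add_mul := Pairing.add_mul_of_universal g ?_ }, hg⟩
  · refine b.obj_hom_ext_left fun Q p x d c => ?_
    simp only [AddMonObj.comp_add, comp_lift_assoc, lift_fst, lift_snd_assoc]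
    rw [hg, hg, hg, elt_add_elt]
    congr 1
    funext i
    exact f.mul_add _ _ _
  · refine b.obj_pair_hom_ext_left fun Q p x y d c => ?_
    simp only [AddMonObj.comp_add, comp_lift_assoc, lift_fst_assoc, lift_snd, lift_fst]
    rw [elt_add_elt, hg, hg, hg, elt_add_elt]
    congr 1
    funext i
    exact f.add_mul _ _ _

/-- A pairing `A × B → E` extends to the bar construction of the second variable:
`s * [x_1 | … | x_p ; d] = [s * x_1 | … | s * x_p ; d]`. -/
lemma exists_pairing_right (f : Pairing A B E) : ∃ g : Pairing A (b.obj B) (b.obj E),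
    ∀ ⦃Q : CommComon V⦄ ⦃p : ℕ⦄ (s : Q ⟶ A.X) (x : Fin p → (Q ⟶ B.X))
      (d : Q ⟶ (𝔻).obj (SimplexCategory.mk p)),
      lift s (b.elt B x d) ≫ g.hom = b.elt E (fun i => lift s (x i) ≫ f.hom) d := by
  obtain ⟨g, hg⟩ := b.exists_pairing_left f.swap
  refine ⟨g.swap, fun Q p s x d => ?_⟩
  rw [Pairing.lift_swap_hom, hg]
  simp only [Pairing.lift_swap_hom]

end Pairing

end BarGroup
/-! ### The graded ring structure of the iterated bar construction -/

namespace BarGroup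

variable {V : Type u} [Category.{v} V] [MonoidalCategory V] [SymmetricCategory V]
  [HasColimits V]

section Cls

variable {D : SimplexCategory ⥤ CommComon V} (b : BarGroup D)
  (S : RingObjCat (CommComon V)) {T : CommComon V} {p : ℕ}

variable {S} in
lemma cls_comp_map {S' : RingObjCat (CommComon V)} (f : S ⟶ S') (n : ℕ)
    (x : Fin p → (T ⟶ (b.deg S n).X)) (d : T ⟶ D.obj (SimplexCategory.mk p)) :
    b.cls S n x d ≫ ((b.iter (n + 1)).map ((ringToAb _).map f)).hom =
      b.cls S' n (fun i => x i ≫ ((b.iter n).map ((ringToAb _).map f)).hom) d :=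
  b.elt_comp_map _ x d

variable [MonoidalClosed V] {S} {n : ℕ}

lemma deg_hom_ext {f g : (b.deg S (n + 1)).X ⟶ T}
    (h : ∀ ⦃Q : CommComon V⦄ ⦃p : ℕ⦄ (x : Fin p → (Q ⟶ (b.deg S n).X))
      (d : Q ⟶ D.obj (SimplexCategory.mk p)), b.cls S n x d ≫ f = b.cls S n x d ≫ g) : f = g :=
  b.obj_hom_ext h

lemma deg_hom_ext_left {C : CommComon V} {f g : (b.deg S (n + 1)).X ⊗ C ⟶ T}
    (h : ∀ ⦃Q : CommComon V⦄ ⦃p : ℕ⦄ (x : Fin p → (Q ⟶ (b.deg S n).X))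
      (d : Q ⟶ D.obj (SimplexCategory.mk p)) (c : Q ⟶ C),
      lift (b.cls S n x d) c ≫ f = lift (b.cls S n x d) c ≫ g) : f = g :=
  b.obj_hom_ext_left h

lemma deg_hom_ext_right {C : CommComon V} {f g : C ⊗ (b.deg S (n + 1)).X ⟶ T}
    (h : ∀ ⦃Q : CommComon V⦄ ⦃p : ℕ⦄ (c : Q ⟶ C) (x : Fin p → (Q ⟶ (b.deg S n).X))
      (d : Q ⟶ D.obj (SimplexCategory.mk p)),
      lift c (b.cls S n x d) ≫ f = lift c (b.cls S n x d) ≫ g) : f = g :=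
  b.obj_hom_ext_right h

end Cls

section Ring

variable [MonoidalClosed V] {F : SSet.{v} ⥤ V} [F.Braided] [F.IsLeftAdjoint]

local notation "𝔻" => cosimplicial F

variable (b : BarGroup (cosimplicial F)) (S : RingObjCat (CommComon V))

/-- The multiplication of a ring object, as a pairing. -/
def ringPairing : Pairing ((ringToAb (CommComon V)).obj S) ((ringToAb (CommComon V)).obj S)
    ((ringToAb (CommComon V)).obj S) where
  hom := μ[S.X]
  mul_add x y z := Hom.mul_add (R := S.X) x y z
  add_mul x y z := Hom.add_mul (R := S.X) x y z

/-- The multiplications in bidegrees `(0, m)`. -/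
noncomputable def pairingZero : ∀ m, Pairing (b.deg S 0) (b.deg S m) (b.deg S m)
  | 0 => ringPairing S
  | m + 1 => (b.exists_pairing_right (pairingZero m)).choose

/-- The multiplications of the iterated bar construction. The index `k = n + m` is a separate
variable, so that the recursion on `n` needs no transport except in bidegrees `(0, m)`. -/
noncomputable def pairing : ∀ n m k, n + m = k → Pairing (b.deg S n) (b.deg S m) (b.deg S k)
  | 0, m, _, h => ((Nat.zero_add m).symm.trans h) ▸ b.pairingZero S m
  | n + 1, m, 0, h => absurd h (by omega)
  | n + 1, m, k + 1, h => (b.exists_pairing_left (pairing n m k (by omega))).choose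

/-- The product of generalized elements of the iterated bar construction. -/
noncomputable def prod {n m k : ℕ} (h : n + m = k) {T : CommComon V} (x : T ⟶ (b.deg S n).X)
    (y : T ⟶ (b.deg S m).X) : T ⟶ (b.deg S k).X :=
  lift x y ≫ (b.pairing S n m k h).hom

variable {S} {T : CommComon V} {n m k p : ℕ}

lemma comp_prod (h : n + m = k) {T' : CommComon V} (f : T' ⟶ T) (x : T ⟶ (b.deg S n).X)
    (y : T ⟶ (b.deg S m).X) : f ≫ b.prod S h x y = b.prod S h (f ≫ x) (f ≫ y) := by
  rw [prod, prod, comp_lift_assoc]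

lemma prod_zero_cls (s : T ⟶ (b.deg S 0).X) (x : Fin p → (T ⟶ (b.deg S m).X))
    (d : T ⟶ (𝔻).obj (SimplexCategory.mk p)) :
    b.prod S (Nat.zero_add (m + 1)) s (b.cls S m x d) =
      b.cls S m (fun i => b.prod S (Nat.zero_add m) s (x i)) d :=
  (b.exists_pairing_right (b.pairingZero S m)).choose_spec s x d

lemma prod_cls (h : n + m = k) (h₁ : n + 1 + m = k + 1) (x : Fin p → (T ⟶ (b.deg S n).X))
    (d : T ⟶ (𝔻).obj (SimplexCategory.mk p)) (y : T ⟶ (b.deg S m).X) :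
    b.prod S h₁ (b.cls S n x d) y = b.cls S k (fun i => b.prod S h (x i) y) d :=
  (b.exists_pairing_left (b.pairing S n m k h)).choose_spec x d y

variable (S) in
/-- The unit of the iterated bar construction. -/
noncomputable def degOne : 𝟙_ (CommComon V) ⟶ (b.deg S 0).X := η[S.X]

lemma one_prod (n : ℕ) (x : T ⟶ (b.deg S n).X) :
    b.prod S (Nat.zero_add n) (toUnit T ≫ b.degOne S) x = x := by
  induction n generalizing T with
  | zero => exact one_mul (M := T ⟶ S.X) x
  | succ n ih =>
    have key : b.prod S (Nat.zero_add (n + 1)) (toUnit _ ≫ b.degOne S)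
        (𝟙 (b.deg S (n + 1)).X) = 𝟙 _ :=
      b.deg_hom_ext fun Q p x d => by
        rw [comp_prod, comp_toUnit_assoc, Category.comp_id, prod_zero_cls]
        simp only [ih]
    simpa [comp_prod] using congrArg (fun t => x ≫ t) key

lemma prod_one (n : ℕ) (x : T ⟶ (b.deg S n).X) :
    b.prod S (Nat.add_zero n) x (toUnit T ≫ b.degOne S) = x := by
  induction n generalizing T with
  | zero => exact mul_one (M := T ⟶ S.X) x
  | succ n ih =>
    have key : b.prod S (Nat.add_zero (n + 1)) (𝟙 (b.deg S (n + 1)).X)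
        (toUnit _ ≫ b.degOne S) = 𝟙 _ :=
      b.deg_hom_ext fun Q p x d => by
        rw [comp_prod, comp_toUnit_assoc, Category.comp_id, b.prod_cls (Nat.add_zero n)]
        simp only [ih]
    simpa [comp_prod] using congrArg (fun t => x ≫ t) key

/-- Associativity in degrees `(0, 0, c)`. The lemmas `prod_assoc_zero` and `prod_assoc` extend it
one variable at a time, as the products are defined by recursion on the degree of the first
variable and, if this degree is `0`, of the second one. -/
lemma prod_assoc_zero_zero (c : ℕ) (x y : T ⟶ (b.deg S 0).X) (z : T ⟶ (b.deg S c).X) :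
    b.prod S (Nat.zero_add c) (b.prod S (Nat.zero_add 0) x y) z =
      b.prod S (Nat.zero_add c) x (b.prod S (Nat.zero_add c) y z) := by
  induction c generalizing T with
  | zero => exact mul_assoc (G := T ⟶ S.X) x y z
  | succ c ih =>
    have key : b.prod S (Nat.zero_add (c + 1)) (b.prod S (Nat.zero_add 0)
          (fst _ _ ≫ fst (b.deg S 0).X (b.deg S 0).X) (fst _ _ ≫ snd _ _))
          (snd _ (b.deg S (c + 1)).X) =
        b.prod S (Nat.zero_add (c + 1)) (fst _ _ ≫ fst _ _)
          (b.prod S (Nat.zero_add (c + 1)) (fst _ _ ≫ snd _ _) (snd _ _)) :=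
      b.deg_hom_ext_right fun Q p t z d => by
        simp only [comp_prod, lift_fst_assoc, lift_snd, prod_zero_cls, ih]
    simpa [comp_prod] using congrArg (fun t => lift (lift x y) z ≫ t) key

lemma prod_assoc_zero (c m k : ℕ) (h : m + c = k) (x : T ⟶ (b.deg S 0).X)
    (y : T ⟶ (b.deg S m).X) (z : T ⟶ (b.deg S c).X) :
    b.prod S h (b.prod S (Nat.zero_add m) x y) z =
      b.prod S (Nat.zero_add k) x (b.prod S h y z) := by
  induction m generalizing k T with
  | zero =>
    obtain rfl : c = k := by omega
    exact b.prod_assoc_zero_zero c x y z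
  | succ m ih =>
    obtain ⟨k, rfl⟩ : ∃ l, k = l + 1 := ⟨m + c, by omega⟩
    have h' : m + c = k := by omega
    have key : b.prod S h (b.prod S (Nat.zero_add (m + 1)) (snd _ _ ≫ fst (b.deg S 0).X _)
          (fst (b.deg S (m + 1)).X _)) (snd _ _ ≫ snd _ (b.deg S c).X) =
        b.prod S (Nat.zero_add (k + 1)) (snd _ _ ≫ fst _ _)
          (b.prod S h (fst _ _) (snd _ _ ≫ snd _ _)) :=
      b.deg_hom_ext_left fun Q p y d t => by
        simp only [comp_prod, lift_snd_assoc, lift_fst, prod_zero_cls, b.prod_cls h', ih]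
    simpa [comp_prod] using congrArg (fun t => lift y (lift x z) ≫ t) key

lemma prod_assoc {l ab bc : ℕ} (h₁ : n + m = ab) (h₂ : ab + l = k) (h₃ : m + l = bc)
    (h₄ : n + bc = k) (x : T ⟶ (b.deg S n).X) (y : T ⟶ (b.deg S m).X) (z : T ⟶ (b.deg S l).X) :
    b.prod S h₂ (b.prod S h₁ x y) z = b.prod S h₄ x (b.prod S h₃ y z) := by
  induction n generalizing ab k T with
  | zero =>
    obtain rfl : m = ab := by omega
    obtain rfl : bc = k := by omega
    exact b.prod_assoc_zero l m bc h₂ x y z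
  | succ n ih =>
    obtain ⟨ab, rfl⟩ : ∃ l, ab = l + 1 := ⟨n + m, by omega⟩
    obtain ⟨k, rfl⟩ : ∃ l, k = l + 1 := ⟨n + bc, by omega⟩
    have h₁' : n + m = ab := by omega
    have h₂' : ab + l = k := by omega
    have h₄' : n + bc = k := by omega
    have key : b.prod S h₂ (b.prod S h₁ (fst (b.deg S (n + 1)).X _)
          (snd _ _ ≫ fst (b.deg S m).X _)) (snd _ _ ≫ snd _ (b.deg S l).X) =
        b.prod S h₄ (fst _ _) (b.prod S h₃ (snd _ _ ≫ fst _ _) (snd _ _ ≫ snd _ _)) :=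
      b.deg_hom_ext_left fun Q p y d t => by
        simp only [comp_prod, lift_snd_assoc, lift_fst, b.prod_cls h₁', b.prod_cls h₂',
          b.prod_cls h₄', ih h₁' h₂' h₄']
    simpa [comp_prod] using congrArg (fun t => lift x (lift y z) ≫ t) key

/-- The graded ring structure on the iterated bar construction. -/
noncomputable def grRingStr (S : RingObjCat (CommComon V)) : GrRingStr (b.deg S) where
  one := b.degOne S
  mul h := (b.pairing S _ _ _ h).hom
  one_mul x := b.one_prod _ x
  mul_one x := b.prod_one _ x
  mul_assoc h₁ h₂ h₃ h₄ x y z := b.prod_assoc h₁ h₂ h₃ h₄ x y z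
  mul_add h x y z := (b.pairing S _ _ _ h).mul_add x y z
  add_mul h x y z := (b.pairing S _ _ _ h).add_mul x y z

section Natural

variable {S' : RingObjCat (CommComon V)} (f : S ⟶ S')

/-- The morphism on iterated bar constructions induced by a morphism of ring objects. -/
noncomputable abbrev degMap (n : ℕ) : (b.deg S n).X ⟶ (b.deg S' n).X :=
  ((b.iter n).map ((ringToAb _).map f)).hom

lemma prod_zero_comp_degMap (m : ℕ) (x : T ⟶ (b.deg S 0).X) (y : T ⟶ (b.deg S m).X) :
    b.prod S (Nat.zero_add m) x y ≫ b.degMap f m =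
      b.prod S' (Nat.zero_add m) (x ≫ b.degMap f 0) (y ≫ b.degMap f m) := by
  induction m generalizing T with
  | zero => exact MonObj.mul_comp (M := S.X) (N := S'.X) x y f.hom
  | succ m ih =>
    have key : b.prod S (Nat.zero_add (m + 1)) (fst _ _) (snd _ _) ≫ b.degMap f (m + 1) =
        b.prod S' (Nat.zero_add (m + 1)) (fst _ _ ≫ b.degMap f 0) (snd _ _ ≫ b.degMap f (m + 1)) :=
      b.deg_hom_ext_right fun Q p s x d => by
        rw [← Category.assoc]
        simp only [comp_prod, lift_fst, lift_snd, lift_fst_assoc, lift_snd_assoc, prod_zero_cls,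
          cls_comp_map, ih]
    simpa [comp_prod, ← Category.assoc] using congrArg (fun t => lift x y ≫ t) key

lemma prod_comp_degMap (h : n + m = k) (x : T ⟶ (b.deg S n).X) (y : T ⟶ (b.deg S m).X) :
    b.prod S h x y ≫ b.degMap f k = b.prod S' h (x ≫ b.degMap f n) (y ≫ b.degMap f m) := by
  induction n generalizing k T with
  | zero =>
    obtain rfl : m = k := by omega
    exact b.prod_zero_comp_degMap f m x y
  | succ n ih =>
    obtain ⟨k, rfl⟩ : ∃ l, k = l + 1 := ⟨n + m, by omega⟩
    have h' : n + m = k := by omega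
    have key : b.prod S h (fst _ _) (snd _ _) ≫ b.degMap f (k + 1) =
        b.prod S' h (fst _ _ ≫ b.degMap f (n + 1)) (snd _ _ ≫ b.degMap f m) :=
      b.deg_hom_ext_left fun Q p x d y => by
        rw [← Category.assoc]
        simp only [comp_prod, lift_fst, lift_snd, lift_fst_assoc, lift_snd_assoc, b.prod_cls h',
          cls_comp_map, ih h']
    simpa [comp_prod, ← Category.assoc] using congrArg (fun t => lift x y ≫ t) key

end Natural

/-- The iterated bar construction with its graded ring structure. -/
noncomputable def iteratedBar : IteratedBar (cosimplicial F) where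
  toBarGroup := b
  ring := b.grRingStr
  one_eq _ := rfl
  mul_zero_zero _ := rfl
  mul_zero_succ S m T p s x d := b.prod_zero_cls s x d
  mul_succ S n m k h h₁ T p x d y := b.prod_cls h h₁ x d y
  mul_natural {S S'} f {n m k} h := by
    have := b.prod_comp_degMap f h (fst _ _) (snd _ _)
    rw [prod, prod, lift_fst_snd, Category.id_comp] at this
    refine this.trans (congrArg (fun t => t ≫ _) ?_)
    exact CartesianMonoidalCategory.hom_ext _ _ (by simp) (by simp)

end Ring

end BarGroup

section Unique

variable {V : Type u} [Category.{v} V] [MonoidalCategory V] [SymmetricCategory V]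
  [HasColimits V] [MonoidalClosed V] {F : SSet.{v} ⥤ V} [F.Braided] [F.IsLeftAdjoint]

namespace IteratedBar

variable (c : IteratedBar (cosimplicial F)) (S : RingObjCat (CommComon V))

lemma ring_mul_zero (m : ℕ) : (c.ring S).mul (Nat.zero_add m) = (c.pairingZero S m).hom := by
  induction m with
  | zero => exact c.mul_zero_zero S
  | succ m ih =>
    refine c.deg_hom_ext_right fun Q p s x d => (c.mul_zero_succ S m s x d).trans ?_
    rw [ih]
    exact (c.prod_zero_cls s x d).symm

/-- The recursive formulas determine the multiplications. -/
lemma ring_mul {n m k : ℕ} (h : n + m = k) : (c.ring S).mul h = (c.pairing S n m k h).hom := by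
  induction n generalizing k with
  | zero =>
    obtain rfl : m = k := by omega
    exact c.ring_mul_zero S m
  | succ n ih =>
    obtain ⟨k, rfl⟩ : ∃ l, k = l + 1 := ⟨n + m, by omega⟩
    have h' : n + m = k := by omega
    refine c.deg_hom_ext_left fun Q p x d y => (c.mul_succ S h' h x d y).trans ?_
    rw [ih h']
    exact (c.prod_cls h' h x d y).symm

lemma ring_eq : c.ring S = c.grRingStr S := by
  have h₁ : (c.ring S).one = (c.grRingStr S).one := c.one_eq S
  have h₂ : @GrRingStr.mul _ _ _ _ _ (c.ring S) = @GrRingStr.mul _ _ _ _ _ (c.grRingStr S) := by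
    funext n m k h
    exact c.ring_mul S h
  generalize c.ring S = r at h₁ h₂
  generalize c.grRingStr S = r' at h₁ h₂
  cases r
  cases r'
  cases h₁
  cases h₂
  rfl

lemma eq_iteratedBar : c = c.toBarGroup.iteratedBar := by
  have h : c.ring = c.grRingStr := funext c.ring_eq
  obtain ⟨b, ring, _, _, _, _, _⟩ := c
  change ring = b.grRingStr at h
  subst h
  rfl

/-- The iterated bar construction exists and is unique. -/
noncomputable instance : Unique (IteratedBar (cosimplicial F)) where
  default := (barGroup F).iteratedBar
  uniq c := by rw [c.eq_iteratedBar, barGroup_unique c.toBarGroup (barGroup F)]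

end IteratedBar

end Unique

/-! ### Change of the base category -/

section Compose

variable {U : Type*} [Category.{v'} U] [MonoidalCategory U] [SymmetricCategory U]
  {V : Type u} [Category.{v} V] [MonoidalCategory V] [SymmetricCategory V]
  {W : Type u'} [Category.{v} W] [MonoidalCategory W] [SymmetricCategory W]
  (F : U ⥤ V) [F.Braided] (G : V ⥤ W) [G.Braided]

/-- The functors induced on cocommutative comonoids are compatible with composition. -/
def mapCoComonComp (A : CommComon U) :
    (mapCoComon G).obj ((mapCoComon F).obj A) ≅ (mapCoComon (F ⋙ G)).obj A :=
  isoMk (A := (mapCoComon G).obj ((mapCoComon F).obj A)) (B := (mapCoComon (F ⋙ G)).obj A)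
    (Iso.refl (G.obj (F.obj A.X)))
    { hom_counit := by
        change 𝟙 (G.obj (F.obj A.X)) ≫ G.map (F.map ε[A.X]) ≫ Functor.OplaxMonoidal.η (F ⋙ G) =
          G.map (F.map ε[A.X] ≫ Functor.OplaxMonoidal.η F) ≫ Functor.OplaxMonoidal.η G
        simp
      hom_comul := by
        change 𝟙 (G.obj (F.obj A.X)) ≫ G.map (F.map Δ[A.X]) ≫
            Functor.OplaxMonoidal.δ (F ⋙ G) A.X A.X =
          (G.map (F.map Δ[A.X] ≫ Functor.OplaxMonoidal.δ F A.X A.X) ≫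
            Functor.OplaxMonoidal.δ G _ _) ≫ (𝟙 (G.obj (F.obj A.X)) ⊗ₘ 𝟙 (G.obj (F.obj A.X)))
        simp }

lemma mapCoComonComp_naturality {A B : CommComon U} (f : A ⟶ B) :
    (mapCoComon G).map ((mapCoComon F).map f) ≫ (mapCoComonComp F G B).hom =
      (mapCoComonComp F G A).hom ≫ (mapCoComon (F ⋙ G)).map f :=
  homOf_injective ((Category.comp_id (G.map (F.map (homOf f)))).trans
    (Category.id_comp (G.map (F.map (homOf f)))).symm)

end Compose

section Common

variable {C : Type u} [Category.{v} C] [CartesianMonoidalCategory C]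
  {D : Type u'} [Category.{v'} D] [CartesianMonoidalCategory D]
  (Φ : C ⥤ D) [Φ.Monoidal]

lemma exists_common_pow {A : C} {T : D} {n : ℕ} (x : Fin n → (T ⟶ Φ.obj A)) :
    ∃ u : T ⟶ Φ.obj (pow A n), ∀ i, x i = u ≫ Φ.map (powProj A n i) := by
  induction n with
  | zero => exact ⟨toUnit T ≫ Functor.LaxMonoidal.ε Φ, fun i => i.elim0⟩
  | succ n ih =>
    obtain ⟨v, hv⟩ := ih (fun i => x i.succ)
    obtain ⟨u, h₀, h₁⟩ := exists_common₂ Φ (x 0) v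
    refine ⟨u, Fin.cases h₀ fun i => ?_⟩
    rw [hv, h₁, Category.assoc, ← Φ.map_comp]
    rfl

/-- Finitely many generalized elements of objects in the image of a cartesian functor come from
generalized elements of the source objects. -/
lemma exists_common_seq {A B : C} {T : D} {n : ℕ} (x : Fin n → (T ⟶ Φ.obj A)) (y : T ⟶ Φ.obj B) :
    ∃ (T₀ : C) (u : T ⟶ Φ.obj T₀) (x₀ : Fin n → (T₀ ⟶ A)) (y₀ : T₀ ⟶ B),
      x = (fun i => u ≫ Φ.map (x₀ i)) ∧ y = u ≫ Φ.map y₀ := by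
  obtain ⟨v, hv⟩ := exists_common_pow Φ x
  obtain ⟨u, rfl, rfl⟩ := exists_common₂ Φ v y
  exact ⟨_, u, fun i => fst _ _ ≫ powProj A n i, snd _ _, funext fun i => by simp [hv], rfl⟩

/-- A cartesian functor sends the projections of a product to a jointly monic pair. -/
lemma map_prod_hom_ext {A B : C} {T : D} {u u' : T ⟶ Φ.obj (A ⊗ B)}
    (h₁ : u ≫ Φ.map (fst A B) = u' ≫ Φ.map (fst A B))
    (h₂ : u ≫ Φ.map (snd A B) = u' ≫ Φ.map (snd A B)) : u = u' := by
  have : IsIso (Functor.OplaxMonoidal.δ Φ A B) := (Functor.Monoidal.μIso Φ A B).isIso_inv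
  rw [← cancel_mono (Functor.OplaxMonoidal.δ Φ A B)]
  exact CartesianMonoidalCategory.hom_ext _ _ (by simpa using h₁) (by simpa using h₂)

lemma map_pow_hom_ext {A : C} {T : D} {n : ℕ} {u u' : T ⟶ Φ.obj (pow A n)}
    (h : ∀ i, u ≫ Φ.map (powProj A n i) = u' ≫ Φ.map (powProj A n i)) : u = u' := by
  induction n with
  | zero =>
    have : IsIso (Functor.OplaxMonoidal.η Φ) := (Functor.Monoidal.εIso Φ).isIso_inv
    exact (cancel_mono (Functor.OplaxMonoidal.η Φ)).1 (toUnit_unique _ _)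
  | succ n ih =>
    have e (w : T ⟶ Φ.obj (A ⊗ pow A n)) (i : Fin n) :
        (w ≫ Φ.map (snd A (pow A n))) ≫ Φ.map (powProj A n i) =
          w ≫ Φ.map (snd A (pow A n) ≫ powProj A n i) := by
      rw [Φ.map_comp, Category.assoc]
    exact map_prod_hom_ext Φ (A := A) (B := pow A n) (h 0)
      (ih fun i => (e u i).trans ((h i.succ).trans (e u' i).symm))

end Common

/-! ### Comparison of the bar constructions over two base categories -/

section MapSum

variable {C : Type u} [Category.{v} C] [CartesianMonoidalCategory C] [BraidedCategory C]
  {D : Type u'} [Category.{v'} D] [CartesianMonoidalCategory D] [BraidedCategory D]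
  (Φ : C ⥤ D) [Φ.Monoidal]

lemma comp_map_segSum {A : AbObj C} {T₀ : C} {T : D} (w : T ⟶ Φ.obj T₀) {m n : ℕ}
    (θ : Fin (m + 1) →o Fin (n + 1)) (x : Fin n → (T₀ ⟶ A.X)) (j : Fin m) :
    (w ≫ Φ.map (segSum θ x j) : T ⟶ ((mapAb Φ).obj A).X) =
      segSum θ (fun i => (w ≫ Φ.map (x i) : T ⟶ ((mapAb Φ).obj A).X)) j := by
  let φ : (T₀ ⟶ A.X) →+ (T ⟶ ((mapAb Φ).obj A).X) :=
    AddMonoidHom.mk' (fun x => w ≫ Φ.map x) fun x y => (comp_map_add Φ w x y).symm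
  exact map_sum φ _ _

end MapSum

section BarInclusion

variable {V : Type u} [Category.{v} V] [MonoidalCategory V] [SymmetricCategory V]
  (D : SimplexCategory ⥤ CommComon V) (A : AbObj (CommComon V))

lemma simplicialBar_map_whiskerRight {p q : SimplexCategory} (θ : p ⟶ q) :
    ((simplicialBar (CommComon V)).obj A).map θ.op ▷ D.obj p =
      lift (powLift (segSum θ.toOrderHom fun i => fst (pow A.X q.len) _ ≫ powProj A.X q.len i))
        (snd _ (D.obj p)) := by
  refine CartesianMonoidalCategory.hom_ext _ _ ?_ ?_
  · refine (whiskerRight_fst _ _).trans (Eq.trans ?_ (lift_fst _ _).symm)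
    refine Eq.trans ?_ (powLift_comp_simplicialBar_map A θ
      fun i => fst (pow A.X q.len) (D.obj p) ≫ powProj A.X q.len i)
    exact congrArg (fun t => t ≫ ((simplicialBar (CommComon V)).obj A).map θ.op)
      (powLift_comp_proj (fst (pow A.X q.len) (D.obj p))).symm
  · exact (whiskerRight_snd _ _).trans (lift_snd _ _).symm

lemma simplicialBar_obj_whiskerLeft {p q : SimplexCategory} (θ : p ⟶ q) :
    ((simplicialBar (CommComon V)).obj A).obj (op q) ◁ D.map θ =
      lift (powLift fun i => fst (pow A.X q.len) _ ≫ powProj A.X q.len i)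
        (snd _ (D.obj p) ≫ D.map θ) := by
  refine CartesianMonoidalCategory.hom_ext _ _ ?_ ?_
  · refine (whiskerLeft_fst _ _).trans (Eq.trans ?_ (lift_fst _ _).symm)
    exact (powLift_comp_proj (fst (pow A.X q.len) (D.obj p))).symm
  · exact (whiskerLeft_snd _ _).trans (lift_snd _ _).symm

variable [HasColimits V]

/-- The structure maps `A ^ p ⊗ D p ⟶ B A` of the bar construction. -/
noncomputable def barι (p : ℕ) :
    pow A.X p ⊗ D.obj (SimplexCategory.mk p) ⟶ (bar D).obj A :=
  geomι D ((simplicialBar (CommComon V)).obj A) (SimplexCategory.mk p)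

lemma barCls_eq_barι {T : CommComon V} {p : ℕ} (x : Fin p → (T ⟶ A.X))
    (d : T ⟶ D.obj (SimplexCategory.mk p)) :
    barCls D A x d = lift (powLift x) d ≫ barι D A p := rfl

lemma barι_eq (p : ℕ) :
    barι D A p = barCls D A (fun i => fst _ _ ≫ powProj A.X p i) (snd _ _) := by
  rw [barCls_eq_barι, powLift_comp_proj, lift_fst_snd, Category.id_comp]

end BarInclusion

section CoendImage

variable {V : Type u} [Category.{v} V] [MonoidalCategory V] [SymmetricCategory V] [HasColimits V]
  {W : Type u'} [Category.{v'} W] (G : V ⥤ W) [G.IsLeftAdjoint]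
  {J : Type} [SmallCategory J] {K : Jᵒᵖ ⥤ J ⥤ CommComon V}

/-- A left adjoint sends the structure maps of a coend to a jointly epic family. -/
lemma map_coend_hom_ext {Z : W} {f g : G.obj (coend (underlying K)) ⟶ Z}
    (h : ∀ j, G.map (coendι K j) ≫ f = G.map (coendι K j) ≫ g) : f = g :=
  (Adjunction.ofIsLeftAdjoint G).homEquiv _ _ |>.injective (coend_hom_ext K fun j => by
    rw [← Adjunction.homEquiv_naturality_left, ← Adjunction.homEquiv_naturality_left, h])

lemma exists_map_coend_desc {Z : W} (f : ∀ j, G.obj ((K.obj (op j)).obj j).X ⟶ Z)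
    (hf : ∀ ⦃i j : J⦄ (g : i ⟶ j), G.map (homOf ((K.map g.op).app i)) ≫ f i =
      G.map (homOf ((K.obj (op j)).map g)) ≫ f j) :
    ∃ h : G.obj (coend (underlying K)) ⟶ Z, ∀ j, G.map (coendι K j) ≫ h = f j := by
  let adj := Adjunction.ofIsLeftAdjoint G
  refine ⟨(adj.homEquiv _ _).symm (coendDesc K (fun j => adj.homEquiv _ _ (f j)) fun i j g => ?_),
    fun j => ?_⟩
  · rw [← Adjunction.homEquiv_naturality_left, ← Adjunction.homEquiv_naturality_left, hf]
  · rw [← Adjunction.homEquiv_naturality_left_symm, coendι_desc, Equiv.symm_apply_apply]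

end CoendImage

section Comparison

variable {V : Type u} [Category.{v} V] [MonoidalCategory V] [SymmetricCategory V]
  {W : Type u'} [Category.{v} W] [MonoidalCategory W] [SymmetricCategory W]
  (F : SSet.{v} ⥤ V) [F.Braided] (G : V ⥤ W) [G.Braided]

/-- The cosimplicial comonoid of `F ⋙ G` is the image of the one of `F`. -/
noncomputable def cosimplicialComp (p : SimplexCategory) :
    (mapCoComon G).obj ((cosimplicial F).obj p) ≅ (cosimplicial (F ⋙ G)).obj p :=
  mapCoComonComp F G ((diagonalCoComon SSet.{v}).obj (SSet.stdSimplex.{v}.obj p))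

lemma cosimplicialComp_naturality {p q : SimplexCategory} (θ : p ⟶ q) :
    (mapCoComon G).map ((cosimplicial F).map θ) ≫ (cosimplicialComp F G q).hom =
      (cosimplicialComp F G p).hom ≫ (cosimplicial (F ⋙ G)).map θ :=
  mapCoComonComp_naturality F G _

/-- The components of a class over `W` in the bar construction of the image of `A` come from
generalized elements over `V`. -/
lemma exists_eq_map_comp {A : AbObj (CommComon V)} {T : CommComon W} {n : ℕ} {p : SimplexCategory}
    (x : Fin n → (T ⟶ ((mapAb (mapCoComon G)).obj A).X))
    (d : T ⟶ (cosimplicial (F ⋙ G)).obj p) :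
    ∃ (T₀ : CommComon V) (w : T ⟶ (mapCoComon G).obj T₀) (x₀ : Fin n → (T₀ ⟶ A.X))
      (d₀ : T₀ ⟶ (cosimplicial F).obj p),
      x = (fun i => w ≫ (mapCoComon G).map (x₀ i)) ∧
        d = w ≫ (mapCoComon G).map d₀ ≫ (cosimplicialComp F G p).hom := by
  obtain ⟨T₀, w, x₀, d₀, hx, hd⟩ := exists_common_seq (mapCoComon G) (A := A.X) x
    (d ≫ (cosimplicialComp F G _).inv)
  refine ⟨T₀, w, x₀, d₀, hx, ?_⟩
  rw [← Category.assoc, ← hd, Category.assoc, Iso.inv_hom_id, Category.comp_id]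

/-- The lifts of the components of a class over `W` to generalized elements over `V` are
essentially unique. -/
lemma comp_map_lift_eq {A : AbObj (CommComon V)} {T : CommComon W} {T₀ T₁ : CommComon V} {p : ℕ}
    {w : T ⟶ (mapCoComon G).obj T₀} {x : Fin p → (T₀ ⟶ A.X)}
    {d : T₀ ⟶ (cosimplicial F).obj (SimplexCategory.mk p)}
    {w₁ : T ⟶ (mapCoComon G).obj T₁} {x₁ : Fin p → (T₁ ⟶ A.X)}
    {d₁ : T₁ ⟶ (cosimplicial F).obj (SimplexCategory.mk p)}
    (hx : ∀ i, w ≫ (mapCoComon G).map (x i) = w₁ ≫ (mapCoComon G).map (x₁ i))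
    (hd : w ≫ (mapCoComon G).map d ≫ (cosimplicialComp F G _).hom =
      w₁ ≫ (mapCoComon G).map d₁ ≫ (cosimplicialComp F G _).hom) :
    w ≫ (mapCoComon G).map (lift (powLift x) d) =
      w₁ ≫ (mapCoComon G).map (lift (powLift x₁) d₁) := by
  refine map_prod_hom_ext (mapCoComon G) (map_pow_hom_ext (mapCoComon G) fun i => ?_) ?_
  · have := hx i
    simp only [Category.assoc, ← Functor.map_comp, lift_fst_assoc, powLift_proj]
    simpa only [lift_fst, powLift_proj] using this
  · rw [Category.assoc, Category.assoc, ← Functor.map_comp, ← Functor.map_comp, lift_snd,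
      lift_snd, ← cancel_mono (cosimplicialComp F G _).hom]
    simpa only [Category.assoc] using hd

section

variable [HasColimits W] (A : AbObj (CommComon V))

/-- The class in the bar construction over `W` of the image of a generalized element of
`A ^ p ⊗ F Δ^p`, restricted along `w`. -/
noncomputable def mapCls {T₀ : CommComon V} {T : CommComon W} (w : T ⟶ (mapCoComon G).obj T₀)
    {p : ℕ} (x : Fin p → (T₀ ⟶ A.X)) (d : T₀ ⟶ (cosimplicial F).obj (SimplexCategory.mk p)) :
    T ⟶ (bar (cosimplicial (F ⋙ G))).obj ((mapAb (mapCoComon G)).obj A) :=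
  barCls (cosimplicial (F ⋙ G)) ((mapAb (mapCoComon G)).obj A)
    (fun i => w ≫ (mapCoComon G).map (x i))
    (w ≫ (mapCoComon G).map d ≫ (cosimplicialComp F G _).hom)

variable {A}

lemma comp_mapCls {T₀ : CommComon V} {T T' : CommComon W} (t : T' ⟶ T)
    (w : T ⟶ (mapCoComon G).obj T₀) {p : ℕ} (x : Fin p → (T₀ ⟶ A.X))
    (d : T₀ ⟶ (cosimplicial F).obj (SimplexCategory.mk p)) :
    t ≫ mapCls F G A w x d = mapCls F G A (t ≫ w) x d := by
  rw [mapCls, comp_barCls, mapCls]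
  congr 1
  · funext i
    exact (Category.assoc _ _ _).symm
  · exact (Category.assoc _ _ _).symm

lemma mapCls_comp {T₀ T₁ : CommComon V} {T : CommComon W} (w : T ⟶ (mapCoComon G).obj T₁)
    (t : T₁ ⟶ T₀) {p : ℕ} (x : Fin p → (T₀ ⟶ A.X))
    (d : T₀ ⟶ (cosimplicial F).obj (SimplexCategory.mk p)) :
    mapCls F G A (w ≫ (mapCoComon G).map t) x d =
      mapCls F G A w (fun i => t ≫ x i) (t ≫ d) := by
  rw [mapCls, mapCls]
  congr 1
  · funext i
    rw [Functor.map_comp]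
    exact Category.assoc _ _ _
  · rw [Functor.map_comp]
    simp only [Category.assoc]

lemma mapCls_segSum {T₀ : CommComon V} {T : CommComon W} (w : T ⟶ (mapCoComon G).obj T₀)
    {p q : SimplexCategory} (θ : p ⟶ q) (x : Fin q.len → (T₀ ⟶ A.X))
    (d : T₀ ⟶ (cosimplicial F).obj p) :
    mapCls F G A (p := p.len) w (segSum θ.toOrderHom x) d =
      mapCls F G A (p := q.len) w x (d ≫ (cosimplicial F).map θ) := by
  have h := barCls_segSum (cosimplicial (F ⋙ G)) ((mapAb (mapCoComon G)).obj A) θ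
    (fun i => w ≫ (mapCoComon G).map (x i))
    (w ≫ (mapCoComon G).map d ≫ (cosimplicialComp F G p).hom)
  rw [mapCls, mapCls]
  refine Eq.trans ?_ (h.trans ?_)
  · congr 1
    funext j
    exact comp_map_segSum (mapCoComon G) w θ.toOrderHom x j
  · congr 1
    rw [Functor.map_comp, Category.assoc, Category.assoc, Category.assoc]
    exact congrArg (fun t => w ≫ (mapCoComon G).map d ≫ t)
      (cosimplicialComp_naturality F G θ).symm

variable (A) in
/-- The image of the universal generalized element of `A ^ p ⊗ F Δ^p`. -/
noncomputable def mapUniv (p : ℕ) :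
    (mapCoComon G).obj (pow A.X p ⊗ (cosimplicial F).obj (SimplexCategory.mk p)) ⟶
      (bar (cosimplicial (F ⋙ G))).obj ((mapAb (mapCoComon G)).obj A) :=
  mapCls F G A (𝟙 _) (fun i => fst _ _ ≫ powProj A.X p i) (snd _ _)

lemma mapCls_eq {T₀ : CommComon V} {T : CommComon W} (w : T ⟶ (mapCoComon G).obj T₀)
    {p : ℕ} (x : Fin p → (T₀ ⟶ A.X)) (d : T₀ ⟶ (cosimplicial F).obj (SimplexCategory.mk p)) :
    mapCls F G A w x d = (w ≫ (mapCoComon G).map (lift (powLift x) d)) ≫ mapUniv F G A p := by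
  rw [mapUniv, comp_mapCls, Category.comp_id, mapCls_comp]
  congr 1
  · funext i
    rw [lift_fst_assoc, powLift_proj]
  · rw [lift_snd]

variable (A) in
lemma map_mapUniv {T₀ : CommComon V} {p : ℕ} (x : Fin p → (T₀ ⟶ A.X))
    (d : T₀ ⟶ (cosimplicial F).obj (SimplexCategory.mk p)) :
    (mapCoComon G).map (lift (powLift x) d) ≫ mapUniv F G A p = mapCls F G A (𝟙 _) x d := by
  rw [mapCls_eq, Category.id_comp]

end

variable [HasColimits V] (A : AbObj (CommComon V))

lemma map_bar_hom_ext [G.IsLeftAdjoint] {Z : W}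
    {f g : ((mapCoComon G).obj ((bar (cosimplicial F)).obj A)).X ⟶ Z}
    (h : ∀ p, homOf ((mapCoComon G).map (barι (cosimplicial F) A p)) ≫ f =
      homOf ((mapCoComon G).map (barι (cosimplicial F) A p)) ≫ g) : f = g :=
  map_coend_hom_ext G (K := realizationBifunctor (cosimplicial F)
    ((simplicialBar (CommComon V)).obj A)) fun p => h p.len

/-- As `G` is a left adjoint, it preserves the coend in `V`; hence there is a morphism in `W` in
the direction opposite to the comparison morphism. -/
lemma exists_map_bar_desc [HasColimits W] [G.IsLeftAdjoint] :
    ∃ k : ((mapCoComon G).obj ((bar (cosimplicial F)).obj A)).X ⟶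
      ((bar (cosimplicial (F ⋙ G))).obj ((mapAb (mapCoComon G)).obj A)).X,
    ∀ p : ℕ, homOf ((mapCoComon G).map (barι (cosimplicial F) A p)) ≫ k =
      homOf (mapUniv F G A p) := by
  have h ⦃p q : SimplexCategory⦄ (θ : p ⟶ q) :
      (mapCoComon G).map (((simplicialBar (CommComon V)).obj A).map θ.op ▷
          (cosimplicial F).obj p) ≫ mapUniv F G A p.len =
        (mapCoComon G).map (((simplicialBar (CommComon V)).obj A).obj (op q) ◁
          (cosimplicial F).map θ) ≫ mapUniv F G A q.len := by
    rw [simplicialBar_map_whiskerRight, simplicialBar_obj_whiskerLeft]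
    exact (map_mapUniv F G A _ _).trans ((mapCls_segSum F G _ θ _ _).trans
      (map_mapUniv F G A _ _).symm)
  obtain ⟨k, hk⟩ := exists_map_coend_desc G (K := realizationBifunctor (cosimplicial F)
    ((simplicialBar (CommComon V)).obj A)) (fun p => homOf (mapUniv F G A p.len))
    fun p q θ => congrArg homOf (h θ)
  exact ⟨k, fun p => hk (SimplexCategory.mk p)⟩

variable [HasColimits W] [MonoidalClosed W]

/-- The comparison morphism is determined by its values on classes: the class over `W` of the image
of a generalized element over `V` goes to the image of its class over `V`. By
`exists_eq_map_comp` and `comp_map_lift_eq` this describes all classes over `W`, without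
ambiguity. -/
lemma exists_barComparisonHom :
    ∃ κ : (bar (cosimplicial (F ⋙ G))).obj ((mapAb (mapCoComon G)).obj A) ⟶
      (mapCoComon G).obj ((bar (cosimplicial F)).obj A),
    ∀ ⦃T₀ : CommComon V⦄ ⦃T : CommComon W⦄ ⦃p : ℕ⦄ (w : T ⟶ (mapCoComon G).obj T₀)
      (x : Fin p → (T₀ ⟶ A.X)) (d : T₀ ⟶ (cosimplicial F).obj (SimplexCategory.mk p)),
      mapCls F G A w x d ≫ κ = w ≫ (mapCoComon G).map (barCls (cosimplicial F) A x d) := by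
  have hrep (T : CommComon W) (p : ℕ) (x : Fin p → (T ⟶ ((mapAb (mapCoComon G)).obj A).X))
      (d : T ⟶ (cosimplicial (F ⋙ G)).obj (SimplexCategory.mk p)) :
      ∃ f : T ⟶ (mapCoComon G).obj ((bar (cosimplicial F)).obj A),
        ∀ (T₀ : CommComon V) (w : T ⟶ (mapCoComon G).obj T₀) (x₀ : Fin p → (T₀ ⟶ A.X))
          (d₀ : T₀ ⟶ (cosimplicial F).obj (SimplexCategory.mk p)),
          x = (fun i => w ≫ (mapCoComon G).map (x₀ i)) →
          d = w ≫ (mapCoComon G).map d₀ ≫ (cosimplicialComp F G _).hom →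
          f = w ≫ (mapCoComon G).map (barCls (cosimplicial F) A x₀ d₀) := by
    obtain ⟨T₁, w₁, x₁, d₁, rfl, rfl⟩ := exists_eq_map_comp F G x d
    refine ⟨w₁ ≫ (mapCoComon G).map (barCls (cosimplicial F) A x₁ d₁), fun T₀ w x₀ d₀ hx hd => ?_⟩
    rw [barCls_eq_barι, barCls_eq_barι, Functor.map_comp, Functor.map_comp, ← Category.assoc,
      ← Category.assoc, comp_map_lift_eq F G (congrFun hx) hd]
  choose f hf using hrep
  obtain ⟨κ, hκ⟩ := exists_bar_desc_left (D := cosimplicial (F ⋙ G))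
    (A := (mapAb (mapCoComon G)).obj A) (C := 𝟙_ _) (fun Q p x d _ => f Q p x d)
    (fun Q Q' t p x d _ => by
      obtain ⟨T₀, w, x, d, rfl, rfl⟩ := exists_eq_map_comp F G x d
      rw [hf Q p _ _ T₀ w x d rfl rfl]
      refine Eq.trans ?_ (hf Q' p _ _ T₀ (t ≫ w) x d ?_ ?_).symm
      · exact (Category.assoc _ _ _).symm
      · funext i
        exact (Category.assoc _ _ _).symm
      · exact (Category.assoc _ _ _).symm)
    (fun Q p q θ x d _ => by
      obtain ⟨T₀, w, x, d, rfl, rfl⟩ := exists_eq_map_comp F G x d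
      refine (hf Q p.len _ _ T₀ w (segSum θ.toOrderHom x) d ?_ rfl).trans
        (Eq.trans ?_ (hf Q q.len _ _ T₀ w x (d ≫ (cosimplicial F).map θ) rfl ?_).symm)
      · exact funext fun j => (comp_map_segSum (mapCoComon G) w θ.toOrderHom x j).symm
      · exact congrArg (fun t => w ≫ (mapCoComon G).map t) (barCls_segSum (cosimplicial F) A θ x d)
      · rw [Functor.map_comp, Category.assoc, Category.assoc, Category.assoc]
        exact congrArg (fun t => w ≫ (mapCoComon G).map d ≫ t)
          (cosimplicialComp_naturality F G θ).symm)
  refine ⟨(ρ_ _).inv ≫ κ, fun T₀ T p w x d => ?_⟩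
  have h₁ := hκ (fun i => w ≫ (mapCoComon G).map (x i))
    (w ≫ (mapCoComon G).map d ≫ (cosimplicialComp F G _).hom) (toUnit T)
  have h₂ : mapCls F G A w x d ≫ (ρ_ _).inv = lift (mapCls F G A w x d) (toUnit T) :=
    CartesianMonoidalCategory.hom_ext _ _ (by simp) (toUnit_unique _ _)
  rw [reassoc_of% h₂]
  exact h₁.trans (hf T p _ _ T₀ w x d rfl rfl)

/-- The canonical morphism from the bar construction over `W` of the image of `A` to the image of
the bar construction over `V`. -/
noncomputable def barComparisonHom :
    (bar (cosimplicial (F ⋙ G))).obj ((mapAb (mapCoComon G)).obj A) ⟶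
      (mapCoComon G).obj ((bar (cosimplicial F)).obj A) :=
  (exists_barComparisonHom F G A).choose

variable {A} in
lemma mapCls_comparisonHom {T₀ : CommComon V} {T : CommComon W} {p : ℕ}
    (w : T ⟶ (mapCoComon G).obj T₀) (x : Fin p → (T₀ ⟶ A.X))
    (d : T₀ ⟶ (cosimplicial F).obj (SimplexCategory.mk p)) :
    mapCls F G A w x d ≫ barComparisonHom F G A =
      w ≫ (mapCoComon G).map (barCls (cosimplicial F) A x d) :=
  (exists_barComparisonHom F G A).choose_spec w x d

variable [G.IsLeftAdjoint]

/-- The comparison morphism is an isomorphism of comonoids because it has an inverse in `W`. -/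
instance isIso_barComparisonHom : IsIso (barComparisonHom F G A) := by
  obtain ⟨k, hk⟩ := exists_map_bar_desc F G A
  have h₀ (p : ℕ) : mapUniv F G A p ≫ barComparisonHom F G A =
      (mapCoComon G).map (barι (cosimplicial F) A p) := by
    rw [mapUniv, mapCls_comparisonHom, ← barι_eq, Category.id_comp]
  have h₁ : homOf (barComparisonHom F G A) ≫ k = 𝟙 _ := by
    refine (covering_geomι (cosimplicial (F ⋙ G)) ((simplicialBar (CommComon W)).obj
      ((mapAb (mapCoComon G)).obj A))).homOf_ext ?_
    rintro _ _ ⟨p⟩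
    obtain ⟨T₀, w, x, d, hx, hd⟩ := exists_eq_map_comp F G (A := A)
      (fun i => fst (pow ((mapAb (mapCoComon G)).obj A).X p.len)
        ((cosimplicial (F ⋙ G)).obj p) ≫ powProj _ p.len i) (snd _ _)
    have h₂ : barι (cosimplicial (F ⋙ G)) ((mapAb (mapCoComon G)).obj A) p.len =
        w ≫ (mapCoComon G).map (lift (powLift x) d) ≫ mapUniv F G A p.len := by
      rw [barι_eq, ← Category.assoc, ← mapCls_eq, mapCls, ← hd]
      exact congrArg (fun t => barCls _ _ t _) hx
    change homOf (barι (cosimplicial (F ⋙ G)) ((mapAb (mapCoComon G)).obj A) p.len) ≫ _ =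
      homOf (barι (cosimplicial (F ⋙ G)) ((mapAb (mapCoComon G)).obj A) p.len) ≫ _
    rw [h₂, Category.comp_id, ← Category.assoc, ← homOf_comp, Category.assoc, Category.assoc, h₀]
    simp only [homOf_comp, Category.assoc, hk]
  have h₂ : k ≫ homOf (barComparisonHom F G A) = 𝟙 _ :=
    map_bar_hom_ext F G A fun p => by
      rw [← Category.assoc, hk, ← homOf_comp, h₀, Category.comp_id]
  have : IsIso (homOf (barComparisonHom F G A)) := ⟨k, h₁, h₂⟩
  exact isIso_of_homOf _

end Comparison

/-! ### Comparison of the iterated bar constructions over two base categories -/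

section AbIso

variable {C : Type u} [Category.{v} C] [CartesianMonoidalCategory C] [BraidedCategory C]

/-- A morphism of abelian group objects whose underlying morphism is an isomorphism is an
isomorphism. -/
noncomputable def AbObj.isoOfIsIso {A B : AbObj C} (f : A ⟶ B) [IsIso f.hom] : A ≅ B where
  hom := f
  inv :=
    { hom := inv f.hom
      isAddMonHom := inferInstanceAs (IsAddMonHom (asIso f.hom).inv) }
  hom_inv_id := AbObj.hom_ext (IsIso.hom_inv_id f.hom)
  inv_hom_id := AbObj.hom_ext (IsIso.inv_hom_id f.hom)

end AbIso

section MapProd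

variable {V : Type u} [Category.{v} V] [MonoidalCategory V] [SymmetricCategory V]
  {W : Type u'} [Category.{v} W] [MonoidalCategory W] [SymmetricCategory W]
  {F : SSet.{v} ⥤ V} [F.Braided] [F.IsLeftAdjoint] [HasColimits V] [MonoidalClosed V]
  (b : BarGroup (cosimplicial F)) {S : RingObjCat (CommComon V)}
  (Φ : CommComon V ⥤ CommComon W) [Φ.Monoidal] {n m k : ℕ}

/-- The image under a cartesian functor `Φ` of the product of the iterated bar construction. -/
noncomputable def BarGroup.mapProd (h : n + m = k) {T : CommComon W}
    (x : T ⟶ Φ.obj (b.deg S n).X) (y : T ⟶ Φ.obj (b.deg S m).X) : T ⟶ Φ.obj (b.deg S k).X :=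
  lift x y ≫ Functor.LaxMonoidal.μ Φ _ _ ≫ Φ.map (b.pairing S n m k h).hom

lemma BarGroup.comp_mapProd (h : n + m = k) {T T' : CommComon W} (t : T' ⟶ T)
    (x : T ⟶ Φ.obj (b.deg S n).X) (y : T ⟶ Φ.obj (b.deg S m).X) :
    t ≫ b.mapProd Φ h x y = b.mapProd Φ h (t ≫ x) (t ≫ y) := by
  rw [mapProd, mapProd, comp_lift_assoc]

lemma BarGroup.mapProd_comp_map (h : n + m = k) {T₀ : CommComon V} {T : CommComon W}
    (w : T ⟶ Φ.obj T₀) (x : T₀ ⟶ (b.deg S n).X) (y : T₀ ⟶ (b.deg S m).X) :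
    b.mapProd Φ h (w ≫ Φ.map x) (w ≫ Φ.map y) = w ≫ Φ.map (b.prod S h x y) :=
  lift_comp_map_μ Φ w x y _

end MapProd

section Comparison

variable {V : Type u} [Category.{v} V] [MonoidalCategory V] [SymmetricCategory V]
  {W : Type u'} [Category.{v} W] [MonoidalCategory W] [SymmetricCategory W]
  {F : SSet.{v} ⥤ V} [F.Braided] {G : V ⥤ W} [G.Braided]

variable (F) in
/-- The components of a class over `W`, together with a further generalized element, come from
generalized elements over `V`. -/
lemma exists_eq_map_comp_right {A B : CommComon V} {T : CommComon W} {n : ℕ} {p : SimplexCategory}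
    (x : Fin n → (T ⟶ (mapCoComon G).obj A)) (d : T ⟶ (cosimplicial (F ⋙ G)).obj p)
    (c : T ⟶ (mapCoComon G).obj B) :
    ∃ (T₀ : CommComon V) (w : T ⟶ (mapCoComon G).obj T₀) (x₀ : Fin n → (T₀ ⟶ A))
      (d₀ : T₀ ⟶ (cosimplicial F).obj p) (c₀ : T₀ ⟶ B),
      x = (fun i => w ≫ (mapCoComon G).map (x₀ i)) ∧
        d = w ≫ (mapCoComon G).map d₀ ≫ (cosimplicialComp F G p).hom ∧
        c = w ≫ (mapCoComon G).map c₀ := by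
  obtain ⟨v, hv⟩ := exists_common_pow (mapCoComon G) x
  obtain ⟨T₀, w, x₀, d₀, c₀, rfl, hd, rfl⟩ := exists_common₃ (mapCoComon G) v
    (d ≫ (cosimplicialComp F G _).inv) c
  refine ⟨T₀, w, fun i => x₀ ≫ powProj A n i, d₀, c₀, funext fun i => ?_, ?_, rfl⟩
  · rw [hv, Functor.map_comp, Category.assoc]
  · rw [← Category.assoc, ← hd, Category.assoc, Iso.inv_hom_id, Category.comp_id]

section

variable [HasColimits W] (b' : BarGroup (cosimplicial (F ⋙ G))) {A : AbObj (CommComon V)}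

variable (F) in
/-- The classes over `W` of the images of generalized elements over `V`, as generalized elements of
abelian group objects. -/
noncomputable def mapElt {T₀ : CommComon V} {T : CommComon W}
    (w : T ⟶ (mapCoComon G).obj T₀) {p : ℕ} (x : Fin p → (T₀ ⟶ A.X))
    (d : T₀ ⟶ (cosimplicial F).obj (SimplexCategory.mk p)) :
    T ⟶ (b'.obj ((mapAb (mapCoComon G)).obj A)).X :=
  mapCls F G A w x d

lemma mapElt_add_mapElt {T₀ : CommComon V} {T : CommComon W}
    (w : T ⟶ (mapCoComon G).obj T₀) {p : ℕ} (x y : Fin p → (T₀ ⟶ A.X))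
    (d : T₀ ⟶ (cosimplicial F).obj (SimplexCategory.mk p)) :
    mapElt F b' w x d + mapElt F b' w y d = mapElt F b' w (fun i => x i + y i) d :=
  (b'.elt_add_elt (A := (mapAb (mapCoComon G)).obj A) _ _ _).trans
    (congrArg (fun t => b'.elt ((mapAb (mapCoComon G)).obj A) t
      (w ≫ (mapCoComon G).map d ≫ (cosimplicialComp F G _).hom))
      (funext fun i => comp_map_add (mapCoComon G) w (x i) (y i)))

lemma exists_eq_mapElt_pair {T : CommComon W} {p : ℕ}
    (x y : Fin p → (T ⟶ ((mapAb (mapCoComon G)).obj A).X))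
    (d : T ⟶ (cosimplicial (F ⋙ G)).obj (SimplexCategory.mk p)) :
    ∃ (T₀ : CommComon V) (w : T ⟶ (mapCoComon G).obj T₀) (x₀ y₀ : Fin p → (T₀ ⟶ A.X))
      (d₀ : T₀ ⟶ (cosimplicial F).obj (SimplexCategory.mk p)),
      b'.elt _ x d = mapElt F b' w x₀ d₀ ∧ b'.elt _ y d = mapElt F b' w y₀ d₀ := by
  obtain ⟨v, hv⟩ := exists_common_pow (mapCoComon G) y
  obtain ⟨T₀, w, x₀, d₀, c₀, rfl, rfl, rfl⟩ := exists_eq_map_comp_right F x d v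
  obtain rfl : y = fun i => w ≫ (mapCoComon G).map (c₀ ≫ powProj A.X p i) := funext fun i => by
    rw [hv, Functor.map_comp, Category.assoc]
  exact ⟨T₀, w, x₀, _, d₀, rfl, rfl⟩

end

variable [HasColimits V] [HasColimits W] [MonoidalClosed W]
  [F.IsLeftAdjoint] [G.IsLeftAdjoint]
  (b : BarGroup (cosimplicial F)) (b' : BarGroup (cosimplicial (F ⋙ G)))
  {A A' : AbObj (CommComon V)}

variable (A) in
/-- The additions over `V` and over `W` are both componentwise on classes with a common second
component. -/
lemma isAddMonHom_barComparisonHom :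
    IsAddMonHom (M' := (b'.obj ((mapAb (mapCoComon G)).obj A)).X)
      (N' := ((mapAb (mapCoComon G)).obj (b.obj A)).X) (barComparisonHom F G A) := by
  let κ : (b'.obj ((mapAb (mapCoComon G)).obj A)).X ⟶ ((mapAb (mapCoComon G)).obj (b.obj A)).X :=
    barComparisonHom F G A
  refine isAddMonHom_of_add κ (b'.obj_pair_hom_ext fun Q p x y d => ?_)
  obtain ⟨T₀, w, x, y, d, hx, hy⟩ := exists_eq_mapElt_pair b' x y d
  let e (x : Fin p → (T₀ ⟶ A.X)) : Q ⟶ ((mapAb (mapCoComon G)).obj (b.obj A)).X :=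
    w ≫ (mapCoComon G).map (b.elt A x d)
  have he (x y : Fin p → (T₀ ⟶ A.X)) : e x + e y = e fun i => x i + y i :=
    (comp_map_add (mapCoComon G) w _ _).trans
      (congrArg (fun t => w ≫ (mapCoComon G).map t) (b.elt_add_elt x y d))
  have hκ (x : Fin p → (T₀ ⟶ A.X)) : mapElt F b' w x d ≫ κ = e x :=
    mapCls_comparisonHom F G w x d
  rw [hx, hy, lift_map_assoc, hκ, hκ, ← Category.assoc]
  change (mapElt F b' w x d + mapElt F b' w y d) ≫ κ = e x + e y
  rw [mapElt_add_mapElt, hκ, he]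

/-- The comparison morphism of the bar constructions, as a morphism of abelian group objects. -/
noncomputable def barComparisonAbHom (A : AbObj (CommComon V)) :
    b'.functor.obj ((mapAb (mapCoComon G)).obj A) ⟶ (mapAb (mapCoComon G)).obj (b.functor.obj A) :=
  AbObj.Hom.mk (A := b'.obj ((mapAb (mapCoComon G)).obj A))
    (B := (mapAb (mapCoComon G)).obj (b.obj A)) (barComparisonHom F G A)
    (isAddMonHom := isAddMonHom_barComparisonHom b b' A)

/-- The bar construction commutes with the functors on abelian group objects induced by `G`. -/
noncomputable def barComparison (A : AbObj (CommComon V)) :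
    b'.functor.obj ((mapAb (mapCoComon G)).obj A) ≅ (mapAb (mapCoComon G)).obj (b.functor.obj A) :=
  haveI : IsIso (barComparisonAbHom b b' A).hom := isIso_barComparisonHom F G A
  AbObj.isoOfIsIso (barComparisonAbHom b b' A)

lemma elt_barComparison {T₀ : CommComon V} {T : CommComon W} {p : ℕ}
    (w : T ⟶ (mapCoComon G).obj T₀) (x : Fin p → (T₀ ⟶ A.X))
    (d : T₀ ⟶ (cosimplicial F).obj (SimplexCategory.mk p)) :
    b'.elt ((mapAb (mapCoComon G)).obj A) (fun i => w ≫ (mapCoComon G).map (x i))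
        (w ≫ (mapCoComon G).map d ≫ (cosimplicialComp F G _).hom) ≫ (barComparison b b' A).hom.hom =
      w ≫ (mapCoComon G).map (b.elt A x d) :=
  mapCls_comparisonHom F G w x d

lemma barComparison_naturality (f : A ⟶ A') :
    b'.functor.map ((mapAb (mapCoComon G)).map f) ≫ (barComparison b b' A').hom =
      (barComparison b b' A).hom ≫ (mapAb (mapCoComon G)).map (b.functor.map f) :=
  AbObj.hom_ext (b'.obj_hom_ext fun Q p x d => by
    obtain ⟨T₀, w, x, d, rfl, rfl⟩ := exists_eq_map_comp F G x d
    have h₁ := elt_barComparison b b' w (fun i => x i ≫ f.hom) d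
    have h₂ := b'.elt_comp_map ((mapAb (mapCoComon G)).map f)
      (fun i => w ≫ (mapCoComon G).map (x i))
      (w ≫ (mapCoComon G).map d ≫ (cosimplicialComp F G _).hom)
    have h₃ := elt_barComparison b b' w x d
    have h₄ : (fun i => (w ≫ (mapCoComon G).map (x i)) ≫ ((mapAb (mapCoComon G)).map f).hom) =
        fun i => w ≫ (mapCoComon G).map (x i ≫ f.hom) := funext fun i =>
      (Category.assoc _ _ _).trans (congrArg (fun t => w ≫ t) (Functor.map_comp _ _ _).symm)
    replace h₂ := h₂.trans (congrArg (fun t => b'.elt ((mapAb (mapCoComon G)).obj A') t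
      (w ≫ (mapCoComon G).map d ≫ (cosimplicialComp F G _).hom)) h₄)
    have h₅ : (w ≫ (mapCoComon G).map (b.elt A x d)) ≫
        (mapCoComon G).map (b.functor.map f).hom =
        w ≫ (mapCoComon G).map (b.elt A' (fun i => x i ≫ f.hom) d) :=
      (Category.assoc _ _ _).trans ((congrArg (fun t => w ≫ t)
        ((Functor.map_comp _ _ _).symm.trans (congrArg _ (b.elt_comp_map f x d)))))
    refine (Category.assoc _ _ _).symm.trans (Eq.trans ?_ (Category.assoc _ _ _))
    exact (congrArg (fun t => t ≫ (barComparison b b' A').hom.hom) h₂).trans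
      (h₁.trans (h₅.symm.trans (congrArg (fun t => t ≫ (mapCoComon G).map (b.functor.map f).hom)
        h₃.symm))))

/-- The iterated bar constructions commute with the functors on abelian group objects induced
by `G`. -/
noncomputable def iterComparison : ∀ (n : ℕ) (A : AbObj (CommComon V)),
    (b'.iter n).obj ((mapAb (mapCoComon G)).obj A) ≅ (mapAb (mapCoComon G)).obj ((b.iter n).obj A)
  | 0, _ => Iso.refl _
  | n + 1, A => b'.functor.mapIso (iterComparison n A) ≪≫ barComparison b b' ((b.iter n).obj A)

lemma iterComparison_naturality (n : ℕ) (f : A ⟶ A') :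
    (b'.iter n).map ((mapAb (mapCoComon G)).map f) ≫ (iterComparison b b' n A').hom =
      (iterComparison b b' n A).hom ≫ (mapAb (mapCoComon G)).map ((b.iter n).map f) := by
  induction n with
  | zero => exact (Category.comp_id _).trans (Category.id_comp _).symm
  | succ n ih =>
    change b'.functor.map ((b'.iter n).map ((mapAb (mapCoComon G)).map f)) ≫
        b'.functor.map (iterComparison b b' n A').hom ≫ (barComparison b b' _).hom =
      (b'.functor.map (iterComparison b b' n A).hom ≫ (barComparison b b' _).hom) ≫
        (mapAb (mapCoComon G)).map (b.functor.map ((b.iter n).map f))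
    rw [Category.assoc, ← barComparison_naturality, ← Functor.map_comp_assoc, ih,
      Functor.map_comp_assoc]

variable (S : RingObjCat (CommComon V))

/-- The comparison isomorphism of the iterated bar constructions of a ring object. -/
noncomputable def degComparison (n : ℕ) : b'.deg ((mapRing (mapCoComon G)).obj S) n ≅
    (mapAb (mapCoComon G)).obj (b.deg S n) :=
  iterComparison b b' n ((ringToAb (CommComon V)).obj S)

/-- The morphism underlying `degComparison`. -/
noncomputable abbrev degComparisonHom (n : ℕ) :
    (b'.deg ((mapRing (mapCoComon G)).obj S) n).X ⟶ (mapCoComon G).obj (b.deg S n).X :=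
  (degComparison b b' S n).hom.hom

variable {S}

/-- The comparison isomorphism on classes, computed from the comparison isomorphism one degree
lower. -/
lemma cls_degComparison {n p : ℕ} {T₀ : CommComon V} {T : CommComon W}
    (w : T ⟶ (mapCoComon G).obj T₀)
    (x : Fin p → (T ⟶ (b'.deg ((mapRing (mapCoComon G)).obj S) n).X))
    (x₀ : Fin p → (T₀ ⟶ (b.deg S n).X))
    (d₀ : T₀ ⟶ (cosimplicial F).obj (SimplexCategory.mk p))
    (hx : ∀ i, x i ≫ degComparisonHom b b' S n = w ≫ (mapCoComon G).map (x₀ i)) :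
    b'.cls ((mapRing (mapCoComon G)).obj S) n x
        (w ≫ (mapCoComon G).map d₀ ≫ (cosimplicialComp F G _).hom) ≫
        degComparisonHom b b' S (n + 1) = w ≫ (mapCoComon G).map (b.cls S n x₀ d₀) := by
  have h₁ := b'.elt_comp_map (degComparison b b' S n).hom x
    (w ≫ (mapCoComon G).map d₀ ≫ (cosimplicialComp F G _).hom)
  have h₂ := elt_barComparison b b' w x₀ d₀
  replace h₁ := h₁.trans (congrArg (fun t => b'.elt ((mapAb (mapCoComon G)).obj (b.deg S n)) t
    (w ≫ (mapCoComon G).map d₀ ≫ (cosimplicialComp F G _).hom)) (funext hx))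
  refine (Category.assoc _ _ _).symm.trans ?_
  exact (congrArg (fun t => t ≫ (barComparison b b' (b.deg S n)).hom.hom) h₁).trans h₂

section Mul

variable [MonoidalClosed V]

lemma prod_zero_comp_degComparisonHom {m : ℕ} {T : CommComon W}
    (x : T ⟶ (b'.deg ((mapRing (mapCoComon G)).obj S) 0).X)
    (y : T ⟶ (b'.deg ((mapRing (mapCoComon G)).obj S) m).X) :
    b'.prod ((mapRing (mapCoComon G)).obj S) (Nat.zero_add m) x y ≫ degComparisonHom b b' S m =
      b.mapProd (mapCoComon G) (Nat.zero_add m) (x ≫ degComparisonHom b b' S 0)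
        (y ≫ degComparisonHom b b' S m) := by
  induction m generalizing T with
  | zero =>
    have h (z : T ⟶ (b'.deg ((mapRing (mapCoComon G)).obj S) 0).X) :
        z ≫ degComparisonHom b b' S 0 = z := Category.comp_id z
    rw [h, h, h]
    rfl
  | succ m ih =>
    have key : b'.prod ((mapRing (mapCoComon G)).obj S) (Nat.zero_add (m + 1)) (fst _ _) (snd _ _) ≫
        degComparisonHom b b' S (m + 1) =
        b.mapProd (mapCoComon G) (Nat.zero_add (m + 1)) (fst _ _ ≫ degComparisonHom b b' S 0)
          (snd _ _ ≫ degComparisonHom b b' S (m + 1)) :=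
      b'.deg_hom_ext_right fun Q p s x d => by
        rw [← Category.assoc]
        simp only [BarGroup.comp_prod, BarGroup.comp_mapProd, lift_fst, lift_snd, lift_fst_assoc,
          lift_snd_assoc, BarGroup.prod_zero_cls]
        obtain ⟨T₀, w, x₀, d₀, s₀, hx, rfl, hs⟩ := exists_eq_map_comp_right F
          (fun i => x i ≫ degComparisonHom b b' S m) d (s ≫ degComparisonHom b b' S 0)
        rw [hs, cls_degComparison b b' w x x₀ d₀ (congrFun hx), BarGroup.mapProd_comp_map,
          BarGroup.prod_zero_cls]
        exact cls_degComparison b b' w _ _ d₀ fun i => by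
          rw [ih, hs, congrFun hx i, BarGroup.mapProd_comp_map]
    simpa [BarGroup.comp_prod, BarGroup.comp_mapProd, ← Category.assoc] using
      congrArg (fun t => lift x y ≫ t) key

/-- The comparison isomorphisms are multiplicative: on classes this is the recursive description of
the multiplications over `V` and over `W`. -/
lemma prod_comp_degComparisonHom {n m k : ℕ} (h : n + m = k) {T : CommComon W}
    (x : T ⟶ (b'.deg ((mapRing (mapCoComon G)).obj S) n).X)
    (y : T ⟶ (b'.deg ((mapRing (mapCoComon G)).obj S) m).X) :
    b'.prod ((mapRing (mapCoComon G)).obj S) h x y ≫ degComparisonHom b b' S k =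
      b.mapProd (mapCoComon G) h (x ≫ degComparisonHom b b' S n)
        (y ≫ degComparisonHom b b' S m) := by
  induction n generalizing k T with
  | zero =>
    obtain rfl : m = k := by omega
    exact prod_zero_comp_degComparisonHom b b' x y
  | succ n ih =>
    obtain ⟨k, rfl⟩ : ∃ l, k = l + 1 := ⟨n + m, by omega⟩
    have h' : n + m = k := by omega
    have key : b'.prod ((mapRing (mapCoComon G)).obj S) h (fst _ _) (snd _ _) ≫
        degComparisonHom b b' S (k + 1) =
        b.mapProd (mapCoComon G) h (fst _ _ ≫ degComparisonHom b b' S (n + 1))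
          (snd _ _ ≫ degComparisonHom b b' S m) :=
      b'.deg_hom_ext_left fun Q p x d y => by
        rw [← Category.assoc]
        simp only [BarGroup.comp_prod, BarGroup.comp_mapProd, lift_fst, lift_snd, lift_fst_assoc,
          lift_snd_assoc, b'.prod_cls h']
        obtain ⟨T₀, w, x₀, d₀, y₀, hx, rfl, hy⟩ := exists_eq_map_comp_right F
          (fun i => x i ≫ degComparisonHom b b' S n) d (y ≫ degComparisonHom b b' S m)
        rw [hy, cls_degComparison b b' w x x₀ d₀ (congrFun hx), BarGroup.mapProd_comp_map, b.prod_cls h']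
        exact cls_degComparison b b' w _ _ d₀ fun i => by
          rw [ih h', hy, congrFun hx i, BarGroup.mapProd_comp_map]
    simpa [BarGroup.comp_prod, BarGroup.comp_mapProd, ← Category.assoc] using
      congrArg (fun t => lift x y ≫ t) key

end Mul

end Comparison

section GrRingIso

variable {C : Type u} [Category.{v} C] [CartesianMonoidalCategory C] [BraidedCategory C]

/-- A morphism of graded ring objects that is an isomorphism in each degree is an isomorphism. -/
def GrRing.isoMk {A B : GrRing C} (e : ∀ n, A.deg n ≅ B.deg n)
    (map_one : A.str.one ≫ (e 0).hom.hom = B.str.one)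
    (map_mul : ∀ {n m k : ℕ} (h : n + m = k),
      A.str.mul h ≫ (e k).hom.hom = ((e n).hom.hom ⊗ₘ (e m).hom.hom) ≫ B.str.mul h) : A ≅ B where
  hom := { hom := fun n => (e n).hom, map_one := map_one, map_mul := map_mul }
  inv :=
    { hom := fun n => (e n).inv
      map_one := by
        have h : (e 0).hom.hom ≫ (e 0).inv.hom = 𝟙 _ := congrArg AbObj.Hom.hom (e 0).hom_inv_id
        rw [← map_one, Category.assoc, h, Category.comp_id]
      map_mul := fun {n m k} h => by
        have h₁ : (e k).hom.hom ≫ (e k).inv.hom = 𝟙 _ := congrArg AbObj.Hom.hom (e k).hom_inv_id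
        have h₂ (n : ℕ) : (e n).inv.hom ≫ (e n).hom.hom = 𝟙 _ :=
          congrArg AbObj.Hom.hom (e n).inv_hom_id
        have h₃ := congrArg (fun t => ((e n).inv.hom ⊗ₘ (e m).inv.hom) ≫ t ≫ (e k).inv.hom)
          (map_mul h)
        simp only [Category.assoc, h₁, Category.comp_id, tensorHom_comp_tensorHom_assoc, h₂,
          id_tensorHom_id, Category.id_comp] at h₃
        exact h₃.symm }
  hom_inv_id := GrRing.Hom.ext (funext fun n => (e n).hom_inv_id)
  inv_hom_id := GrRing.Hom.ext (funext fun n => (e n).inv_hom_id)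

end GrRingIso

section IteratedBar

variable {V : Type u} [Category.{v} V] [MonoidalCategory V] [SymmetricCategory V]
  {W : Type u'} [Category.{v} W] [MonoidalCategory W] [SymmetricCategory W]
  {F : SSet.{v} ⥤ V} [F.Braided] {G : V ⥤ W} [G.Braided]
  [HasColimits V] [HasColimits W] [MonoidalClosed W] [MonoidalClosed V]
  [F.IsLeftAdjoint] [G.IsLeftAdjoint]
  (c : IteratedBar (cosimplicial F)) (c' : IteratedBar (cosimplicial (F ⋙ G)))

/-- The comparison isomorphism of the iterated bar constructions as graded ring objects. -/
noncomputable def ringComparison (S : RingObjCat (CommComon V)) :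
    c'.functor.obj ((mapRing (mapCoComon G)).obj S) ≅
      (mapGrRing (mapCoComon G)).obj (c.functor.obj S) :=
  GrRing.isoMk (fun n => degComparison c.toBarGroup c'.toBarGroup S n)
    (by
      have h₁ := c'.one_eq ((mapRing (mapCoComon G)).obj S)
      have h₂ := congrArg (fun t => Functor.LaxMonoidal.ε (mapCoComon G) ≫ (mapCoComon G).map t)
        (c.one_eq S)
      exact (Category.comp_id (c'.ring ((mapRing (mapCoComon G)).obj S)).one).trans
        (h₁.trans h₂.symm))
    (fun {n m k} h => by
      change (c'.ring _).mul h ≫ degComparisonHom c.toBarGroup c'.toBarGroup S k =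
        (degComparisonHom c.toBarGroup c'.toBarGroup S n ⊗ₘ
          degComparisonHom c.toBarGroup c'.toBarGroup S m) ≫
          Functor.LaxMonoidal.μ (mapCoComon G) _ _ ≫ (mapCoComon G).map ((c.ring S).mul h)
      rw [c'.ring_mul, c.ring_mul]
      have := prod_comp_degComparisonHom c.toBarGroup c'.toBarGroup h
        (fst (c'.deg ((mapRing (mapCoComon G)).obj S) n).X _) (snd _ _)
      rw [BarGroup.prod, lift_fst_snd, Category.id_comp] at this
      refine this.trans ?_
      rw [BarGroup.mapProd]
      congr 1
      exact CartesianMonoidalCategory.hom_ext _ _ (by simp) (by simp))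

/-- The iterated bar construction commutes with the functors induced by `G`. -/
noncomputable def functorComparison : mapRing (mapCoComon G) ⋙ c'.functor ≅
    c.functor ⋙ mapGrRing (mapCoComon G) :=
  NatIso.ofComponents (fun S => ringComparison c c' S) fun f =>
    GrRing.Hom.ext (funext fun n =>
      iterComparison_naturality c.toBarGroup c'.toBarGroup n ((ringToAb (CommComon V)).map f))

end IteratedBar

end HopfBar

theorem corollary3p4 {V : Type u} [Category.{v} V] [MonoidalCategory V] [SymmetricCategory V]
    [MonoidalClosed V] [HasColimits V] (F : SSet.{v} ⥤ V) [F.Braided] [F.IsLeftAdjoint] :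
    Nonempty (Unique (HopfBar.IteratedBar (HopfBar.cosimplicial F))) ∧
      ∀ {W : Type u'} [Category.{v} W] [MonoidalCategory W] [SymmetricCategory W]
        [MonoidalClosed W] [HasColimits W] (G : V ⥤ W) [G.Braided] [G.IsLeftAdjoint]
        (BV : HopfBar.IteratedBar (HopfBar.cosimplicial F)) (BW : HopfBar.IteratedBar (HopfBar.cosimplicial (F ⋙ G))),
        Nonempty (HopfBar.mapRing (HopfBar.mapCoComon G) ⋙ BW.functor ≅
          BV.functor ⋙ HopfBar.mapGrRing (HopfBar.mapCoComon G)) :=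
  ⟨⟨inferInstance⟩, fun _ _ _ BV BW => ⟨HopfBar.functorComparison BV BW⟩⟩
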